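/- Let $G$ be an amenable (Hausdorff) locally compact group, let $\mathrm{C}^*(G)$ be its full group $\mathrm{C}^*$-algebra with the comultiplication $\Delta:\mathrm{C}^*(G)\to M(\mathrm{C}^*(G)\otimes \mathrm{C}^*(G))$ determined by $\Delta(u_g)=u_g\otimes u_g$ for the canonical unitaries $u_g$ ($g\in G$), where $\otimes$ is the spatial tensor product. Identify $\mathrm{C}^*(G)^*$ with the Fourier--Stieltjes algebra $B(G)$: $\omega\in \mathrm{C}^*(G)^*$ corresponds to the continuous function $\varphi$ on $G$ with $\omega(f)=\int_G f(g)\varphi(g)\,dg$ for all $f\in C_c(G)$. For $\omega,\mu\in \mathrm{C}^*(G)^*$ let $\omega\star\mu=(\omega\otimes\mu)\circ\Delta$. A contractive idempotent is a nonzero $\omega\in \mathrm{C}^*(G)^*$ with $\omega\star\omega=\omega$ and $\|\omega\|\le 1$. (1) A functional $\omega\in \mathrm{C}^*(G)^*$ is a contractive idempotent if and only if $\omega=1_C$ for some open coset $C$ (of a subgroup) of $G$; moreover $1_C\in B(G)$ for every open coset $C$ of $G$. (2) Let $\omega=1_C$ with $C$ an open coset, and let $\omega=u.|\omega|_r$ (that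 is, $\omega(a)=|\omega|_r(au)$) be its polar decomposition: $|\omega|_r$ is a positive functional and $u$ is a partial isometry in the von Neumann algebra $\mathrm{C}^*(G)^{**}$ such that $u^*u$ is the support of $|\omega|_r$. Let $|\omega|_l=u.|\omega|_r.u^*$, that is, $|\omega|_l(a)=|\omega|_r(u^*au)$. Then $|\omega|_r$ is a Haar idempotent if and only if $C^{-1}C$ is a normal subgroup of $G$, and $|\omega|_l$ is a Haar idempotent if and only if $C^{-1}C$ is a normal subgroup of $G$. Here a Haar idempotent is an idempotent state of the form $h_{\mathbb H}\circ\pi$, where $\mathbb H$ is a compact quantum group (with faithful Haar state $h_{\mathbb H}$ on $\mathrm{C}(\mathbb H)$ and bounded counit) and $\pi:\mathrm{C}^*(G)\to \mathrm{C}(\mathbb H)$ is a surjective $*$-homomorphism that intertwines the comultiplications. -/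

import Mathlib

open scoped TensorProduct ENNReal CompactlySupported BoundedContinuousFunction Pointwise
open MeasureTheory

universe u

noncomputable section

namespace CIdem

/-! ### Concrete C*-algebras and their spatial tensor products -/

section Concrete

/-- The Hilbert space tensor product. -/
abbrev HTensor (E F : Type*) [NormedAddCommGroup E] [InnerProductSpace ℂ E]
    [NormedAddCommGroup F] [InnerProductSpace ℂ F] : Type _ :=
  UniformSpace.Completion (E ⊗[ℂ] F)

/-- The elementary tensor `x ⊗ y` in the Hilbert space tensor product. -/
def htmul {E F : Type*} [NormedAddCommGroup E] [InnerProductSpace ℂ E]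
    [NormedAddCommGroup F] [InnerProductSpace ℂ F] (x : E) (y : F) : HTensor E F :=
  ((x ⊗ₜ[ℂ] y : E ⊗[ℂ] F) : UniformSpace.Completion (E ⊗[ℂ] F))

/-- The operator `S ⊗ T` on the Hilbert space tensor product. -/
def opTensor {E F : Type*} [NormedAddCommGroup E] [InnerProductSpace ℂ E]
    [NormedAddCommGroup F] [InnerProductSpace ℂ F] (S : E →L[ℂ] E) (T : F →L[ℂ] F) :
    HTensor E F →L[ℂ] HTensor E F :=
  (TensorProduct.mapL S T).completion

theorem opTensor_htmul {E F : Type*} [NormedAddCommGroup E] [InnerProductSpace ℂ E]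
    [NormedAddCommGroup F] [InnerProductSpace ℂ F] (S : E →L[ℂ] E) (T : F →L[ℂ] F)
    (x : E) (y : F) : opTensor S T (htmul x y) = htmul (S x) (T y) := by
  simp [opTensor, htmul]

theorem norm_opTensor_le {E F : Type*} [NormedAddCommGroup E] [InnerProductSpace ℂ E]
    [NormedAddCommGroup F] [InnerProductSpace ℂ F] (S : E →L[ℂ] E) (T : F →L[ℂ] F) :
    ‖opTensor S T‖ ≤ ‖S‖ * ‖T‖ := by
  refine ContinuousLinearMap.opNorm_le_bound _ (by positivity) fun x => ?_
  induction x using UniformSpace.Completion.induction_on with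
  | hp => exact isClosed_le (by fun_prop) (by fun_prop)
  | ih x =>
    rw [opTensor, ContinuousLinearMap.completion_apply_coe, UniformSpace.Completion.norm_coe,
      UniformSpace.Completion.norm_coe]
    exact (ContinuousLinearMap.le_opNorm _ _).trans
      (mul_le_mul_of_nonneg_right (TensorProduct.norm_mapL_le S T) (norm_nonneg _))

variable {ι κ : Type*} (H : ι → Type*) (K : κ → Type*)
  [∀ i, NormedAddCommGroup (H i)] [∀ i, InnerProductSpace ℂ (H i)] [∀ i, CompleteSpace (H i)]
  [∀ j, NormedAddCommGroup (K j)] [∀ j, InnerProductSpace ℂ (K j)] [∀ j, CompleteSpace (K j)]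

/-- The C*-algebra `∏ᵢ B(Hᵢ)` of uniformly bounded families of operators, with the supremum norm. It
acts (block diagonally and faithfully) on the Hilbert sum of the `Hᵢ`. -/
def BProd : Type _ := lp (fun i => H i →L[ℂ] H i) ∞

instance : NonUnitalCStarAlgebra (BProd H) :=
  inferInstanceAs (NonUnitalCStarAlgebra (lp (fun i => H i →L[ℂ] H i) ∞))

/-- The family of all Hilbert space tensor products `Hᵢ ⊗ Kⱼ`. -/
abbrev TensorFam : ι × κ → Type _ := fun p => HTensor (H p.1) (K p.2)

variable {H K}

/-- The `i`-th component of a family of operators. -/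
def BProd.comp (a : BProd H) (i : ι) : H i →L[ℂ] H i :=
  (show lp (fun i => H i →L[ℂ] H i) ∞ from a) i

/-- A uniformly bounded family of operators as an element of `∏ᵢ B(Hᵢ)`. -/
def BProd.mk (T : ∀ i, H i →L[ℂ] H i) (C : ℝ) (hT : ∀ i, ‖T i‖ ≤ C) : BProd H :=
  (⟨T, memℓp_infty ⟨C, by rintro _ ⟨i, rfl⟩; exact hT i⟩⟩ : lp (fun i => H i →L[ℂ] H i) ∞)

theorem BProd.norm_comp_le (a : BProd H) (i : ι) : ‖a.comp i‖ ≤ ‖a‖ :=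
  lp.norm_apply_le_norm (E := fun i => H i →L[ℂ] H i) (by simp) a i

variable (H) in
/-- A concrete C*-algebra: a norm closed *-subalgebra of `∏ᵢ B(Hᵢ)`. -/
structure CAlg where
  toSub : NonUnitalStarSubalgebra ℂ (BProd H)
  isClosed : IsClosed (toSub : Set (BProd H))

/-- The type of elements of a concrete C*-algebra. -/
def CAlg.Elem (A : CAlg H) : Type _ := A.toSub

instance : CoeSort (CAlg H) (Type _) := ⟨CAlg.Elem⟩

instance (A : CAlg H) : NonUnitalCStarAlgebra A.Elem :=
  letI : IsClosed (A.toSub : Set (BProd H)) := A.isClosed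
  inferInstanceAs (NonUnitalCStarAlgebra A.toSub)

/-- The inclusion of a concrete C*-algebra into `∏ᵢ B(Hᵢ)`. -/
def CAlg.Elem.val {A : CAlg H} (a : A) : BProd H := Subtype.val (p := (· ∈ A.toSub)) a

/-- The C*-algebra generated by a set. -/
def CAlg.gen (S : Set (BProd H)) : CAlg H where
  toSub := (NonUnitalStarAlgebra.adjoin ℂ S).topologicalClosure
  isClosed := NonUnitalStarSubalgebra.isClosed_topologicalClosure _

/-- A generator as an element of the generated C*-algebra. -/
def CAlg.of {S : Set (BProd H)} (a : BProd H) (ha : a ∈ S) : CAlg.gen S :=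
  (⟨a, NonUnitalStarSubalgebra.le_topologicalClosure _
    (NonUnitalStarAlgebra.subset_adjoin ℂ _ ha)⟩ :
    (NonUnitalStarAlgebra.adjoin ℂ S).topologicalClosure)

/-- The elementary tensor `a ⊗ b`, the family of all `aᵢ ⊗ bⱼ`. -/
def btmul (a : BProd H) (b : BProd K) : BProd (TensorFam H K) :=
  BProd.mk (fun p => opTensor (a.comp p.1) (b.comp p.2)) (‖a‖ * ‖b‖) fun _ =>
    (norm_opTensor_le _ _).trans (mul_le_mul (a.norm_comp_le _) (b.norm_comp_le _)
      (norm_nonneg _) (norm_nonneg _))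

/-- The spatial (minimal) tensor product of two concrete C*-algebras: the C*-algebra generated by
the elementary tensors on the Hilbert space tensor products. -/
def spatial (A : CAlg H) (B : CAlg K) : CAlg (TensorFam H K) :=
  CAlg.gen {t | ∃ (a : A) (b : B), t = btmul a.val b.val}

/-- The elementary tensor as an element of the spatial tensor product. -/
def stmul {A : CAlg H} {B : CAlg K} (a : A) (b : B) : spatial A B :=
  CAlg.of (btmul a.val b.val) ⟨a, b, rfl⟩

/-- `Φ` is the bounded linear map on `A ⊗ B` determined by `Φ (a ⊗ b) = β a b`. -/
def ExtendsToTensor {A : CAlg H} {B : CAlg K} {X : Type*} [NormedAddCommGroup X] [NormedSpace ℂ X]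
    (β : A → B → X) (Φ : spatial A B →L[ℂ] X) : Prop :=
  ∀ a b, Φ (stmul a b) = β a b

/-- The idealizer `{T | T B ⊆ B, B T ⊆ B}`. When `B` acts nondegenerately on every `Hᵢ`, this is
the multiplier algebra `M(B)`. -/
def multiplier (B : CAlg H) : Submodule ℂ (BProd H) where
  carrier := {T | ∀ b ∈ B.toSub, T * b ∈ B.toSub ∧ b * T ∈ B.toSub}
  add_mem' := fun {S T} hS hT b hb => by
    rw [add_mul, mul_add]
    exact ⟨add_mem (hS b hb).1 (hT b hb).1, add_mem (hS b hb).2 (hT b hb).2⟩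
  zero_mem' := fun b _ => by
    rw [zero_mul, mul_zero]
    exact ⟨zero_mem _, zero_mem _⟩
  smul_mem' := fun c T hT b hb => by
    rw [smul_mul_assoc, mul_smul_comm]
    exact ⟨SMulMemClass.smul_mem c (hT b hb).1, SMulMemClass.smul_mem c (hT b hb).2⟩

/-- `B ⊆ M(B)`. -/
theorem val_mem_multiplier {B : CAlg H} (b : B) : b.val ∈ multiplier B := fun _ hc =>
  ⟨mul_mem (Subtype.prop (p := (· ∈ B.toSub)) b) hc,
    mul_mem hc (Subtype.prop (p := (· ∈ B.toSub)) b)⟩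

/-- `Ψ` is the strict extension to `M(B)` of the bounded linear map `Φ` on `B`: it agrees with `Φ`
on `B`, and it is continuous from the strict topology, i.e. the locally convex topology of the
seminorms `T ↦ ‖T b‖` and `T ↦ ‖b T‖` with `b ∈ B`, to the norm topology. -/
def IsStrictExtension {B : CAlg H} {X : Type*} [NormedAddCommGroup X] [NormedSpace ℂ X]
    (Φ : B →L[ℂ] X) (Ψ : multiplier B →ₗ[ℂ] X) : Prop :=
  (∀ b : B, Ψ ⟨b.val, val_mem_multiplier b⟩ = Φ b) ∧
  ∃ (F : Finset B) (C : ℝ), ∀ T : multiplier B,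
    ‖Ψ T‖ ≤ C * ∑ b ∈ F, (‖(T : BProd H) * b.val‖ + ‖b.val * (T : BProd H)‖)

end Concrete

/-! ### The group C*-algebra and its comultiplication -/

section GroupAlgebra

/-- A strongly continuous unitary representation of `G` on a Hilbert space. (Each `op g` is
an invertible isometry, hence unitary.) -/
structure UnitaryRep (G : Type u) [Group G] [TopologicalSpace G] : Type (u + 1) where
  space : Type u
  [normed : NormedAddCommGroup space]
  [inner : InnerProductSpace ℂ space]
  [complete : CompleteSpace space]
  op : G →* (space →L[ℂ] space)
  norm_op : ∀ g ξ, ‖op g ξ‖ = ‖ξ‖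
  continuous_op : ∀ ξ, Continuous fun g => op g ξ

attribute [instance] UnitaryRep.normed UnitaryRep.inner UnitaryRep.complete

variable {G : Type u} [Group G] [TopologicalSpace G]

theorem norm_opTensor_rep (π σ : UnitaryRep G) (g : G) (x : HTensor π.space σ.space) :
    ‖opTensor (π.op g) (σ.op g) x‖ = ‖x‖ := by
  induction x using UniformSpace.Completion.induction_on with
  | hp => exact isClosed_eq (by fun_prop) (by fun_prop)
  | ih x =>
    rw [opTensor, ContinuousLinearMap.completion_apply_coe, UniformSpace.Completion.norm_coe,
      UniformSpace.Completion.norm_coe]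
    rw [TensorProduct.mapL_apply]
    exact TensorProduct.norm_map (⟨(π.op g).toLinearMap, π.norm_op g⟩ : π.space →ₗᵢ[ℂ] π.space)
      (⟨(σ.op g).toLinearMap, σ.norm_op g⟩ : σ.space →ₗᵢ[ℂ] σ.space) x

theorem continuous_opTensor_rep (π σ : UnitaryRep G) (x : HTensor π.space σ.space) :
    Continuous fun g => opTensor (π.op g) (σ.op g) x := by
  have key : ∀ y : π.space ⊗[ℂ] σ.space,
      Continuous fun g => opTensor (π.op g) (σ.op g) (y : HTensor π.space σ.space) := by
    intro y
    induction y using TensorProduct.induction_on with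
    | zero =>
      refine (continuous_const (y := (0 : HTensor π.space σ.space))).congr fun g => ?_
      rw [UniformSpace.Completion.coe_zero, map_zero]
    | tmul a b =>
      have h : Continuous fun g => (π.op g a) ⊗ₜ[ℂ] (σ.op g b) :=
        TensorProduct.continuous_tmul.comp
          ((π.continuous_op a).prodMk (σ.continuous_op b))
      have h' := (UniformSpace.Completion.continuous_coe (π.space ⊗[ℂ] σ.space)).comp h
      refine h'.congr fun g => ?_
      exact (opTensor_htmul (π.op g) (σ.op g) a b).symm
    | add a b ha hb =>
      refine (ha.add hb).congr fun g => ?_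
      rw [UniformSpace.Completion.coe_add, map_add, Pi.add_apply]
  rw [continuous_iff_continuousAt]
  intro g₀
  rw [Metric.continuousAt_iff']
  intro ε hε
  obtain ⟨y, hy⟩ := UniformSpace.Completion.denseRange_coe.exists_dist_lt x
    (show (0 : ℝ) < ε / 3 by positivity)
  have h1 := Metric.continuousAt_iff'.1 ((key y).continuousAt (x := g₀)) (ε / 3) (by positivity)
  filter_upwards [h1] with g hg
  have e : ∀ s : G, dist (opTensor (π.op s) (σ.op s) x) (opTensor (π.op s) (σ.op s) y) < ε / 3 := by
    intro s
    rw [dist_eq_norm, ← map_sub, norm_opTensor_rep, ← dist_eq_norm]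
    exact hy
  have e1 := e g
  have e2 := e g₀
  rw [dist_comm] at e2
  have t1 := dist_triangle4 (opTensor (π.op g) (σ.op g) x) (opTensor (π.op g) (σ.op g) y)
    (opTensor (π.op g₀) (σ.op g₀) y) (opTensor (π.op g₀) (σ.op g₀) x)
  linarith

/-- The (inner) tensor product `g ↦ π(g) ⊗ σ(g)` of two representations. -/
def UnitaryRep.tensor (π σ : UnitaryRep G) : UnitaryRep G where
  space := HTensor π.space σ.space
  op :=
    { toFun := fun g => opTensor (π.op g) (σ.op g)
      map_one' := by
        ext x
        induction x using UniformSpace.Completion.induction_on with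
        | hp => exact isClosed_eq (by fun_prop) (by fun_prop)
        | ih x =>
          simp [opTensor, ContinuousLinearMap.one_def]
      map_mul' := fun g h => by
        ext x
        induction x using UniformSpace.Completion.induction_on with
        | hp => exact isClosed_eq (by fun_prop) (by fun_prop)
        | ih x =>
          simp [opTensor, TensorProduct.mapL_mul, -TensorProduct.mapL_apply] }
  norm_op := norm_opTensor_rep π σ
  continuous_op := continuous_opTensor_rep π σ

variable [IsTopologicalGroup G] [LocallyCompactSpace G] [MeasurableSpace G] [BorelSpace G]

theorem integrable_rep (π : UnitaryRep G) (f : C_c(G, ℂ)) (ξ : π.space) :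
    Integrable (fun g => f g • π.op g ξ) (Measure.haar : Measure G) :=
  (f.continuous.smul (π.continuous_op ξ)).integrable_of_hasCompactSupport
    f.hasCompactSupport.smul_right

theorem norm_integral_rep_le (π : UnitaryRep G) (f : C_c(G, ℂ)) (ξ : π.space) :
    ‖∫ g, f g • π.op g ξ ∂(Measure.haar : Measure G)‖ ≤
      (∫ g, ‖f g‖ ∂(Measure.haar : Measure G)) * ‖ξ‖ := by
  refine (norm_integral_le_integral_norm _).trans (le_of_eq ?_)
  rw [← integral_mul_const]
  simp [norm_smul, π.norm_op]

/-- The integrated form `π(f) = ∫ f(g) π(g) dg` with respect to left Haar measure. -/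
def UnitaryRep.integrated (π : UnitaryRep G) (f : C_c(G, ℂ)) : π.space →L[ℂ] π.space :=
  LinearMap.mkContinuous
    { toFun := fun ξ => ∫ g, f g • π.op g ξ ∂(Measure.haar : Measure G)
      map_add' := fun ξ η => by
        simp only [map_add, smul_add]
        exact integral_add (integrable_rep π f ξ) (integrable_rep π f η)
      map_smul' := fun c ξ => by
        simp only [map_smul, RingHom.id_apply]
        rw [← integral_smul]
        simp only [smul_comm c] }
    (∫ g, ‖f g‖ ∂(Measure.haar : Measure G)) (norm_integral_rep_le π f)

/-- The image of `f` in the product of the algebras `B(H_π)` over all unitary representations. -/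
def lam (f : C_c(G, ℂ)) : BProd (fun π : UnitaryRep G => π.space) :=
  BProd.mk (fun π => π.integrated f) (∫ g, ‖f g‖ ∂(Measure.haar : Measure G)) fun _ =>
    LinearMap.mkContinuous_norm_le _ (integral_nonneg fun _ => norm_nonneg _) _

variable (G) in
/-- The (full) group C*-algebra `C*(G)`: the C*-algebra generated by the convolution algebra
`C_c(G)` under the norm `‖f‖ = sup_π ‖π(f)‖`, the supremum being over all strongly continuous
unitary representations of `G`. -/
def groupCStar : CAlg (fun π : UnitaryRep G => π.space) :=
  CAlg.gen (Set.range (lam (G := G)))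

/-- The image of `f ∈ C_c(G)` in `C*(G)`. -/
def lamC (f : C_c(G, ℂ)) : groupCStar G :=
  CAlg.of (lam f) ⟨f, rfl⟩

/-- The comultiplication of `C*(G)`, with `Δ(∫ f(g) u_g dg) = ∫ f(g) (u_g ⊗ u_g) dg`. The component
of `Δ(a)` in `B(H_π ⊗ H_σ)` is the image of `a` under the representation `π ⊗ σ`. -/
def comul (a : groupCStar G) :
    BProd (TensorFam (fun π : UnitaryRep G => π.space) (fun π : UnitaryRep G => π.space)) :=
  BProd.mk (fun p => a.val.comp (p.1.tensor p.2)) ‖a.val‖ fun p =>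
    a.val.norm_comp_le (p.1.tensor p.2)

/-- The convolution `ν = ω ⋆ μ = (ω ⊗ μ) ∘ Δ` in `C*(G)^*`, where `ω ⊗ μ` is extended strictly to
the multiplier algebra of `C*(G) ⊗ C*(G)`. -/
def IsConvolution (ω μ ν : StrongDual ℂ (groupCStar G)) : Prop :=
  ∃ Ω : StrongDual ℂ (spatial (groupCStar G) (groupCStar G)),
    ExtendsToTensor (fun a b => ω a * μ b) Ω ∧
    ∃ Ψ : multiplier (spatial (groupCStar G) (groupCStar G)) →ₗ[ℂ] ℂ,
      IsStrictExtension Ω Ψ ∧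
      ∀ a, ∃ h : comul a ∈ multiplier (spatial (groupCStar G) (groupCStar G)),
        Ψ ⟨comul a, h⟩ = ν a

/-- A nonzero functional with `ω ⋆ ω = ω`. -/
def IsIdempotentFunctional (ω : StrongDual ℂ (groupCStar G)) : Prop :=
  ω ≠ 0 ∧ IsConvolution ω ω ω

/-- A contractive idempotent functional. -/
def IsContractiveIdempotent (ω : StrongDual ℂ (groupCStar G)) : Prop :=
  IsIdempotentFunctional ω ∧ ‖ω‖ ≤ 1

/-- The identification `C*(G)^* = B(G)`: the functional `ω` corresponds to the continuous function
`φ` when `ω(f) = ∫ f(g) φ(g) dg` for all `f ∈ C_c(G)`. -/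
def Represents (ω : StrongDual ℂ (groupCStar G)) (φ : G → ℂ) : Prop :=
  Continuous φ ∧ ∀ f : C_c(G, ℂ), ω (lamC f) = ∫ g, f g * φ g ∂(Measure.haar : Measure G)

end GroupAlgebra

/-! ### The bidual and polar decompositions of functionals -/

section Bidual

variable {A : Type*} [NonUnitalCStarAlgebra A]

/-- A positive functional. -/
def IsPositive (φ : StrongDual ℂ A) : Prop :=
  ∀ a, 0 ≤ (φ (star a * a)).re ∧ (φ (star a * a)).im = 0

/-- The functional `x.φ` for `x ∈ A**`: `(x.φ)(a) = φ(a x)`, i.e. `x` applied to `b ↦ φ(a b)`. -/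
def lact (x : StrongDual ℂ (StrongDual ℂ A)) (φ : StrongDual ℂ A) : StrongDual ℂ A :=
  x.comp ((ContinuousLinearMap.compL ℂ A A ℂ φ).comp (ContinuousLinearMap.mul ℂ A))

/-- The functional `φ.x` for `x ∈ A**`: `(φ.x)(a) = φ(x a)`, i.e. `x` applied to `b ↦ φ(b a)`. -/
def ract (φ : StrongDual ℂ A) (x : StrongDual ℂ (StrongDual ℂ A)) : StrongDual ℂ A :=
  x.comp ((ContinuousLinearMap.compL ℂ A A ℂ φ).comp (ContinuousLinearMap.mul ℂ A).flip)

/-- The (Arens) product of `A**`: `(x y)(φ) = x(y.φ)`. For a C*-algebra `A` this is the product of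
the von Neumann algebra `A**`. -/
def bmul (x y : StrongDual ℂ (StrongDual ℂ A)) : StrongDual ℂ (StrongDual ℂ A) :=
  LinearMap.mkContinuous
    { toFun := fun φ => x (lact y φ)
      map_add' := fun φ ψ => by
        rw [← map_add]; congr 1; ext a; simp [lact]
      map_smul' := fun c φ => by
        rw [RingHom.id_apply, ← map_smul]; congr 1; ext a; simp [lact] }
    (‖x‖ * ‖y‖) fun φ => by
      have h : ‖lact y φ‖ ≤ ‖y‖ * ‖φ‖ := by
        refine ContinuousLinearMap.opNorm_le_bound _ (by positivity) fun a => ?_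
        have h1 : ‖φ.comp (ContinuousLinearMap.mul ℂ A a)‖ ≤ ‖φ‖ * ‖a‖ :=
          (ContinuousLinearMap.opNorm_comp_le _ _).trans
            (mul_le_mul_of_nonneg_left (ContinuousLinearMap.opNorm_mul_apply_le ℂ A a)
              (norm_nonneg _))
        calc ‖lact y φ a‖ ≤ ‖y‖ * ‖φ.comp (ContinuousLinearMap.mul ℂ A a)‖ := y.le_opNorm _
          _ ≤ ‖y‖ * (‖φ‖ * ‖a‖) := mul_le_mul_of_nonneg_left h1 (norm_nonneg y)
          _ = ‖y‖ * ‖φ‖ * ‖a‖ := by ring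
      calc ‖x (lact y φ)‖ ≤ ‖x‖ * ‖lact y φ‖ := x.le_opNorm _
        _ ≤ ‖x‖ * (‖y‖ * ‖φ‖) := mul_le_mul_of_nonneg_left h (norm_nonneg x)
        _ = ‖x‖ * ‖y‖ * ‖φ‖ := by ring

/-- The functional `φ^*`, `φ^*(a) = conj (φ(a^*))`. -/
def dstar (φ : StrongDual ℂ A) : StrongDual ℂ A where
  toFun := fun a => star (φ (star a))
  map_add' := fun a b => by simp
  map_smul' := fun c a => by simp
  cont := by fun_prop

/-- The involution of `A**`: `x^*(φ) = conj (x(φ^*))`. -/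
def bstar (x : StrongDual ℂ (StrongDual ℂ A)) : StrongDual ℂ (StrongDual ℂ A) :=
  LinearMap.mkContinuous
    { toFun := fun φ => star (x (dstar φ))
      map_add' := fun φ ψ => by
        rw [← star_add, ← map_add]; congr 2; ext a; simp [dstar]
      map_smul' := fun c φ => by
        have : dstar (c • φ) = star c • dstar φ := by ext a; simp [dstar]
        rw [this]; simp }
    ‖x‖ fun φ => by
      have h : ‖dstar φ‖ ≤ ‖φ‖ :=
        ContinuousLinearMap.opNorm_le_bound _ (norm_nonneg _) fun a => by
          have h1 := φ.le_opNorm (star a)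
          rw [norm_star] at h1
          calc ‖dstar φ a‖ = ‖star (φ (star a))‖ := rfl
            _ ≤ ‖φ‖ * ‖a‖ := by rw [norm_star]; exact h1
      calc ‖star (x (dstar φ))‖ = ‖x (dstar φ)‖ := norm_star _
        _ ≤ ‖x‖ * ‖dstar φ‖ := x.le_opNorm _
        _ ≤ ‖x‖ * ‖φ‖ := mul_le_mul_of_nonneg_left h (norm_nonneg x)

/-- `p` is a projection in `A**`. -/
def IsBProj (p : StrongDual ℂ (StrongDual ℂ A)) : Prop :=
  bmul p p = p ∧ bstar p = p

/-- `τ(p x) = τ(x p) = τ(x)` for all `x ∈ A**`. -/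
def Carries (p : StrongDual ℂ (StrongDual ℂ A)) (τ : StrongDual ℂ A) : Prop :=
  ∀ x : StrongDual ℂ (StrongDual ℂ A), bmul p x τ = x τ ∧ bmul x p τ = x τ

/-- `p ∈ A**` is the support of `τ`: the smallest projection that carries `τ`
(`p ≤ q` means `p q = p`). -/
def IsSupport (p : StrongDual ℂ (StrongDual ℂ A)) (τ : StrongDual ℂ A) : Prop :=
  IsBProj p ∧ Carries p τ ∧ ∀ q, IsBProj q → Carries q τ → bmul p q = p

/-- The polar decomposition `ω = u.τ` of a functional: `τ` is a positive functional, and `u ∈ A**`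
is a partial isometry such that `u^* u` is the support of `τ`. Then `τ` is the right absolute value
of `ω`. -/
def IsPolarDecomposition (ω : StrongDual ℂ A) (u : StrongDual ℂ (StrongDual ℂ A))
    (τ : StrongDual ℂ A) : Prop :=
  IsPositive τ ∧ ω = lact u τ ∧ IsSupport (bmul (bstar u) u) τ

/-- The functional `u.τ.u^*`. If `ω = u.τ` is the polar decomposition, it is the left absolute value
of `ω`. -/
def leftAbs (u : StrongDual ℂ (StrongDual ℂ A)) (τ : StrongDual ℂ A) : StrongDual ℂ A :=
  ract (lact u τ) (bstar u)

end Bidual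

/-! ### Compact quantum groups and Haar idempotents -/

section Quantum

/-- A (coamenable) compact quantum group, given by its unital C*-algebra `C(ℍ)` with comultiplication
and faithful Haar state. -/
structure CompactQuantumGroup : Type (u + 1) where
  idx : Type u
  space : idx → Type u
  [normed : ∀ i, NormedAddCommGroup (space i)]
  [inner : ∀ i, InnerProductSpace ℂ (space i)]
  [complete : ∀ i, CompleteSpace (space i)]
  alg : CAlg space
  one : alg
  one_apply : ∀ i, one.val.comp i = 1
  comul : alg →⋆ₙₐ[ℂ] spatial alg alg
  comul_one : comul one = stmul one one
  /-- `(id ⊗ Δ) Δ = (Δ ⊗ id) Δ`, under the identification of `(ξ₁ ⊗ ξ₂) ⊗ ξ₃`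
  with `ξ₁ ⊗ (ξ₂ ⊗ ξ₃)`. -/
  coassoc : ∃ (Φ : spatial alg alg →L[ℂ] spatial alg (spatial alg alg))
    (Ψ : spatial alg alg →L[ℂ] spatial (spatial alg alg) alg),
    ExtendsToTensor (fun a b => stmul a (comul b)) Φ ∧
    ExtendsToTensor (fun a b => stmul (comul a) b) Ψ ∧
    ∀ (a : alg) (i j k : idx) (ξ₁ η₁ : space i) (ξ₂ η₂ : space j) (ξ₃ η₃ : space k),
      Inner.inner ℂ (htmul η₁ (htmul η₂ η₃))
        ((Φ (comul a)).val.comp (i, (j, k)) (htmul ξ₁ (htmul ξ₂ ξ₃))) =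
      Inner.inner ℂ (htmul (htmul η₁ η₂) η₃)
        ((Ψ (comul a)).val.comp ((i, j), k) (htmul (htmul ξ₁ ξ₂) ξ₃))
  /-- Quantum cancellation laws. -/
  cancel_left : (Submodule.span ℂ {t : spatial alg alg |
    ∃ a b, t = comul a * stmul b one}).topologicalClosure = ⊤
  cancel_right : (Submodule.span ℂ {t : spatial alg alg |
    ∃ a b, t = comul a * stmul one b}).topologicalClosure = ⊤
  /-- The Haar state. -/
  haar : StrongDual ℂ alg
  haar_one : haar one = 1
  haar_pos : ∀ a, 0 ≤ (haar (star a * a)).re ∧ (haar (star a * a)).im = 0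
  haar_faithful : ∀ a, haar (star a * a) = 0 → a = 0
  haar_left : ∃ E : spatial alg alg →L[ℂ] alg,
    ExtendsToTensor (fun a b => haar b • a) E ∧ ∀ a, E (comul a) = haar a • one
  haar_right : ∃ E : spatial alg alg →L[ℂ] alg,
    ExtendsToTensor (fun a b => haar a • b) E ∧ ∀ a, E (comul a) = haar a • one
  /-- A bounded counit: `(ε ⊗ id) Δ = id = (id ⊗ ε) Δ`. -/
  counit : ∃ (ε : StrongDual ℂ alg) (E F : spatial alg alg →L[ℂ] alg),
    ExtendsToTensor (fun a b => ε a • b) E ∧ ExtendsToTensor (fun a b => ε b • a) F ∧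
    ∀ a, E (comul a) = a ∧ F (comul a) = a

attribute [instance] CompactQuantumGroup.normed CompactQuantumGroup.inner
  CompactQuantumGroup.complete

variable {G : Type u} [Group G] [TopologicalSpace G] [IsTopologicalGroup G]
  [LocallyCompactSpace G] [MeasurableSpace G] [BorelSpace G]

/-- `(π ⊗ π) Δ = Δ_ℍ π`, where `π ⊗ π` is extended strictly to the multiplier algebra of
`C*(G) ⊗ C*(G)`. -/
def Intertwines (ℍ : CompactQuantumGroup.{u}) (π : groupCStar G →⋆ₙₐ[ℂ] ℍ.alg) : Prop :=
  ∃ Φ : spatial (groupCStar G) (groupCStar G) →L[ℂ] spatial ℍ.alg ℍ.alg,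
    ExtendsToTensor (fun a b => stmul (π a) (π b)) Φ ∧
    ∃ Ψ : multiplier (spatial (groupCStar G) (groupCStar G)) →ₗ[ℂ] spatial ℍ.alg ℍ.alg,
      IsStrictExtension Φ Ψ ∧
      ∀ a, ∃ h : comul a ∈ multiplier (spatial (groupCStar G) (groupCStar G)),
        Ψ ⟨comul a, h⟩ = ℍ.comul (π a)

/-- A state of `C*(G)` that is idempotent for the convolution. -/
def IsIdempotentState (τ : StrongDual ℂ (groupCStar G)) : Prop :=
  IsPositive τ ∧ ‖τ‖ = 1 ∧ IsIdempotentFunctional τ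

/-- A Haar idempotent: an idempotent state `h_ℍ ∘ π` with `(ℍ, π)` a compact quantum subgroup. -/
def IsHaarIdempotent (τ : StrongDual ℂ (groupCStar G)) : Prop :=
  IsIdempotentState τ ∧ ∃ (ℍ : CompactQuantumGroup.{u}) (π : groupCStar G →⋆ₙₐ[ℂ] ℍ.alg),
    Function.Surjective π ∧ Intertwines ℍ π ∧ ∀ a, τ a = ℍ.haar (π a)

end Quantum

/-! ### Amenability and cosets -/

section Groups

variable (G : Type u) [Group G] [TopologicalSpace G] [IsTopologicalGroup G]

/-- `G` is amenable: there is a left invariant mean on the bounded continuous functions. -/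
def IsAmenable : Prop :=
  ∃ m : (G →ᵇ ℝ) →ₗ[ℝ] ℝ, (∀ f, 0 ≤ f → 0 ≤ m f) ∧ m 1 = 1 ∧
    ∀ (s : G) (f : G →ᵇ ℝ), m (f.compContinuous ⟨fun g => s * g, by fun_prop⟩) = m f

variable {G}

/-- `C` is an open coset of a subgroup of `G`. -/
def IsOpenCoset (C : Set G) : Prop :=
  IsOpen C ∧ ∃ (N : Subgroup G) (s : G), C = s • (N : Set G)

end Groups

end CIdem

end

/-! For (1): convolution of functionals is multiplication of the functions that represent them. A
contractive functional is a coefficient φ(g) = ⟨η, π(g)ξ⟩ with ‖ξ‖, ‖η‖ ≤ 1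
(`exists_eq_vf_of_norm_le_one`), and φ² = φ leaves only the values 0 and 1. By equality in
Cauchy-Schwarz, φ(g) = 1 means that π(g)ξ = η is a unit vector, so φ is the indicator of a coset of
the stabilizer of ξ; the coset is open because φ is continuous and nonempty because ω ≠ 0
(`IsContractiveIdempotent.exists_openCoset`). Conversely, for an open subgroup N, the indicator of
sN is the coefficient ⟨δ_{sN}, λ(g)δ_N⟩ of the quasi-regular representation on ℓ²(G/N)
(`represents_cosetFun`, `isIdempotentFunctional_cosetFun`).

For (2): elements of the bidual act on every representation space. Let ω = u.τ be the functional of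
sN and U the operator of u on ℓ²(G/N). Then τ = u*.ω is the coefficient of U*δ_N against δ_{sN}; it
is positive of norm at least 1, which forces U*δ_N = δ_{sN} and Uδ_{sN} = δ_N. Hence the right
absolute value is the vector state of δ_{sN}, that is 1_{sNs⁻¹}, and the left one is 1_N
(`polar_cosetFun`, `vf_qv_self`). As C⁻¹C = N, and N and sNs⁻¹ are normal together, it remains to
decide when 1_N is a Haar idempotent.

If 1_N = h ∘ θ with h faithful, then {a : aδ_N = 0} is the kernel of θ, hence a two-sided ideal. For
n in N the elements (u_n b - b)* kill δ_N, so they kill every δ_{gN}; thus n fixes every δ_{gN}, and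
N is normal (`normal_of_isHaarIdempotent`).

If N is normal, C*(G) maps onto the reduced C*-algebra of the discrete group G/N, whose canonical
trace is a faithful Haar state that pulls back to 1_N (`isHaarIdempotent_cosetFun_one`). Amenability
enters only in the bounded counit: an invariant mean passes to G/N and gives almost invariant unit
vectors in ℓ²(G/N), whose vector states converge to the counit
(`IsAmenable.hasAlmostInvariantVectors`, `exists_counit`). -/

noncomputable section

namespace CIdem

/-! ### Components of concrete C*-algebras -/

section Components

set_option linter.unusedSectionVars false
set_option linter.unusedSimpArgs false

variable {ι κ : Type*} {H : ι → Type*} {K : κ → Type*}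
  [∀ i, NormedAddCommGroup (H i)] [∀ i, InnerProductSpace ℂ (H i)] [∀ i, CompleteSpace (H i)]
  [∀ j, NormedAddCommGroup (K j)] [∀ j, InnerProductSpace ℂ (K j)] [∀ j, CompleteSpace (K j)]

@[simp] theorem BProd.comp_add (a b : BProd H) (i : ι) :
    (a + b).comp i = a.comp i + b.comp i := rfl

@[simp] theorem BProd.comp_smul (c : ℂ) (a : BProd H) (i : ι) :
    (c • a).comp i = c • a.comp i := rfl

@[simp] theorem BProd.comp_mul (a b : BProd H) (i : ι) :
    (a * b).comp i = a.comp i * b.comp i := rfl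

theorem BProd.ext_comp {a b : BProd H} (h : ∀ i, a.comp i = b.comp i) : a = b :=
  Subtype.ext (funext h)

theorem BProd.norm_le_of_comp {a : BProd H} {C : ℝ} (hC : 0 ≤ C) (h : ∀ i, ‖a.comp i‖ ≤ C) :
    ‖a‖ ≤ C :=
  lp.norm_le_of_forall_le (E := fun i => H i →L[ℂ] H i)
    (f := (show lp (fun i => H i →L[ℂ] H i) ∞ from a)) hC h

/-- The `i`-th component as a bounded linear map. -/
def BProd.compL (i : ι) : BProd H →L[ℂ] (H i →L[ℂ] H i) :=
  LinearMap.mkContinuous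
    { toFun := fun a => a.comp i
      map_add' := fun _ _ => rfl
      map_smul' := fun _ _ => rfl } 1 fun a => by
    rw [one_mul]; exact a.norm_comp_le i

@[simp] theorem BProd.compL_apply (i : ι) (a : BProd H) : BProd.compL i a = a.comp i := rfl

theorem opTensor_mul {E F : Type*} [NormedAddCommGroup E] [InnerProductSpace ℂ E]
    [NormedAddCommGroup F] [InnerProductSpace ℂ F] (S S' : E →L[ℂ] E) (T T' : F →L[ℂ] F) :
    opTensor S T * opTensor S' T' = opTensor (S * S') (T * T') := by
  ext x
  induction x using UniformSpace.Completion.induction_on with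
  | hp => exact isClosed_eq (by fun_prop) (by fun_prop)
  | ih x => simp [opTensor, TensorProduct.mapL_mul, -TensorProduct.mapL_apply]

variable {A : CAlg H} {B : CAlg K}

theorem CAlg.Elem.mem (a : A) : a.val ∈ A.toSub := Subtype.prop (p := (· ∈ A.toSub)) a

/-- An element of a concrete C*-algebra from its underlying family. -/
def CAlg.mkElem (a : BProd H) (ha : a ∈ A.toSub) : A := (⟨a, ha⟩ : A.toSub)

@[simp] theorem CAlg.val_add (a b : A) : (a + b).val = a.val + b.val := rfl
@[simp] theorem CAlg.val_zero : (0 : A).val = 0 := rfl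
@[simp] theorem CAlg.val_smul (c : ℂ) (a : A) : (c • a).val = c • a.val := rfl
@[simp] theorem CAlg.val_mul (a b : A) : (a * b).val = a.val * b.val := rfl
@[simp] theorem CAlg.val_star (a : A) : (star a).val = star a.val := rfl
theorem CAlg.norm_val (a : A) : ‖a.val‖ = ‖a‖ := rfl

theorem CAlg.val_injective {a b : A} (h : a.val = b.val) : a = b := Subtype.ext h

theorem CAlg.val_ext {a b : A} (h : ∀ i, a.val.comp i = b.val.comp i) : a = b :=
  CAlg.val_injective (BProd.ext_comp h)

theorem CAlg.isometry_val : Isometry fun a : A => a.val := fun _ _ => rfl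

/-- The inclusion as a bounded linear map. -/
def CAlg.valL : A →L[ℂ] BProd H :=
  LinearMap.mkContinuous
    { toFun := fun a => a.val
      map_add' := fun _ _ => rfl
      map_smul' := fun _ _ => rfl } 1 fun a => by rw [one_mul]; exact le_of_eq (CAlg.norm_val a)

@[simp] theorem CAlg.valL_apply (a : A) : CAlg.valL a = a.val := rfl

/-- The `i`-th component of an element, as a bounded linear map. -/
def CAlg.compL (i : ι) : A →L[ℂ] (H i →L[ℂ] H i) := (BProd.compL i).comp CAlg.valL

theorem CAlg.norm_comp_le (a : A) (i : ι) : ‖a.val.comp i‖ ≤ ‖a‖ := a.val.norm_comp_le i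

/-- The vector functional `a ↦ ⟨η, aᵢ ξ⟩`. -/
def vf (A : CAlg H) (i : ι) (ξ η : H i) : StrongDual ℂ A :=
  (innerSL ℂ η).comp (((ContinuousLinearMap.apply ℂ (H i)) ξ).comp (CAlg.compL i))

@[simp] theorem vf_apply (i : ι) (ξ η : H i) (a : A) :
    vf A i ξ η a = Inner.inner ℂ η (a.val.comp i ξ) := rfl

theorem norm_vf_apply_le (i : ι) (ξ η : H i) (a : A) : ‖vf A i ξ η a‖ ≤ ‖ξ‖ * ‖η‖ * ‖a‖ := by
  rw [vf_apply]
  calc _ ≤ ‖η‖ * ‖a.val.comp i ξ‖ := norm_inner_le_norm _ _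
    _ ≤ ‖η‖ * (‖a‖ * ‖ξ‖) := by
      gcongr
      exact (ContinuousLinearMap.le_opNorm _ _).trans
        (mul_le_mul_of_nonneg_right (CAlg.norm_comp_le a i) (norm_nonneg _))
    _ = _ := by ring

theorem norm_vf_le (i : ι) (ξ η : H i) : ‖vf A i ξ η‖ ≤ ‖ξ‖ * ‖η‖ :=
  ContinuousLinearMap.opNorm_le_bound _ (by positivity) (norm_vf_apply_le i ξ η)

/-! ### Elementary tensors -/

theorem inner_htmul {E F : Type*} [NormedAddCommGroup E] [InnerProductSpace ℂ E]
    [NormedAddCommGroup F] [InnerProductSpace ℂ F] (x x' : E) (y y' : F) :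
    Inner.inner ℂ (htmul x y) (htmul x' y') = Inner.inner ℂ x x' * Inner.inner ℂ y y' := by
  simp [htmul]

theorem norm_htmul {E F : Type*} [NormedAddCommGroup E] [InnerProductSpace ℂ E]
    [NormedAddCommGroup F] [InnerProductSpace ℂ F] (x : E) (y : F) :
    ‖htmul x y‖ = ‖x‖ * ‖y‖ := by
  simp [htmul]

theorem add_htmul {E F : Type*} [NormedAddCommGroup E] [InnerProductSpace ℂ E]
    [NormedAddCommGroup F] [InnerProductSpace ℂ F] (x x' : E) (y : F) :
    htmul (x + x') y = htmul x y + htmul x' y := by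
  simp [htmul, TensorProduct.add_tmul, UniformSpace.Completion.coe_add]

theorem htmul_add {E F : Type*} [NormedAddCommGroup E] [InnerProductSpace ℂ E]
    [NormedAddCommGroup F] [InnerProductSpace ℂ F] (x : E) (y y' : F) :
    htmul x (y + y') = htmul x y + htmul x y' := by
  simp [htmul, TensorProduct.tmul_add, UniformSpace.Completion.coe_add]

theorem smul_htmul {E F : Type*} [NormedAddCommGroup E] [InnerProductSpace ℂ E]
    [NormedAddCommGroup F] [InnerProductSpace ℂ F] (c : ℂ) (x : E) (y : F) :
    htmul (c • x) y = c • htmul x y := by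
  rw [htmul, ← TensorProduct.smul_tmul', UniformSpace.Completion.coe_smul, htmul]

theorem htmul_smul {E F : Type*} [NormedAddCommGroup E] [InnerProductSpace ℂ E]
    [NormedAddCommGroup F] [InnerProductSpace ℂ F] (c : ℂ) (x : E) (y : F) :
    htmul x (c • y) = c • htmul x y := by
  rw [htmul, TensorProduct.tmul_smul, UniformSpace.Completion.coe_smul, htmul]

/-- The elementary tensor as a bounded bilinear map. -/
def htmulL (E F : Type*) [NormedAddCommGroup E] [InnerProductSpace ℂ E]
    [NormedAddCommGroup F] [InnerProductSpace ℂ F] : E →L[ℂ] F →L[ℂ] HTensor E F :=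
  LinearMap.mkContinuous₂
    (LinearMap.mk₂ ℂ htmul add_htmul smul_htmul htmul_add htmul_smul) 1
    fun x y => by rw [one_mul, ← norm_htmul]; rfl

@[simp] theorem htmulL_apply {E F : Type*} [NormedAddCommGroup E] [InnerProductSpace ℂ E]
    [NormedAddCommGroup F] [InnerProductSpace ℂ F] (x : E) (y : F) :
    htmulL E F x y = htmul x y := rfl

/-- A vector orthogonal to all the elementary tensors vanishes. -/
theorem dense_span_htmul (E F : Type*) [NormedAddCommGroup E] [InnerProductSpace ℂ E]
    [NormedAddCommGroup F] [InnerProductSpace ℂ F] :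
    Dense (Submodule.span ℂ {z : HTensor E F | ∃ x y, z = htmul x y} : Set (HTensor E F)) := by
  intro z
  induction z using UniformSpace.Completion.induction_on with
  | hp => exact isClosed_closure
  | ih z =>
    apply subset_closure
    induction z using TensorProduct.induction_on with
    | zero => rw [UniformSpace.Completion.coe_zero]; exact zero_mem _
    | tmul x y => exact Submodule.subset_span ⟨x, y, rfl⟩
    | add a b ha hb => rw [UniformSpace.Completion.coe_add]; exact add_mem ha hb

theorem opTensor_ext {E F X : Type*} [NormedAddCommGroup E] [InnerProductSpace ℂ E]
    [NormedAddCommGroup F] [InnerProductSpace ℂ F] [NormedAddCommGroup X] [NormedSpace ℂ X]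
    {S T : HTensor E F →L[ℂ] X} (h : ∀ x y, S (htmul x y) = T (htmul x y)) : S = T := by
  refine ContinuousLinearMap.ext_on (dense_span_htmul E F) ?_
  rintro _ ⟨x, y, rfl⟩
  exact h x y

theorem opTensor_star {E F : Type*} [NormedAddCommGroup E] [InnerProductSpace ℂ E]
    [NormedAddCommGroup F] [InnerProductSpace ℂ F] [CompleteSpace E] [CompleteSpace F]
    (S : E →L[ℂ] E) (T : F →L[ℂ] F) :
    star (opTensor S T) = opTensor (star S) (star T) := by
  refine opTensor_ext fun x y => ?_
  refine ext_inner_left ℂ fun v => ?_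
  rw [ContinuousLinearMap.star_eq_adjoint, ContinuousLinearMap.adjoint_inner_right]
  induction v using UniformSpace.Completion.induction_on with
  | hp => exact isClosed_eq (by fun_prop) (by fun_prop)
  | ih v =>
    induction v using TensorProduct.induction_on with
    | zero => simp [UniformSpace.Completion.coe_zero]
    | tmul a b =>
      change Inner.inner ℂ (opTensor S T (htmul a b)) (htmul x y) =
        Inner.inner ℂ (htmul a b) _
      rw [opTensor_htmul, opTensor_htmul, inner_htmul, inner_htmul,
        ContinuousLinearMap.star_eq_adjoint, ContinuousLinearMap.star_eq_adjoint,
        ContinuousLinearMap.adjoint_inner_right, ContinuousLinearMap.adjoint_inner_right]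
    | add a b ha hb =>
      rw [UniformSpace.Completion.coe_add, map_add, inner_add_left, inner_add_left, ha, hb]

@[simp] theorem btmul_comp (a : BProd H) (b : BProd K) (p : ι × κ) :
    (btmul a b).comp p = opTensor (a.comp p.1) (b.comp p.2) := rfl

@[simp] theorem stmul_val (a : A) (b : B) : (stmul a b).val = btmul a.val b.val := rfl

theorem btmul_mul (a a' : BProd H) (b b' : BProd K) :
    btmul a b * btmul a' b' = btmul (a * a') (b * b') :=
  BProd.ext_comp fun _ => opTensor_mul _ _ _ _

theorem btmul_star (a : BProd H) (b : BProd K) : star (btmul a b) = btmul (star a) (star b) :=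
  BProd.ext_comp fun _ => opTensor_star _ _

theorem stmul_mul (a a' : A) (b b' : B) : stmul a b * stmul a' b' = stmul (a * a') (b * b') :=
  CAlg.val_injective (btmul_mul _ _ _ _)

theorem stmul_star (a : A) (b : B) : star (stmul a b) = stmul (star a) (star b) :=
  CAlg.val_injective (btmul_star _ _)

theorem norm_btmul_le (a : BProd H) (b : BProd K) : ‖btmul a b‖ ≤ ‖a‖ * ‖b‖ :=
  BProd.norm_le_of_comp (by positivity) fun _ => (norm_opTensor_le _ _).trans
    (mul_le_mul (a.norm_comp_le _) (b.norm_comp_le _) (norm_nonneg _) (norm_nonneg _))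

/-- The elementary tensor as a bounded bilinear map. -/
def stmulL (A : CAlg H) (B : CAlg K) : A →L[ℂ] B →L[ℂ] spatial A B :=
  LinearMap.mkContinuous₂
    (LinearMap.mk₂ ℂ stmul
      (fun x x' y => CAlg.val_ext fun _ => opTensor_ext fun _ _ => by
        simp [opTensor_htmul, add_htmul, htmul_add, smul_htmul, htmul_smul])
      (fun c x y => CAlg.val_ext fun _ => opTensor_ext fun _ _ => by
        simp [opTensor_htmul, add_htmul, htmul_add, smul_htmul, htmul_smul])
      (fun x y y' => CAlg.val_ext fun _ => opTensor_ext fun _ _ => by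
        simp [opTensor_htmul, add_htmul, htmul_add, smul_htmul, htmul_smul])
      (fun c x y => CAlg.val_ext fun _ => opTensor_ext fun _ _ => by
        simp [opTensor_htmul, add_htmul, htmul_add, smul_htmul, htmul_smul])) 1
    fun x y => by rw [one_mul]; exact norm_btmul_le x.val y.val

@[simp] theorem stmulL_apply (a : A) (b : B) : stmulL A B a b = stmul a b := rfl

theorem stmul_mem_span (a : A) (b : B) :
    stmul a b ∈ Submodule.span ℂ {t : spatial A B | ∃ a b, t = stmul a b} :=
  Submodule.subset_span ⟨a, b, rfl⟩

/-- The spatial tensor product is generated as a C*-algebra, but products and adjoints of elementary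
tensors are elementary tensors, so their linear span is already a *-subalgebra. -/
theorem dense_span_stmul (A : CAlg H) (B : CAlg K) :
    Dense (Submodule.span ℂ {t : spatial A B | ∃ a b, t = stmul a b} : Set (spatial A B)) := by
  set S := Submodule.span ℂ {t : spatial A B | ∃ a b, t = stmul a b} with hS
  let V : NonUnitalStarSubalgebra ℂ (BProd (TensorFam H K)) :=
    { carrier := (fun t : spatial A B => t.val) '' (S : Set (spatial A B))
      add_mem' := by
        rintro _ _ ⟨x, hx, rfl⟩ ⟨y, hy, rfl⟩
        exact ⟨x + y, add_mem hx hy, rfl⟩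
      zero_mem' := ⟨0, zero_mem _, rfl⟩
      smul_mem' := by
        rintro c _ ⟨x, hx, rfl⟩
        exact ⟨c • x, S.smul_mem c hx, rfl⟩
      mul_mem' := by
        rintro _ _ ⟨x, hx, rfl⟩ ⟨y, hy, rfl⟩
        refine ⟨x * y, ?_, rfl⟩
        rw [SetLike.mem_coe] at hx hy ⊢
        induction hx using Submodule.span_induction with
        | zero => rw [zero_mul]; exact zero_mem _
        | add a b _ _ ha hb => rw [add_mul]; exact add_mem ha hb
        | smul c a _ ha => rw [smul_mul_assoc]; exact S.smul_mem c ha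
        | mem a ha =>
          obtain ⟨a, b, rfl⟩ := ha
          induction hy using Submodule.span_induction with
          | zero => rw [mul_zero]; exact zero_mem _
          | add c d _ _ hc hd => rw [mul_add]; exact add_mem hc hd
          | smul c d _ hd => rw [mul_smul_comm]; exact S.smul_mem c hd
          | mem y hy =>
            obtain ⟨c, d, rfl⟩ := hy
            rw [stmul_mul]
            exact stmul_mem_span _ _
      star_mem' := by
        rintro _ ⟨x, hx, rfl⟩
        refine ⟨star x, ?_, rfl⟩
        rw [SetLike.mem_coe] at hx ⊢
        induction hx using Submodule.span_induction with
        | zero => rw [star_zero]; exact zero_mem _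
        | add a b _ _ ha hb => rw [star_add]; exact add_mem ha hb
        | smul c a _ ha => rw [star_smul]; exact S.smul_mem _ ha
        | mem a ha =>
          obtain ⟨a, b, rfl⟩ := ha
          rw [stmul_star]
          exact stmul_mem_span _ _ }
  have hV : NonUnitalStarAlgebra.adjoin ℂ {t | ∃ (a : A) (b : B), t = btmul a.val b.val} ≤ V := by
    apply NonUnitalStarAlgebra.adjoin_le
    rintro _ ⟨a, b, rfl⟩
    exact ⟨stmul a b, stmul_mem_span _ _, rfl⟩
  intro t
  have ht : t.val ∈ closure (V : Set (BProd (TensorFam H K))) :=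
    closure_mono hV t.mem
  change t.val ∈ closure ((fun t : spatial A B => t.val) '' (S : Set (spatial A B))) at ht
  exact ((CAlg.isometry_val (A := spatial A B)).isEmbedding.isInducing.closure_eq_preimage_closure_image _).symm ▸ ht

/-- Bounded linear maps on a spatial tensor product are determined on elementary tensors. -/
theorem spatial_ext {X : Type*} [NormedAddCommGroup X] [NormedSpace ℂ X]
    {S T : spatial A B →L[ℂ] X} (h : ∀ a b, S (stmul a b) = T (stmul a b)) : S = T := by
  refine ContinuousLinearMap.ext_on (dense_span_stmul A B) ?_
  rintro _ ⟨a, b, rfl⟩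
  exact h a b

/-- A closed subspace containing the elementary tensors is everything. -/
theorem spatial_induction {p : Submodule ℂ (spatial A B)} (hp : IsClosed (p : Set (spatial A B)))
    (h : ∀ a b, stmul a b ∈ p) (t : spatial A B) : t ∈ p := by
  have : Submodule.span ℂ {t : spatial A B | ∃ a b, t = stmul a b} ≤ p := by
    rw [Submodule.span_le]
    rintro _ ⟨a, b, rfl⟩
    exact h a b
  exact hp.closure_subset_iff.2 this (dense_span_stmul A B t)

end Components

end CIdem

end

/-! ### Canonical unitaries, approximate units and density of C_c(G) in C*(G). -/

noncomputable section

namespace CIdem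

set_option linter.unusedSectionVars false

/-- The Bochner integral of a function with values in a closed subspace lies in that subspace. -/
theorem integral_mem_submodule {X E : Type*} [MeasurableSpace X] {μ : Measure X}
    [NormedAddCommGroup E] [NormedSpace ℂ E] [CompleteSpace E] {S : Submodule ℂ E}
    (hS : IsClosed (S : Set E)) {F : X → E} (hF : Integrable F μ) (h : ∀ x, F x ∈ S) :
    ∫ x, F x ∂μ ∈ S := by
  have : IsClosed (S : Set E) := hS
  have e := S.mkQL.integral_comp_comm hF
  have h0 : ∀ x, S.mkQL (F x) = 0 := fun x => by simpa using h x
  simp only [h0, integral_zero] at e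
  simpa using e.symm

section GroupAlgebra

variable {G : Type u} [Group G] [TopologicalSpace G] [IsTopologicalGroup G]

/-- Left translation of a compactly supported function. -/
def translate (g : G) (f : C_c(G, ℂ)) : C_c(G, ℂ) where
  toFun := fun h => f (g⁻¹ * h)
  continuous_toFun := f.continuous.comp (by fun_prop)
  hasCompactSupport' := f.hasCompactSupport.comp_homeomorph (Homeomorph.mulLeft g⁻¹)

@[simp] theorem translate_apply (g : G) (f : C_c(G, ℂ)) (h : G) :
    translate g f h = f (g⁻¹ * h) := rfl

theorem UnitaryRep.norm_op_le (π : UnitaryRep G) (g : G) : ‖π.op g‖ ≤ 1 :=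
  ContinuousLinearMap.opNorm_le_bound _ zero_le_one fun x => by rw [π.norm_op, one_mul]

theorem UnitaryRep.op_mul_apply (π : UnitaryRep G) (g h : G) (ξ : π.space) :
    π.op (g * h) ξ = π.op g (π.op h ξ) := by rw [map_mul]; rfl

@[simp] theorem UnitaryRep.op_one_apply (π : UnitaryRep G) (ξ : π.space) :
    π.op 1 ξ = ξ := by rw [map_one]; rfl

theorem UnitaryRep.inner_op_op (π : UnitaryRep G) (g : G) (ξ η : π.space) :
    Inner.inner ℂ (π.op g ξ) (π.op g η) = Inner.inner ℂ ξ η :=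
  LinearIsometry.inner_map_map (⟨(π.op g).toLinearMap, π.norm_op g⟩ : π.space →ₗᵢ[ℂ] π.space) ξ η

theorem UnitaryRep.inner_op_left (π : UnitaryRep G) (g : G) (ξ η : π.space) :
    Inner.inner ℂ (π.op g ξ) η = Inner.inner ℂ ξ (π.op g⁻¹ η) := by
  rw [← π.inner_op_op g ξ, ← π.op_mul_apply, mul_inv_cancel, π.op_one_apply]

/-- The canonical unitary `u_g`. -/
def uop (g : G) : BProd (fun π : UnitaryRep G => π.space) :=
  BProd.mk (fun π => π.op g) 1 fun π => π.norm_op_le g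

@[simp] theorem uop_comp (g : G) (π : UnitaryRep G) : (uop g).comp π = π.op g := rfl

theorem uop_mul (g h : G) : (uop (g * h)) = uop g * uop h :=
  BProd.ext_comp fun π => map_mul π.op g h

theorem norm_uop_mul (g : G) (a : BProd (fun π : UnitaryRep G => π.space)) :
    ‖uop g * a‖ = ‖a‖ := by
  have key : ∀ (g : G) (a : BProd (fun π : UnitaryRep G => π.space)), ‖uop g * a‖ ≤ ‖a‖ := by
    intro g a
    refine BProd.norm_le_of_comp (norm_nonneg _) fun π => ?_
    refine ContinuousLinearMap.opNorm_le_bound _ (norm_nonneg _) fun ξ => ?_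
    change ‖π.op g (a.comp π ξ)‖ ≤ _
    rw [π.norm_op]
    exact (ContinuousLinearMap.le_opNorm _ _).trans
      (mul_le_mul_of_nonneg_right (a.norm_comp_le π) (norm_nonneg _))
  refine le_antisymm (key g a) ?_
  have h := key g⁻¹ (uop g * a)
  rwa [← mul_assoc, ← uop_mul, inv_mul_cancel, show uop (1 : G) * a = a from
    BProd.ext_comp fun π => by ext ξ; simp] at h

variable [LocallyCompactSpace G] [MeasurableSpace G] [BorelSpace G]

/-- Integrability of a continuous function against a compactly supported one. -/
theorem integrable_smul {E : Type*} [NormedAddCommGroup E] [NormedSpace ℂ E]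
    (f : C_c(G, ℂ)) {F : G → E} (hF : Continuous F) :
    Integrable (fun g => f g • F g) (Measure.haar : Measure G) :=
  (f.continuous.smul hF).integrable_of_hasCompactSupport f.hasCompactSupport.smul_right

theorem integrable_star_smul {E : Type*} [NormedAddCommGroup E] [NormedSpace ℂ E]
    (f : C_c(G, ℂ)) {F : G → E} (hF : Continuous F) :
    Integrable (fun g => star (f g) • F g) (Measure.haar : Measure G) := by
  refine (f.continuous.star.smul hF).integrable_of_hasCompactSupport ?_
  refine HasCompactSupport.smul_right ?_
  exact f.hasCompactSupport.comp_left (star_zero ℂ)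

theorem integrable_cc (f : C_c(G, ℂ)) : Integrable f (Measure.haar : Measure G) :=
  f.continuous.integrable_of_hasCompactSupport f.hasCompactSupport

theorem UnitaryRep.integrated_apply (π : UnitaryRep G) (f : C_c(G, ℂ)) (ξ : π.space) :
    π.integrated f ξ = ∫ g, f g • π.op g ξ ∂(Measure.haar : Measure G) := rfl

@[simp] theorem lam_comp (f : C_c(G, ℂ)) (π : UnitaryRep G) :
    (lam f).comp π = π.integrated f := rfl

@[simp] theorem lamC_val (f : C_c(G, ℂ)) : (lamC f).val = lam f := rfl

theorem norm_lam_le (f : C_c(G, ℂ)) :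
    ‖lam f‖ ≤ ∫ g, ‖f g‖ ∂(Measure.haar : Measure G) := by
  have h0 : 0 ≤ ∫ g, ‖f g‖ ∂(Measure.haar : Measure G) := integral_nonneg fun _ => norm_nonneg _
  exact BProd.norm_le_of_comp h0 fun π =>
    LinearMap.mkContinuous_norm_le _ h0 (norm_integral_rep_le π f)

theorem lam_add (f k : C_c(G, ℂ)) : lam (f + k) = lam f + lam k := by
  refine BProd.ext_comp fun π => ?_
  ext ξ
  simp only [lam_comp, BProd.comp_add, add_apply, π.integrated_apply]
  rw [← integral_add (integrable_rep π f ξ) (integrable_rep π k ξ)]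
  simp [add_smul]

theorem lam_smul (c : ℂ) (f : C_c(G, ℂ)) : lam (c • f) = c • lam f := by
  refine BProd.ext_comp fun π => ?_
  ext ξ
  simp only [lam_comp, BProd.comp_smul, smul_apply, π.integrated_apply]
  rw [← integral_smul]
  simp [smul_smul]

/-- `f ↦ lamC f` as a linear map. -/
def lamL : C_c(G, ℂ) →ₗ[ℂ] groupCStar G where
  toFun := lamC
  map_add' := fun f k => CAlg.val_injective (lam_add f k)
  map_smul' := fun c f => CAlg.val_injective (lam_smul c f)

@[simp] theorem lamL_apply (f : C_c(G, ℂ)) : lamL f = lamC f := rfl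

theorem integrated_translate (π : UnitaryRep G) (g : G) (f : C_c(G, ℂ)) (ξ : π.space) :
    π.integrated (translate g f) ξ = π.op g (π.integrated f ξ) := by
  rw [π.integrated_apply, π.integrated_apply,
    ← ContinuousLinearMap.integral_comp_comm _ (integrable_rep π f ξ),
    ← integral_mul_left_eq_self _ g]
  simp

theorem lam_translate (g : G) (f : C_c(G, ℂ)) : lam (translate g f) = uop g * lam f :=
  BProd.ext_comp fun π => by ext ξ; exact integrated_translate π g f ξ

/-- Translation is continuous for the L¹ norm on C_c(G), which dominates the norm of `lam`.
Continuity at 1 suffices, since multiplication by u_{g₀} carries it to g₀. -/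
theorem continuous_uop_mul_lam (f : C_c(G, ℂ)) : Continuous fun g => uop g * lam f := by
  have key : ContinuousAt (fun g => uop g * lam f) (1 : G) := by
    -- For g in a fixed compact neighbourhood of 1, all the translates of f are supported in one
    -- compact set, so the L¹ distance from f depends continuously on g.
    obtain ⟨U, hU, hU1⟩ := exists_compact_mem_nhds (1 : G)
    have hk : IsCompact (U * tsupport f) := hU.mul f.hasCompactSupport
    have h := continuousOn_integral_of_compact_support (μ := (Measure.haar : Measure G))
      (f := fun g h => ‖f (g⁻¹ * h) - f h‖) (s := U) (k := U * tsupport f ∪ tsupport f)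
      (hk.union f.hasCompactSupport)
      (by
        apply Continuous.continuousOn
        have := f.continuous
        simp only [Function.uncurry_def]
        fun_prop)
      (by
        intro g h hg hh
        simp only [Set.mem_union, not_or] at hh
        have h1 : f (g⁻¹ * h) = 0 := by
          by_contra hne
          exact hh.1 ⟨g, hg, g⁻¹ * h, subset_tsupport _ hne, by simp⟩
        have h2 : f h = 0 := by
          by_contra hne
          exact hh.2 (subset_tsupport _ hne)
        simp [h1, h2])
    have h' := (h.continuousAt hU1).tendsto
    simp only [inv_one, one_mul, sub_self, norm_zero, integral_zero] at h'
    have e : (fun g => uop g * lam f) (1 : G) = lam f := by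
      refine BProd.ext_comp fun π => ?_
      ext ξ; simp
    rw [ContinuousAt, show uop (1 : G) * lam f = lam f from e, tendsto_iff_norm_sub_tendsto_zero]
    refine squeeze_zero (fun _ => norm_nonneg _) (fun g => ?_) h'
    have e2 : uop g * lam f - lam f = lam (translate g f - f) := by
      rw [← lam_translate, sub_eq_add_neg, sub_eq_add_neg, lam_add, ← neg_one_smul ℂ f, lam_smul,
        neg_one_smul]
    rw [e2]
    exact norm_lam_le _
  rw [continuous_iff_continuousAt]
  intro g₀
  have h1 : Filter.Tendsto (fun g => g₀⁻¹ * g) (nhds g₀) (nhds 1) := by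
    have : Continuous fun g => g₀⁻¹ * g := by fun_prop
    simpa using this.tendsto g₀
  have h2 := (key.tendsto.comp h1).const_mul (uop g₀)
  simp only [Function.comp_def, ← mul_assoc, ← uop_mul, mul_inv_cancel, one_mul, mul_one] at h2
  exact h2

/-! ### Averaging near the identity -/

theorem exists_bump (U : Set G) (hU : U ∈ nhds (1 : G)) :
    ∃ k : C_c(G, ℂ), (∀ g, k g = ((k g).re : ℂ)) ∧ (∀ g, 0 ≤ (k g).re) ∧
      (∀ g, k g ≠ 0 → g ∈ U) ∧ ∫ g, k g ∂(Measure.haar : Measure G) = 1 := by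
  obtain ⟨V, hVU, hV, hV1⟩ := mem_nhds_iff.1 hU
  obtain ⟨f, hf1, hf0, hfc, hf⟩ := exists_continuous_one_zero_of_isCompact
    (isCompact_singleton (x := (1 : G))) hV.isClosed_compl (by simpa using hV1)
  set I := ∫ g, f g ∂(Measure.haar : Measure G) with hI
  have hIpos : 0 < I := f.continuous.integral_pos_of_hasCompactSupport_nonneg_nonzero hfc
    (fun g => (hf g).1) (x := 1) (by rw [hf1 rfl]; simp)
  refine ⟨⟨⟨fun g => ((I⁻¹ * f g : ℝ) : ℂ), by fun_prop⟩, ?_⟩, fun g => ?_, fun g => ?_,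
    fun g hg => ?_, ?_⟩
  · exact hfc.comp_left (g := fun t : ℝ => ((I⁻¹ * t : ℝ) : ℂ)) (by simp)
  · simp
  · have := (hf g).1
    simp only [CompactlySupportedContinuousMap.coe_mk, ContinuousMap.coe_mk, Complex.ofReal_re]
    positivity
  · by_contra hgU
    apply hg
    have : f g = 0 := hf0 (fun h => hgU (hVU h))
    simp [this]
  · simp only [CompactlySupportedContinuousMap.coe_mk, ContinuousMap.coe_mk]
    rw [integral_complex_ofReal, integral_const_mul, inv_mul_cancel₀ hIpos.ne', Complex.ofReal_one]

open Classical in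
/-- A normalized nonnegative function supported in the neighbourhood `U` of `1`. -/
def bump (U : Set G) : C_c(G, ℂ) :=
  -- The value 0 for other sets is a mere default: along `smallNhds` every U is eventually a
  -- neighbourhood of 1.
  if hU : U ∈ nhds (1 : G) then (exists_bump U hU).choose else 0

theorem bump_real (U : Set G) (g : G) : bump U g = ((bump U g).re : ℂ) := by
  unfold bump
  split_ifs with h
  · exact (exists_bump U h).choose_spec.1 g
  · simp

theorem star_bump (U : Set G) (g : G) : star (bump U g) = bump U g := by
  rw [bump_real]; exact Complex.conj_ofReal _

theorem bump_nonneg (U : Set G) (g : G) : 0 ≤ (bump U g).re := by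
  unfold bump
  split_ifs with h
  · exact (exists_bump U h).choose_spec.2.1 g
  · simp

theorem mem_of_bump_ne_zero {U : Set G} {g : G} (h : bump U g ≠ 0) : g ∈ U := by
  unfold bump at h
  split_ifs at h with hU
  · exact (exists_bump U hU).choose_spec.2.2.1 g h
  · simp at h

theorem integral_bump {U : Set G} (hU : U ∈ nhds (1 : G)) :
    ∫ g, bump U g ∂(Measure.haar : Measure G) = 1 := by
  unfold bump
  rw [dif_pos hU]
  exact (exists_bump U hU).choose_spec.2.2.2

theorem norm_bump (U : Set G) (g : G) : ‖bump U g‖ = (bump U g).re := by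
  conv_lhs => rw [bump_real]
  rw [Complex.norm_real, Real.norm_of_nonneg (bump_nonneg U g)]

theorem integral_norm_bump {U : Set G} (hU : U ∈ nhds (1 : G)) :
    ∫ g, ‖bump U g‖ ∂(Measure.haar : Measure G) = 1 := by
  simp only [norm_bump]
  have h := integral_re (𝕜 := ℂ) (integrable_cc (bump U))
  rw [integral_bump hU] at h
  simpa using h

theorem norm_lam_bump_le (U : Set G) : ‖lam (bump U)‖ ≤ 1 := by
  by_cases hU : U ∈ nhds (1 : G)
  · exact (norm_lam_le _).trans (integral_norm_bump hU).le
  · rw [show bump U = (0 : ℂ) • (0 : C_c(G, ℂ)) by rw [bump, dif_neg hU, smul_zero], lam_smul,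
      zero_smul, norm_zero]
    exact zero_le_one

variable (G) in
/-- The filter of small neighbourhoods of `1`. -/
def smallNhds : Filter (Set G) := (nhds (1 : G)).smallSets ⊓ Filter.principal {U | U ∈ nhds (1 : G)}

instance : (smallNhds G).NeBot := by
  rw [smallNhds, Filter.inf_principal_neBot_iff]
  intro S hS
  obtain ⟨V, hV, hVS⟩ := (nhds (1 : G)).basis_sets.smallSets.mem_iff.1 hS
  exact ⟨V, hVS (Set.mem_powerset subset_rfl), hV⟩

theorem eventually_mem_nhds_one : ∀ᶠ U in smallNhds G, U ∈ nhds (1 : G) :=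
  Filter.mem_inf_of_right (Filter.mem_principal_self _)

theorem eventually_subset {V : Set G} (hV : V ∈ nhds (1 : G)) : ∀ᶠ U in smallNhds G, U ⊆ V :=
  Filter.mem_inf_of_left (Filter.eventually_smallSets_subset.2 hV)

/-- The weight is a probability density supported in U. The bound is not strict, so ε = 0 is
allowed; `integrated_bump_fixed` uses exactly that case. -/
theorem norm_integral_bump_sub_le {E : Type*} [NormedAddCommGroup E] [NormedSpace ℂ E]
    [CompleteSpace E] {F : G → E} (hF : Continuous F) {U : Set G} (hU : U ∈ nhds (1 : G)) {v : E}
    {ε : ℝ} (h : ∀ g ∈ U, ‖F g - v‖ ≤ ε) :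
    ‖∫ g, bump U g • F g ∂(Measure.haar : Measure G) - v‖ ≤ ε := by
  have e : ∫ g, bump U g • F g ∂(Measure.haar : Measure G) - v =
      ∫ g, bump U g • (F g - v) ∂(Measure.haar : Measure G) := by
    simp only [smul_sub]
    rw [integral_sub (integrable_smul _ hF) (integrable_smul _ continuous_const),
      integral_smul_const, integral_bump hU, one_smul]
  rw [e]
  refine (norm_integral_le_of_norm_le ((integrable_cc (bump U)).norm.mul_const ε)
    (Filter.Eventually.of_forall fun g => ?_)).trans ?_
  · rw [norm_smul]
    by_cases hg : bump U g = 0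
    · simp [hg]
    · exact mul_le_mul_of_nonneg_left (h g (mem_of_bump_ne_zero hg)) (norm_nonneg _)
  · rw [integral_mul_const, integral_norm_bump hU, one_mul]

theorem tendsto_bump {E : Type*} [NormedAddCommGroup E] [NormedSpace ℂ E] [CompleteSpace E]
    {F : G → E} (hF : Continuous F) :
    Filter.Tendsto (fun U => ∫ g, bump U g • F g ∂(Measure.haar : Measure G))
      (smallNhds G) (nhds (F 1)) := by
  rw [Metric.tendsto_nhds]
  intro ε hε
  have hV : {g | ‖F g - F 1‖ < ε / 2} ∈ nhds (1 : G) := by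
    have := Metric.tendsto_nhds.1 (hF.tendsto 1) (ε / 2) (by positivity)
    simpa only [dist_eq_norm] using! this
  filter_upwards [eventually_mem_nhds_one, eventually_subset hV] with U hU hUV
  rw [dist_eq_norm]
  exact (norm_integral_bump_sub_le hF hU fun g hg => (hUV hg).le).trans_lt (by linarith)

/-! ### Products with the generators as integrals -/

/-- The map g ↦ u_g is only strongly continuous, so `lam f` itself is not treated as a norm
integral. Against an element b with norm-continuous orbit the integral converges in norm, and then
membership in closed subspaces can be read off from the integrand. -/
theorem lam_mul_eq_integral (f : C_c(G, ℂ)) {b : BProd (fun π : UnitaryRep G => π.space)}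
    (hb : Continuous fun g => uop g * b) :
    lam f * b = ∫ g, f g • (uop g * b) ∂(Measure.haar : Measure G) := by
  refine BProd.ext_comp fun π => ?_
  ext ξ
  have h1 := (BProd.compL (H := fun π : UnitaryRep G => π.space) π).integral_comp_comm
    (integrable_smul f hb)
  rw [BProd.compL_apply] at h1
  rw [← h1]
  have hc : Continuous fun g => BProd.compL (H := fun π : UnitaryRep G => π.space) π (uop g * b) :=
    (BProd.compL (H := fun π : UnitaryRep G => π.space) π).continuous.comp hb
  have h2 := (ContinuousLinearMap.apply ℂ π.space ξ).integral_comp_comm (integrable_smul f hc)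
  simp only [map_smul] at h2 ⊢
  rw [ContinuousLinearMap.apply_apply] at h2
  rw [← h2]
  rfl

theorem adjoint_integrated_apply (π : UnitaryRep G) (f : C_c(G, ℂ)) (ξ : π.space) :
    star (π.integrated f) ξ = ∫ g, star (f g) • π.op g⁻¹ ξ ∂(Measure.haar : Measure G) := by
  have hc : Continuous fun g => π.op g⁻¹ ξ := (π.continuous_op ξ).comp continuous_inv
  refine ext_inner_left ℂ fun v => ?_
  rw [ContinuousLinearMap.star_eq_adjoint, ContinuousLinearMap.adjoint_inner_right,
    ← inner_conj_symm, π.integrated_apply, ← integral_inner (integrable_rep π f v),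
    ← integral_inner (integrable_star_smul f hc), ← integral_conj]
  refine integral_congr_ae (Filter.Eventually.of_forall fun g => ?_)
  simp only [inner_smul_right, map_mul, inner_conj_symm, π.inner_op_left]
  rfl

theorem star_lam_mul_eq_integral (f : C_c(G, ℂ)) {b : BProd (fun π : UnitaryRep G => π.space)}
    (hb : Continuous fun g => uop g * b) :
    star (lam f) * b = ∫ g, star (f g) • (uop g⁻¹ * b) ∂(Measure.haar : Measure G) := by
  have hb' : Continuous fun g : G => uop g⁻¹ * b := hb.comp continuous_inv
  refine BProd.ext_comp fun π => ?_
  ext ξ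
  have h1 := (BProd.compL (H := fun π : UnitaryRep G => π.space) π).integral_comp_comm (integrable_star_smul f hb')
  rw [BProd.compL_apply] at h1
  rw [← h1]
  have hc : Continuous fun g => BProd.compL (H := fun π : UnitaryRep G => π.space) π (uop g⁻¹ * b) :=
    (BProd.compL (H := fun π : UnitaryRep G => π.space) π).continuous.comp hb'
  have h2 := (ContinuousLinearMap.apply ℂ π.space ξ).integral_comp_comm
    (integrable_star_smul f hc)
  simp only [map_smul] at h2 ⊢
  rw [ContinuousLinearMap.apply_apply] at h2
  rw [← h2]
  exact adjoint_integrated_apply π f (b.comp π ξ)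

/-! ### The functions of compact support are dense -/

variable (G) in
/-- The closure of `{lam f}` as a subspace. -/
def lamClosure : Submodule ℂ (BProd (fun π : UnitaryRep G => π.space)) :=
  (LinearMap.range ((CAlg.valL (A := groupCStar G)).toLinearMap.comp (lamL (G := G)))).topologicalClosure

theorem isClosed_lamClosure : IsClosed (lamClosure G : Set (BProd (fun π : UnitaryRep G => π.space))) :=
  Submodule.isClosed_topologicalClosure _

theorem lam_mem_lamClosure (f : C_c(G, ℂ)) : lam f ∈ lamClosure G :=
  Submodule.le_topologicalClosure _ ⟨f, rfl⟩

theorem lamClosure_induction {p : BProd (fun π : UnitaryRep G => π.space) → Prop}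
    (hp : IsClosed {b | p b}) (h : ∀ f, p (lam f)) {b : BProd (fun π : UnitaryRep G => π.space)}
    (hb : b ∈ lamClosure G) : p b := by
  have : b ∈ closure (Set.range (lam (G := G))) := by
    have e : ((LinearMap.range ((CAlg.valL (A := groupCStar G)).toLinearMap.comp (lamL (G := G))) :
        Submodule ℂ (BProd (fun π : UnitaryRep G => π.space))) : Set _) =
        Set.range (lam (G := G)) := by
      ext; simp
    rw [← e]
    exact hb
  exact closure_minimal (by rintro _ ⟨f, rfl⟩; exact h f) hp this

theorem uop_mul_mem_lamClosure (g : G) {b : BProd (fun π : UnitaryRep G => π.space)}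
    (hb : b ∈ lamClosure G) : uop g * b ∈ lamClosure G := by
  refine lamClosure_induction (p := fun b => uop g * b ∈ lamClosure G) ?_ (fun f => ?_) hb
  · exact isClosed_lamClosure.preimage (continuous_const_mul (uop g))
  · rw [← lam_translate]; exact lam_mem_lamClosure _

theorem continuous_uop_mul {b : BProd (fun π : UnitaryRep G => π.space)}
    (hb : b ∈ lamClosure G) : Continuous fun g => uop g * b := by
  refine lamClosure_induction (p := fun b => Continuous fun g => uop g * b) ?_
    continuous_uop_mul_lam hb
  rw [← isSeqClosed_iff_isClosed]
  intro x b hx hxb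
  refine (TendstoUniformly.continuous (F := fun n g => uop g * x n) (p := Filter.atTop) ?_
    (Filter.Frequently.of_forall hx))
  rw [Metric.tendstoUniformly_iff]
  intro ε hε
  filter_upwards [Metric.tendsto_nhds.1 hxb ε hε] with n hn g
  rwa [dist_eq_norm, ← mul_sub, norm_uop_mul, ← dist_eq_norm, dist_comm]

theorem lam_mul_mem_lamClosure (f : C_c(G, ℂ)) {b : BProd (fun π : UnitaryRep G => π.space)}
    (hb : b ∈ lamClosure G) : lam f * b ∈ lamClosure G := by
  rw [lam_mul_eq_integral f (continuous_uop_mul hb)]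
  exact integral_mem_submodule isClosed_lamClosure (integrable_smul f (continuous_uop_mul hb))
    fun g => Submodule.smul_mem _ _ (uop_mul_mem_lamClosure g hb)

theorem star_lam_mul_mem_lamClosure (f : C_c(G, ℂ))
    {b : BProd (fun π : UnitaryRep G => π.space)} (hb : b ∈ lamClosure G) :
    star (lam f) * b ∈ lamClosure G := by
  rw [star_lam_mul_eq_integral f (continuous_uop_mul hb)]
  exact integral_mem_submodule isClosed_lamClosure
    (integrable_star_smul f ((continuous_uop_mul hb).comp continuous_inv))
    fun g => Submodule.smul_mem _ _ (uop_mul_mem_lamClosure g⁻¹ hb)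

theorem uop_one_mul (b : BProd (fun π : UnitaryRep G => π.space)) : uop (1 : G) * b = b :=
  BProd.ext_comp fun π => by ext ξ; simp

theorem tendsto_lam_bump_mul {b : BProd (fun π : UnitaryRep G => π.space)}
    (hb : b ∈ lamClosure G) :
    Filter.Tendsto (fun U => lam (bump U) * b) (smallNhds G) (nhds b) := by
  have h := tendsto_bump (continuous_uop_mul hb)
  rw [uop_one_mul] at h
  simpa only [lam_mul_eq_integral _ (continuous_uop_mul hb)] using h

theorem tendsto_star_lam_bump_mul {b : BProd (fun π : UnitaryRep G => π.space)}
    (hb : b ∈ lamClosure G) :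
    Filter.Tendsto (fun U => star (lam (bump U)) * b) (smallNhds G) (nhds b) := by
  have h := tendsto_bump ((continuous_uop_mul hb).comp continuous_inv)
  simp only [Function.comp_def, inv_one, uop_one_mul] at h
  simpa only [star_lam_mul_eq_integral _ (continuous_uop_mul hb), star_bump] using h

/-- The adjoint of `lam f` is the limit of `star (lam f) * lam (bump U)`, and these products are
norm integrals of translates of `lam (bump U)`. This avoids the modular function. -/
theorem star_mem_lamClosure {b : BProd (fun π : UnitaryRep G => π.space)}
    (hb : b ∈ lamClosure G) : star b ∈ lamClosure G := by
  refine lamClosure_induction (p := fun b => star b ∈ lamClosure G)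
    (isClosed_lamClosure.preimage continuous_star) (fun f => ?_) hb
  have h := (tendsto_star_lam_bump_mul (lam_mem_lamClosure f)).star
  simp only [star_mul, star_star] at h
  exact isClosed_lamClosure.mem_of_tendsto h
    (Filter.Eventually.of_forall fun U => star_lam_mul_mem_lamClosure f (lam_mem_lamClosure _))

theorem mul_mem_lamClosure {a b : BProd (fun π : UnitaryRep G => π.space)}
    (ha : a ∈ lamClosure G) (hb : b ∈ lamClosure G) : a * b ∈ lamClosure G := by
  refine lamClosure_induction (p := fun a => a * b ∈ lamClosure G)
    (isClosed_lamClosure.preimage (continuous_mul_const b))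
    (fun f => lam_mul_mem_lamClosure f hb) ha

/-- The closed linear span of C_c(G) is stable under products and adjoints, so generating a
C*-algebra adds nothing. Every later density argument on C*(G) is a check on `lamC f`. -/
theorem mem_lamClosure_iff {a : BProd (fun π : UnitaryRep G => π.space)} :
    a ∈ lamClosure G ↔ a ∈ (groupCStar G).toSub := by
  constructor
  · intro ha
    exact lamClosure_induction (p := fun a => a ∈ (groupCStar G).toSub) (groupCStar G).isClosed
      (fun f => (lamC f).mem) ha
  · intro ha
    let V : NonUnitalStarSubalgebra ℂ (BProd (fun π : UnitaryRep G => π.space)) :=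
      { lamClosure G with
        mul_mem' := mul_mem_lamClosure
        star_mem' := star_mem_lamClosure }
    have hV : NonUnitalStarAlgebra.adjoin ℂ (Set.range (lam (G := G))) ≤ V := by
      apply NonUnitalStarAlgebra.adjoin_le
      rintro _ ⟨f, rfl⟩
      exact lam_mem_lamClosure f
    exact closure_minimal (show _ ⊆ (lamClosure G : Set _) from hV) isClosed_lamClosure ha

theorem mem_lamClosure (a : groupCStar G) : a.val ∈ lamClosure G := mem_lamClosure_iff.2 a.mem

theorem groupCStar_induction {p : groupCStar G → Prop} (hp : IsClosed {a | p a})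
    (h : ∀ f, p (lamC f)) (a : groupCStar G) : p a := by
  have key : a.val ∈ closure (Set.range (lam (G := G))) :=
    lamClosure_induction (p := fun b => b ∈ closure (Set.range (lam (G := G)))) isClosed_closure
      (fun f => subset_closure ⟨f, rfl⟩) (mem_lamClosure a)
  have e : Set.range (lam (G := G)) = (fun a : groupCStar G => a.val) '' Set.range lamC := by
    rw [← Set.range_comp]; rfl
  rw [e] at key
  have key' : a ∈ closure (Set.range (lamC (G := G))) :=
    ((CAlg.isometry_val (A := groupCStar G)).isEmbedding.isInducing.closure_eq_preimage_closure_image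
      _).symm ▸ key
  exact closure_minimal (by rintro _ ⟨f, rfl⟩; exact h f) hp key'

theorem groupCStar_ext {X : Type*} [TopologicalSpace X] [T2Space X] {S T : groupCStar G → X}
    (hS : Continuous S) (hT : Continuous T) (h : ∀ f, S (lamC f) = T (lamC f)) : S = T :=
  funext fun a => groupCStar_induction (p := fun a => S a = T a) (isClosed_eq hS hT) h a

/-- The product `u_g a`. -/
def umul (g : G) (a : groupCStar G) : groupCStar G :=
  CAlg.mkElem (uop g * a.val)
    (mem_lamClosure_iff.1 (uop_mul_mem_lamClosure g (mem_lamClosure a)))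

theorem continuous_umul (a : groupCStar G) : Continuous fun g => umul g a :=
  (CAlg.isometry_val (A := groupCStar G)).isEmbedding.isInducing.continuous_iff.2
    (continuous_uop_mul (mem_lamClosure a))

theorem norm_umul (g : G) (a : groupCStar G) : ‖umul g a‖ = ‖a‖ := norm_uop_mul g a.val

theorem umul_lamC (g : G) (f : C_c(G, ℂ)) : umul g (lamC f) = lamC (translate g f) :=
  CAlg.val_injective (lam_translate g f).symm

theorem tendsto_val_iff {ι α : Type*} {H : ι → Type*} [∀ i, NormedAddCommGroup (H i)]
    [∀ i, InnerProductSpace ℂ (H i)] [∀ i, CompleteSpace (H i)] {A : CAlg H} {l : Filter α}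
    {x : α → A} {a : A} :
    Filter.Tendsto x l (nhds a) ↔ Filter.Tendsto (fun t => (x t).val) l (nhds a.val) :=
  (CAlg.isometry_val (A := A)).isEmbedding.isInducing.tendsto_nhds_iff

theorem tendsto_bump_mul (a : groupCStar G) :
    Filter.Tendsto (fun U => lamC (bump U) * a) (smallNhds G) (nhds a) :=
  tendsto_val_iff.2 (tendsto_lam_bump_mul (mem_lamClosure a))

theorem tendsto_star_bump_mul (a : groupCStar G) :
    Filter.Tendsto (fun U => star (lamC (bump U)) * a) (smallNhds G) (nhds a) :=
  tendsto_val_iff.2 (tendsto_star_lam_bump_mul (mem_lamClosure a))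

theorem tendsto_mul_bump (a : groupCStar G) :
    Filter.Tendsto (fun U => a * lamC (bump U)) (smallNhds G) (nhds a) := by
  have h := (tendsto_star_bump_mul (star a)).star
  simpa only [star_mul, star_star] using h

theorem norm_lamC_bump_le (U : Set G) : ‖lamC (bump U)‖ ≤ 1 := norm_lam_bump_le U

theorem tendsto_integrated_bump (π : UnitaryRep G) (ξ : π.space) :
    Filter.Tendsto (fun U => π.integrated (bump U) ξ) (smallNhds G) (nhds ξ) := by
  have h := tendsto_bump (π.continuous_op ξ)
  rwa [π.op_one_apply] at h

/-- A bump function in the isotropy of `ξ` fixes `ξ`. -/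
theorem integrated_bump_fixed (π : UnitaryRep G) {U : Set G} (hU : U ∈ nhds (1 : G)) {ξ : π.space}
    (h : ∀ g ∈ U, π.op g ξ = ξ) : π.integrated (bump U) ξ = ξ := by
  have := norm_integral_bump_sub_le (π.continuous_op ξ) hU (v := ξ) (ε := 0)
    fun g hg => by rw [h g hg, sub_self, norm_zero]
  rwa [← π.integrated_apply, norm_le_zero_iff, sub_eq_zero] at this

theorem vf_lamC (π : UnitaryRep G) (ξ η : π.space) (f : C_c(G, ℂ)) :
    vf (groupCStar G) π ξ η (lamC f) =
      ∫ g, f g * Inner.inner ℂ η (π.op g ξ) ∂(Measure.haar : Measure G) := by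
  rw [vf_apply, lamC_val, lam_comp, π.integrated_apply, ← integral_inner (integrable_rep π f ξ)]
  simp only [inner_smul_right]

theorem represents_vf (π : UnitaryRep G) (ξ η : π.space) :
    Represents (vf (groupCStar G) π ξ η) fun g => Inner.inner ℂ η (π.op g ξ) :=
  ⟨continuous_const.inner (π.continuous_op ξ), vf_lamC π ξ η⟩

theorem Represents.functional_unique {ω μ : StrongDual ℂ (groupCStar G)} {φ : G → ℂ}
    (hω : Represents ω φ) (hμ : Represents μ φ) : ω = μ :=
  ContinuousLinearMap.coeFn_injective
    (groupCStar_ext ω.continuous μ.continuous fun f => by rw [hω.2, hμ.2])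

end GroupAlgebra

end CIdem

end

/-! ### Contractive functionals are coefficients of pairs of vectors in the unit ball. -/

noncomputable section

namespace CIdem

set_option linter.unusedSectionVars false

section VectorFunctional

variable {G : Type u} [Group G] [TopologicalSpace G] [IsTopologicalGroup G]
  [LocallyCompactSpace G] [MeasurableSpace G] [BorelSpace G]

variable (G) in
/-- A hermitian positive functional on `C*(G)`. -/
structure PosForm : Type (u + 1) where
  toDual : StrongDual ℂ (groupCStar G)
  herm : ∀ a, toDual (star a) = star (toDual a)
  pos : ∀ a, 0 ≤ (toDual (star a * a)).re

/-- The elements of `C*(G)` that dominate `a* a` for some `a` with `1 ≤ Re ω(a)`. -/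
def dominating (ω : StrongDual ℂ (groupCStar G)) : Set (groupCStar G) :=
  {x | ∃ a : groupCStar G, 1 ≤ (ω a).re ∧
    ∀ (π : UnitaryRep G) (ξ : π.space),
      ‖a.val.comp π ξ‖ ^ 2 ≤ (Inner.inner ℂ ξ (x.val.comp π ξ)).re}

/-- Passing from the elements a*a to everything above them makes the set convex, because a ↦ a*a is
operator convex; this is tested vector by vector, as convexity of the square. -/
theorem convex_dominating (ω : StrongDual ℂ (groupCStar G)) : Convex ℝ (dominating ω) := by
  rintro x ⟨a, ha1, ha⟩ y ⟨b, hb1, hb⟩ s t hs ht hst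
  refine ⟨(s : ℂ) • a + (t : ℂ) • b, ?_, fun π ξ => ?_⟩
  · simp only [map_add, map_smul, Complex.add_re, smul_eq_mul, Complex.re_ofReal_mul]
    nlinarith
  · have e : (s • x + t • y).val = (s : ℂ) • x.val + (t : ℂ) • y.val := rfl
    rw [e]
    simp only [CAlg.val_add, CAlg.val_smul, BProd.comp_add, BProd.comp_smul, add_apply, smul_apply,
      inner_add_right, inner_smul_right, Complex.add_re, Complex.re_ofReal_mul]
    have h1 : ‖(s : ℂ) • a.val.comp π ξ + (t : ℂ) • b.val.comp π ξ‖ ≤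
        s * ‖a.val.comp π ξ‖ + t * ‖b.val.comp π ξ‖ := by
      refine (norm_add_le _ _).trans ?_
      rw [norm_smul, norm_smul, Complex.norm_real, Complex.norm_real, Real.norm_of_nonneg hs,
        Real.norm_of_nonneg ht]
    have h2 : ‖(s : ℂ) • a.val.comp π ξ + (t : ℂ) • b.val.comp π ξ‖ ^ 2 ≤
        (s * ‖a.val.comp π ξ‖ + t * ‖b.val.comp π ξ‖) ^ 2 := by gcongr
    have h3 := ha π ξ
    have h4 := hb π ξ
    have h5 : (s * ‖a.val.comp π ξ‖ + t * ‖b.val.comp π ξ‖) ^ 2 ≤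
        s * ‖a.val.comp π ξ‖ ^ 2 + t * ‖b.val.comp π ξ‖ ^ 2 := by
      obtain rfl : t = 1 - s := by linarith
      nlinarith [mul_nonneg (mul_nonneg hs ht)
        (sq_nonneg (‖a.val.comp π ξ‖ - ‖b.val.comp π ξ‖))]
    nlinarith [mul_le_mul_of_nonneg_left h3 hs, mul_le_mul_of_nonneg_left h4 ht]

/-- A contractive ω with Re ω(a) ≥ 1 needs ‖a‖ ≥ 1, and x ≥ a*a gives ‖a‖² ≤ ‖x‖. So `dominating ω`
misses the open unit ball. -/
theorem one_le_norm_of_dominating {ω : StrongDual ℂ (groupCStar G)} (hω : ‖ω‖ ≤ 1)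
    {x : groupCStar G} (hx : x ∈ dominating ω) : 1 ≤ ‖x‖ := by
  obtain ⟨a, ha1, ha⟩ := hx
  have h1 : 1 ≤ ‖a‖ := by
    calc 1 ≤ (ω a).re := ha1
      _ ≤ ‖ω a‖ := Complex.re_le_norm _
      _ ≤ ‖ω‖ * ‖a‖ := ω.le_opNorm a
      _ ≤ 1 * ‖a‖ := mul_le_mul_of_nonneg_right hω (norm_nonneg _)
      _ = ‖a‖ := one_mul _
  have h2 : ‖a‖ ≤ Real.sqrt ‖x‖ := by
    refine BProd.norm_le_of_comp (Real.sqrt_nonneg _) fun π => ?_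
    refine ContinuousLinearMap.opNorm_le_bound _ (Real.sqrt_nonneg _) fun ξ => ?_
    refine abs_le_of_sq_le_sq' ?_ (by positivity) |>.2
    rw [mul_pow, Real.sq_sqrt (norm_nonneg _)]
    calc ‖a.val.comp π ξ‖ ^ 2 ≤ (Inner.inner ℂ ξ (x.val.comp π ξ)).re := ha π ξ
      _ ≤ ‖Inner.inner ℂ ξ (x.val.comp π ξ)‖ := Complex.re_le_norm _
      _ ≤ ‖ξ‖ * ‖x.val.comp π ξ‖ := norm_inner_le_norm _ _
      _ ≤ ‖ξ‖ * (‖x‖ * ‖ξ‖) := by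
        gcongr
        exact (ContinuousLinearMap.le_opNorm _ _).trans
          (mul_le_mul_of_nonneg_right (CAlg.norm_comp_le x π) (norm_nonneg _))
      _ = ‖x‖ * ‖ξ‖ ^ 2 := by ring
  have h3 : 1 ≤ Real.sqrt ‖x‖ := h1.trans h2
  rwa [Real.one_le_sqrt] at h3

theorem inner_star_mul_self (a : groupCStar G) (π : UnitaryRep G) (ξ : π.space) :
    Inner.inner ℂ ξ ((star a * a).val.comp π ξ) = ((‖a.val.comp π ξ‖ ^ 2 : ℝ) : ℂ) := by
  change Inner.inner ℂ ξ (star (a.val.comp π) (a.val.comp π ξ)) = _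
  rw [ContinuousLinearMap.star_eq_adjoint, ContinuousLinearMap.adjoint_inner_right,
    inner_self_eq_norm_sq_to_K]
  simp

theorem add_mem_dominating {ω : StrongDual ℂ (groupCStar G)} {x : groupCStar G}
    (hx : x ∈ dominating ω) {t : ℝ} (ht : 0 ≤ t) (b : groupCStar G) :
    x + (t : ℂ) • (star b * b) ∈ dominating ω := by
  obtain ⟨a, ha1, ha⟩ := hx
  refine ⟨a, ha1, fun π ξ => (ha π ξ).trans ?_⟩
  have h := inner_star_mul_self b π ξ
  simp only [CAlg.val_add, CAlg.val_smul, BProd.comp_add, BProd.comp_smul, add_apply, smul_apply,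
      inner_add_right, inner_smul_right, Complex.add_re, Complex.re_ofReal_mul, h,
      Complex.ofReal_re]
  have : 0 ≤ t * ‖b.val.comp π ξ‖ ^ 2 := by positivity
  linarith

theorem star_mul_self_mem_dominating {ω : StrongDual ℂ (groupCStar G)} {a : groupCStar G}
    (ha : 1 ≤ (ω a).re) : star a * a ∈ dominating ω :=
  ⟨a, ha, fun π ξ => by rw [inner_star_mul_self, Complex.ofReal_re]⟩

/-- A positive form p with |ω(a)|² ≤ p(a*a) ≤ ‖a‖², obtained by Hahn-Banach separation instead of a
polar decomposition of ω. These two bounds are all that the representation of ω as a coefficient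
needs. -/
theorem exists_posForm (ω : StrongDual ℂ (groupCStar G)) (hω : ‖ω‖ ≤ 1) :
    ∃ p : PosForm G, (∀ a, (p.toDual (star a * a)).re ≤ ‖a‖ ^ 2) ∧
      ∀ a, ‖ω a‖ ^ 2 ≤ (p.toDual (star a * a)).re := by
  by_cases h0 : ω = 0
  · refine ⟨⟨0, by simp, by simp⟩, fun a => ?_, fun a => by simp [h0]⟩
    simp only [zero_apply, Complex.zero_re]; positivity
  obtain ⟨a₀, ha₀⟩ : ∃ a, ω a ≠ 0 := by
    by_contra h
    push Not at h
    exact h0 (ContinuousLinearMap.ext h)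
  have hdisj : Disjoint (Metric.ball (0 : groupCStar G) 1) (dominating ω) := by
    rw [Set.disjoint_left]
    intro x hx hx'
    rw [mem_ball_zero_iff] at hx
    exact absurd (one_le_norm_of_dominating hω hx') (not_le.2 hx)
  -- Re f < c on the open unit ball and Re f ≥ c on `dominating ω`. The first will give the upper
  -- bound for p, the second, applied to a / ω(a), the lower bound.
  obtain ⟨f, c, hf1, hf2⟩ := RCLike.geometric_hahn_banach_open (𝕜 := ℂ)
    (convex_ball (0 : groupCStar G) 1) Metric.isOpen_ball (convex_dominating ω) hdisj
  simp only [RCLike.re_eq_complex_re] at hf1 hf2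
  have hc : 0 < c := by simpa using hf1 0 (Metric.mem_ball_self one_pos)
  have hmem : ∀ a, ω a ≠ 0 → star ((ω a)⁻¹ • a) * ((ω a)⁻¹ • a) ∈ dominating ω := fun a ha =>
    star_mul_self_mem_dominating (by simp [ha])
  have hpos : ∀ b, 0 ≤ (f (star b * b)).re := by
    intro b
    by_contra hb
    push Not at hb
    have hx := hmem a₀ ha₀
    set x := star ((ω a₀)⁻¹ • a₀) * ((ω a₀)⁻¹ • a₀)
    -- The set is stable under adding t b*b with t ≥ 0, so a negative value of Re f(b*b) would push
    -- Re f below c. The t chosen for `h3` makes the right-hand side vanish.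
    have h1 : ∀ t : ℝ, 0 ≤ t → c ≤ (f x).re + t * (f (star b * b)).re := by
      intro t ht
      have := hf2 _ (add_mem_dominating hx ht b)
      simpa only [map_add, map_smul, smul_eq_mul, Complex.add_re, Complex.re_ofReal_mul] using this
    have h2 := hf2 x hx
    have h3 := h1 ((f x).re / -(f (star b * b)).re) (div_nonneg (hc.le.trans h2) (by linarith))
    have h4 : (f x).re / -(f (star b * b)).re * (f (star b * b)).re = -(f x).re := by
      rw [div_neg, neg_mul, div_mul_cancel₀ _ hb.ne]
    linarith
  have hbd : ∀ x, (f x).re ≤ c * ‖x‖ := by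
    intro x
    refine le_of_forall_pos_le_add fun ε hε => ?_
    have hr : 0 < ‖x‖ + ε / c := by positivity
    have h := hf1 (((‖x‖ + ε / c)⁻¹ : ℝ) • x) (by
      rw [mem_ball_zero_iff, norm_smul, Real.norm_of_nonneg (by positivity), inv_mul_lt_one₀ hr]
      have : 0 < ε / c := by positivity
      linarith)
    rw [← Complex.coe_smul, map_smul, smul_eq_mul, Complex.re_ofReal_mul, inv_mul_lt_iff₀ hr] at h
    have e : (‖x‖ + ε / c) * c = c * ‖x‖ + ε := by field_simp
    linarith
  -- The form is the hermitian part of f divided by c.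
  have hre : ∀ a, ((((2 * c)⁻¹ : ℝ) : ℂ) • (f + dstar f)) (star a * a) =
      ((c⁻¹ * (f (star a * a)).re : ℝ) : ℂ) := by
    intro a
    change (((2 * c)⁻¹ : ℝ) : ℂ) * (f (star a * a) + star (f (star (star a * a)))) = _
    rw [star_mul, star_star, Complex.star_def, Complex.add_conj]
    push_cast
    field_simp
  refine ⟨⟨(((2 * c)⁻¹ : ℝ) : ℂ) • (f + dstar f), fun a => ?_, fun a => ?_⟩, fun a => ?_,
    fun a => ?_⟩
  · change (((2 * c)⁻¹ : ℝ) : ℂ) * (f (star a) + star (f (star (star a)))) =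
      star ((((2 * c)⁻¹ : ℝ) : ℂ) * (f a + star (f (star a))))
    rw [star_mul', star_add, star_star, star_star, add_comm, Complex.star_def, Complex.conj_ofReal]
  · rw [hre, Complex.ofReal_re]
    have := hpos a
    positivity
  · rw [hre, Complex.ofReal_re, inv_mul_le_iff₀ hc, sq, ← CStarRing.norm_star_mul_self]
    exact hbd _
  · rw [hre, Complex.ofReal_re]
    by_cases ha : ω a = 0
    · have h1 := hpos a
      have h2 : 0 ≤ c⁻¹ * (f (star a * a)).re := by positivity
      simpa [ha] using h2
    · have h := hf2 _ (hmem a ha)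
      rw [star_smul, smul_mul_smul_comm, map_smul, smul_eq_mul, Complex.star_def,
        Complex.conj_mul', ← Complex.ofReal_pow, Complex.re_ofReal_mul, norm_inv, inv_pow] at h
      have h1 : 0 < ‖ω a‖ ^ 2 := by positivity
      rw [inv_mul_eq_div, le_div_iff₀ h1] at h
      rw [le_inv_mul_iff₀ hc]
      exact h

/-- The vectors with continuous orbit under an isometric action form a closed set. -/
theorem isClosed_continuous_orbit {X E : Type*} [TopologicalSpace X] [NormedAddCommGroup E]
    [NormedSpace ℂ E] (T : X → E →L[ℂ] E) (hT : ∀ g x, ‖T g x‖ = ‖x‖) :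
    IsClosed {x | Continuous fun g => T g x} := by
  rw [← isSeqClosed_iff_isClosed]
  intro x b hx hxb
  refine TendstoUniformly.continuous (F := fun n g => T g (x n)) (p := Filter.atTop) ?_
    (Filter.Frequently.of_forall hx)
  rw [Metric.tendstoUniformly_iff]
  intro ε hε
  filter_upwards [Metric.tendsto_nhds.1 hxb ε hε] with n hn g
  rwa [dist_eq_norm, ← map_sub, hT, ← dist_eq_norm, dist_comm]

/-! ### The GNS representation on the completion of `C_c(G)` -/

/-- The space `C_c(G)` with the semi-inner product `⟨f, k⟩ = p(f* k)`. -/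
def PreGns (_p : PosForm G) : Type u := C_c(G, ℂ)

variable (p : PosForm G)

instance : AddCommGroup (PreGns p) := inferInstanceAs (AddCommGroup C_c(G, ℂ))
instance : Module ℂ (PreGns p) := inferInstanceAs (Module ℂ C_c(G, ℂ))

/-- The element of `C*(G)` given by a vector of the pre-Hilbert space. -/
def PreGns.elem : PreGns p →ₗ[ℂ] groupCStar G := lamL (G := G)

/-- A function as a vector of the pre-Hilbert space. -/
def PreGns.mk : C_c(G, ℂ) →ₗ[ℂ] PreGns p := LinearMap.id (M := C_c(G, ℂ))

/-- The semi-inner product of `p`. -/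
abbrev preGnsCore : PreInnerProductSpace.Core ℂ (PreGns p) where
  inner f k := p.toDual (star (PreGns.elem p f) * PreGns.elem p k)
  conj_inner_symm f k := by
    rw [← Complex.star_def, ← p.herm, star_mul, star_star]
  re_inner_nonneg f := p.pos _
  add_left f k l := by rw [map_add, star_add, add_mul, map_add]
  smul_left f k c := by rw [map_smul, star_smul, smul_mul_assoc, map_smul]; rfl

instance : SeminormedAddCommGroup (PreGns p) :=
  InnerProductSpace.Core.toSeminormedAddCommGroup (c := preGnsCore p)
instance : InnerProductSpace ℂ (PreGns p) := InnerProductSpace.ofCore (preGnsCore p)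

theorem PreGns.inner_def (f k : PreGns p) :
    Inner.inner ℂ f k = p.toDual (star (PreGns.elem p f) * PreGns.elem p k) := rfl

theorem PreGns.norm_sq (f : PreGns p) :
    ‖f‖ ^ 2 = (p.toDual (star (PreGns.elem p f) * PreGns.elem p f)).re := by
  rw [← PreGns.inner_def, ← RCLike.re_eq_complex_re, inner_self_eq_norm_sq]

/-- The action of `G` by translation. -/
def PreGns.act (g : G) : PreGns p →ₗ[ℂ] PreGns p where
  toFun f := PreGns.mk p (translate g f)
  map_add' _ _ := rfl
  map_smul' _ _ := rfl

theorem PreGns.elem_act (g : G) (f : PreGns p) :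
    PreGns.elem p (PreGns.act p g f) = umul g (PreGns.elem p f) := (umul_lamC g f).symm

theorem star_umul_mul_umul (g : G) (a b : groupCStar G) :
    star (umul g a) * umul g b = star a * b := by
  refine CAlg.val_ext fun π => ?_
  ext ξ
  refine ext_inner_left ℂ fun v => ?_
  change Inner.inner ℂ v (star (π.op g * a.val.comp π) (π.op g (b.val.comp π ξ))) =
    Inner.inner ℂ v (star (a.val.comp π) (b.val.comp π ξ))
  rw [ContinuousLinearMap.star_eq_adjoint, ContinuousLinearMap.star_eq_adjoint,
    ContinuousLinearMap.adjoint_inner_right, ContinuousLinearMap.adjoint_inner_right]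
  exact π.inner_op_op g _ _

theorem PreGns.norm_act (g : G) (f : PreGns p) : ‖PreGns.act p g f‖ = ‖f‖ := by
  have : ‖PreGns.act p g f‖ ^ 2 = ‖f‖ ^ 2 := by
    rw [PreGns.norm_sq, PreGns.norm_sq, PreGns.elem_act, star_umul_mul_umul]
  exact (sq_eq_sq₀ (norm_nonneg _) (norm_nonneg _)).1 this

/-- Translation as a bounded operator. -/
def PreGns.actL (g : G) : PreGns p →L[ℂ] PreGns p :=
  (PreGns.act p g).mkContinuous 1 fun f => by rw [one_mul, PreGns.norm_act]

theorem PreGns.continuous_act (f : PreGns p) : Continuous fun g => PreGns.act p g f := by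
  rw [continuous_iff_continuousAt]
  intro g₀
  rw [ContinuousAt, tendsto_iff_norm_sub_tendsto_zero]
  have h : Filter.Tendsto (fun g => (p.toDual (star (umul g (PreGns.elem p f) -
      umul g₀ (PreGns.elem p f)) * (umul g (PreGns.elem p f) - umul g₀ (PreGns.elem p f)))).re)
      (nhds g₀) (nhds 0) := by
    have hc := continuous_umul (PreGns.elem p f)
    have : Continuous fun g => (p.toDual (star (umul g (PreGns.elem p f) -
      umul g₀ (PreGns.elem p f)) * (umul g (PreGns.elem p f) - umul g₀ (PreGns.elem p f)))).re := by
      fun_prop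
    simpa using this.tendsto g₀
  have h2 := h.sqrt
  rw [Real.sqrt_zero] at h2
  refine h2.congr fun g => ?_
  rw [← PreGns.elem_act, ← PreGns.elem_act, ← map_sub, ← PreGns.norm_sq,
    Real.sqrt_sq (norm_nonneg _)]

theorem norm_actL_completion (g : G) (x : UniformSpace.Completion (PreGns p)) :
    ‖(PreGns.actL p g).completion x‖ = ‖x‖ := by
  induction x using UniformSpace.Completion.induction_on with
  | hp => exact isClosed_eq (by fun_prop) (by fun_prop)
  | ih x =>
    rw [ContinuousLinearMap.completion_apply_coe, UniformSpace.Completion.norm_coe,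
      UniformSpace.Completion.norm_coe]
    exact PreGns.norm_act p g x

theorem continuous_actL_completion (x : UniformSpace.Completion (PreGns p)) :
    Continuous fun g => (PreGns.actL p g).completion x := by
  induction x using UniformSpace.Completion.induction_on with
  | hp =>
    exact isClosed_continuous_orbit (fun g => (PreGns.actL p g).completion)
      (norm_actL_completion p)
  | ih x =>
    refine ((UniformSpace.Completion.continuous_coe (PreGns p)).comp
      (PreGns.continuous_act p x)).congr fun g => ?_
    exact ((PreGns.actL p g).completion_apply_coe x).symm

open UniformSpace in
/-- The GNS representation of `G`. -/
def gnsRep : UnitaryRep G where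
  space := Completion (PreGns p)
  op :=
    { toFun := fun g => (PreGns.actL p g).completion
      map_one' := by
        ext x
        induction x using Completion.induction_on with
        | hp => exact isClosed_eq (by fun_prop) (by fun_prop)
        | ih x =>
          rw [ContinuousLinearMap.completion_apply_coe]
          congr 1
          exact CompactlySupportedContinuousMap.ext fun h => by
            change x.toFun (1⁻¹ * h) = x.toFun h
            rw [inv_one, one_mul]
      map_mul' := fun g h => by
        ext x
        induction x using Completion.induction_on with
        | hp => exact isClosed_eq (by fun_prop) (by fun_prop)
        | ih x =>
          rw [ContinuousLinearMap.completion_apply_coe, mul_apply_eq_comp,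
            ContinuousLinearMap.completion_apply_coe, ContinuousLinearMap.completion_apply_coe]
          congr 1
          exact CompactlySupportedContinuousMap.ext fun k => by
            change x.toFun ((g * h)⁻¹ * k) = x.toFun (h⁻¹ * (g⁻¹ * k))
            rw [mul_inv_rev, mul_assoc] }
  norm_op := fun g x => norm_actL_completion p g x
  continuous_op := continuous_actL_completion p

/-- A vector of the pre-Hilbert space as a vector of the GNS space. -/
def gnsVec (f : C_c(G, ℂ)) : (gnsRep p).space :=
  ((PreGns.mk p f : PreGns p) : UniformSpace.Completion (PreGns p))

theorem gnsRep_op_gnsVec (g : G) (f : C_c(G, ℂ)) :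
    (gnsRep p).op g (gnsVec p f) = gnsVec p (translate g f) :=
  (PreGns.actL p g).completion_apply_coe (PreGns.mk p f)

theorem inner_gnsVec (f k : C_c(G, ℂ)) :
    Inner.inner ℂ (gnsVec p f) (gnsVec p k) = p.toDual (star (lamC f) * lamC k) :=
  UniformSpace.Completion.inner_coe (PreGns.mk p f) (PreGns.mk p k)

theorem norm_gnsVec_sq (f : C_c(G, ℂ)) :
    ‖gnsVec p f‖ ^ 2 = (p.toDual (star (lamC f) * lamC f)).re := by
  rw [← inner_gnsVec, ← RCLike.re_eq_complex_re, inner_self_eq_norm_sq]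

theorem gns_induction {q : (gnsRep p).space → Prop} (hq : IsClosed {x | q x})
    (h : ∀ f, q (gnsVec p f)) (x : (gnsRep p).space) : q x :=
  UniformSpace.Completion.induction_on (α := PreGns p) x hq h

/-- Riesz representation of a bounded functional on the pre-Hilbert space. -/
theorem exists_gns_riesz (ℓ : C_c(G, ℂ) →ₗ[ℂ] ℂ) {C : ℝ} (hC : 0 ≤ C)
    (h : ∀ f, ‖ℓ f‖ ≤ C * ‖gnsVec p f‖) :
    ∃ η : (gnsRep p).space, ‖η‖ ≤ C ∧ ∀ f, Inner.inner ℂ η (gnsVec p f) = ℓ f := by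
  let L : PreGns p →L[ℂ] ℂ := LinearMap.mkContinuous (E := PreGns p) ℓ C fun f => by
    exact (h f).trans_eq (congrArg (C * ·) (UniformSpace.Completion.norm_coe (PreGns.mk p f)))
  let E : StrongDual ℂ (gnsRep p).space :=
    L.extend (UniformSpace.Completion.toComplL (E := PreGns p))
  have hE : ∀ f : C_c(G, ℂ), E (gnsVec p f) = ℓ f := fun f =>
    L.extend_eq UniformSpace.Completion.denseRange_coe
      (UniformSpace.Completion.isUniformInducing_coe (PreGns p)) (PreGns.mk p f)
  refine ⟨(InnerProductSpace.toDual ℂ (gnsRep p).space).symm E, ?_, fun f => ?_⟩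
  · rw [LinearIsometryEquiv.norm_map]
    refine ContinuousLinearMap.opNorm_le_bound _ hC fun x => ?_
    refine gns_induction p (q := fun x => ‖E x‖ ≤ C * ‖x‖) ?_ (fun f => ?_) x
    · exact isClosed_le (E.continuous.norm) (continuous_const.mul continuous_norm)
    · rw [hE]; exact h f
  · rw [InnerProductSpace.toDual_symm_apply]; exact hE f

theorem star_lamC_mul_eq_integral (f : C_c(G, ℂ)) (a : groupCStar G) :
    star (lamC f) * a = ∫ g, star (f g) • umul g⁻¹ a ∂(Measure.haar : Measure G) := by
  refine CAlg.val_injective ?_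
  have h := (CAlg.valL (A := groupCStar G)).integral_comp_comm
    (integrable_star_smul f ((continuous_umul a).comp continuous_inv))
  exact (star_lam_mul_eq_integral f (continuous_uop_mul (mem_lamClosure a))).trans h

/-- Here p(f) is the limit of p(e* f) along the approximate unit, and Cauchy-Schwarz applies because
the classes of the e are in the unit ball of the GNS space. -/
theorem norm_posForm_lamC_le (hp : ∀ a, (p.toDual (star a * a)).re ≤ ‖a‖ ^ 2) (f : C_c(G, ℂ)) :
    ‖p.toDual (lamC f)‖ ≤ ‖gnsVec p f‖ := by
  have h := ((p.toDual.continuous.tendsto _).comp (tendsto_star_bump_mul (lamC f))).norm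
  refine le_of_tendsto h (Filter.Eventually.of_forall fun U => ?_)
  have h1 : ‖gnsVec p (bump U)‖ ≤ 1 := by
    have h2 : ‖gnsVec p (bump U)‖ ^ 2 ≤ 1 := by
      rw [norm_gnsVec_sq]
      exact (hp _).trans (pow_le_one₀ (norm_nonneg _) (norm_lamC_bump_le U))
    exact (sq_le_one_iff₀ (norm_nonneg _)).1 h2
  simp only [Function.comp_apply]
  rw [← inner_gnsVec]
  calc _ ≤ ‖gnsVec p (bump U)‖ * ‖gnsVec p f‖ := norm_inner_le_norm _ _
    _ ≤ 1 * ‖gnsVec p f‖ := mul_le_mul_of_nonneg_right h1 (norm_nonneg _)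
    _ = _ := one_mul _

/-- The algebra has no unit, so the cyclic vector is found by Riesz representation of p itself: ⟨ξ,
f⟩ = p(f). It plays the role of the class of 1. -/
theorem exists_cyclic (hp : ∀ a, (p.toDual (star a * a)).re ≤ ‖a‖ ^ 2) :
    ∃ ξ : (gnsRep p).space, ‖ξ‖ ≤ 1 ∧ ∀ f, (gnsRep p).integrated f ξ = gnsVec p f := by
  obtain ⟨ξ, hξ1, hξ⟩ := exists_gns_riesz p (p.toDual.toLinearMap.comp (lamL (G := G)))
    zero_le_one fun f => by rw [one_mul]; exact norm_posForm_lamC_le p hp f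
  refine ⟨ξ, hξ1, fun f => ?_⟩
  refine ext_inner_right ℂ fun v => ?_
  refine gns_induction p (q := fun v => Inner.inner ℂ ((gnsRep p).integrated f ξ) v =
    Inner.inner ℂ (gnsVec p f) v) (isClosed_eq (by fun_prop) (by fun_prop)) (fun k => ?_) v
  have hc : Continuous fun g => (gnsRep p).op g⁻¹ (gnsVec p k) :=
    ((gnsRep p).continuous_op _).comp continuous_inv
  have hi : Integrable (fun g => star (f g) • umul g⁻¹ (lamC k)) (Measure.haar : Measure G) :=
    integrable_star_smul f ((continuous_umul (lamC k)).comp continuous_inv)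
  rw [inner_gnsVec, star_lamC_mul_eq_integral, ← ContinuousLinearMap.adjoint_inner_right,
    ← ContinuousLinearMap.star_eq_adjoint, adjoint_integrated_apply,
    ← integral_inner (integrable_star_smul f hc), ← ContinuousLinearMap.integral_comp_comm _ hi]
  refine integral_congr_ae (Filter.Eventually.of_forall fun g => ?_)
  simp only [inner_smul_right, map_smul, smul_eq_mul, gnsRep_op_gnsVec, umul_lamC]
  rw [hξ]
  rfl

/-- Every contractive functional on `C*(G)` is a vector functional with vectors of norm `≤ 1`. -/
theorem exists_eq_vf_of_norm_le_one (ω : StrongDual ℂ (groupCStar G)) (hω : ‖ω‖ ≤ 1) :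
    ∃ (π : UnitaryRep G) (ξ η : π.space), ‖ξ‖ ≤ 1 ∧ ‖η‖ ≤ 1 ∧ ω = vf (groupCStar G) π ξ η := by
  obtain ⟨p, hp1, hp2⟩ := exists_posForm ω hω
  obtain ⟨ξ, hξ1, hξ⟩ := exists_cyclic p hp1
  -- The inequality |ω(f)|² ≤ p(f*f) says that ω is a contraction for the GNS norm, so Riesz gives
  -- the second vector.
  obtain ⟨η, hη1, hη⟩ := exists_gns_riesz p (ω.toLinearMap.comp (lamL (G := G)))
    zero_le_one fun f => by
      rw [one_mul]
      refine abs_le_of_sq_le_sq' ?_ (norm_nonneg _) |>.2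
      rw [norm_gnsVec_sq]
      exact hp2 (lamC f)
  refine ⟨gnsRep p, ξ, η, hξ1, hη1, ContinuousLinearMap.coeFn_injective
    (groupCStar_ext ω.continuous (vf _ _ _ _).continuous fun f => ?_)⟩
  rw [vf_apply, lamC_val, lam_comp, hξ, hη]
  rfl

/-- Every functional on `C*(G)` is a vector functional, with control of the norm. -/
theorem exists_eq_vf (ω : StrongDual ℂ (groupCStar G)) :
    ∃ (π : UnitaryRep G) (ξ η : π.space), ‖ξ‖ ≤ ‖ω‖ ∧ ‖η‖ ≤ 1 ∧ ω = vf (groupCStar G) π ξ η := by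
  by_cases h0 : ω = 0
  · obtain ⟨π, -, -, -, -, -⟩ := exists_eq_vf_of_norm_le_one ω (by simp [h0])
    refine ⟨π, 0, 0, by simp, by simp, ?_⟩
    ext a
    simp [h0]
  have hn : 0 < ‖ω‖ := norm_pos_iff.2 h0
  obtain ⟨π, ξ, η, hξ, hη, h⟩ := exists_eq_vf_of_norm_le_one (((‖ω‖⁻¹ : ℝ) : ℂ) • ω) (by
    rw [norm_smul, Complex.norm_real, norm_inv, norm_norm, inv_mul_cancel₀ hn.ne'])
  refine ⟨π, (‖ω‖ : ℂ) • ξ, η, ?_, hη, ?_⟩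
  · rw [norm_smul, Complex.norm_real, norm_norm]
    exact mul_le_of_le_one_right hn.le hξ
  · ext a
    have h1 := congrArg (fun φ : StrongDual ℂ (groupCStar G) => (‖ω‖ : ℂ) * φ a) h
    have h2 : (‖ω‖ : ℂ) ≠ 0 := Complex.ofReal_ne_zero.2 hn.ne'
    simp only [smul_apply, smul_eq_mul, Complex.ofReal_inv, vf_apply] at h1
    rw [mul_inv_cancel_left₀ h2] at h1
    rw [h1, vf_apply, map_smul, inner_smul_right]

end VectorFunctional

end CIdem

end

/-! ### Convolution as pointwise multiplication, and idempotents as cosets. -/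

noncomputable section

namespace CIdem

set_option linter.unusedSectionVars false

section Convolution

variable {G : Type u} [Group G] [TopologicalSpace G] [IsTopologicalGroup G]
  [LocallyCompactSpace G] [MeasurableSpace G] [BorelSpace G]

/-! ### The comultiplication takes values in the multiplier algebra -/

variable (G) in
/-- The operators on the tensor squares of the representations. -/
abbrev BGG : Type (u + 1) :=
  BProd (TensorFam (fun π : UnitaryRep G => π.space) (fun π : UnitaryRep G => π.space))

/-- The comultiplication as a bounded linear map. -/
def comulL : groupCStar G →L[ℂ]
    BGG G :=
  LinearMap.mkContinuous
    { toFun := comul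
      map_add' := fun _ _ => rfl
      map_smul' := fun _ _ => rfl } 1 fun a => by
    rw [one_mul]
    exact BProd.norm_le_of_comp (norm_nonneg _) fun p => a.val.norm_comp_le (p.1.tensor p.2)

theorem comul_star (a : groupCStar G) : comul (star a) = star (comul a) := rfl

theorem tensor_op_apply (π σ : UnitaryRep G) (g : G) (x : HTensor π.space σ.space) :
    (π.tensor σ).op g x = opTensor (π.op g) (σ.op g) x := rfl

theorem continuous_stmul_umul (b c : groupCStar G) :
    Continuous fun g => stmul (umul g b) (umul g c) :=
  ((stmulL (groupCStar G) (groupCStar G)).continuous.comp (continuous_umul b)).clm_apply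
    (continuous_umul c)

/-- On the component (π, σ), Δ(f) integrates f against π(g) ⊗ σ(g). After multiplication by b ⊗ c
the integrand u_g b ⊗ u_g c is norm continuous with values in the spatial tensor product, which puts
the product there. -/
theorem comul_lamC_mul_stmul (f : C_c(G, ℂ)) (b c : groupCStar G) :
    comul (lamC f) * (stmul b c).val =
      (∫ g, f g • stmul (umul g b) (umul g c) ∂(Measure.haar : Measure G)).val := by
  refine BProd.ext_comp fun p => ?_
  ext x
  have hc := continuous_stmul_umul b c
  have h := (((ContinuousLinearMap.apply ℂ (HTensor p.1.space p.2.space)) x).comp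
    (CAlg.compL (A := spatial (groupCStar G) (groupCStar G)) p)).integral_comp_comm
    (integrable_smul f hc)
  refine Eq.trans ?_ h
  change (p.1.tensor p.2).integrated f (opTensor (b.val.comp p.1) (c.val.comp p.2) x) = _
  refine (UnitaryRep.integrated_apply (p.1.tensor p.2) f _).trans ?_
  refine integral_congr_ae (Filter.Eventually.of_forall fun g => ?_)
  simp only [map_smul]
  congr 1
  change (opTensor (p.1.op g) (p.2.op g) * opTensor (b.val.comp p.1) (c.val.comp p.2)) x = _
  rw [opTensor_mul]
  rfl

theorem comul_mul_mem (a : groupCStar G) (t : spatial (groupCStar G) (groupCStar G)) :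
    comul a * t.val ∈ (spatial (groupCStar G) (groupCStar G)).toSub := by
  refine groupCStar_induction (p := fun a => comul a * t.val ∈
    (spatial (groupCStar G) (groupCStar G)).toSub) ?_ (fun f => ?_) a
  · exact (spatial (groupCStar G) (groupCStar G)).isClosed.preimage
      ((continuous_mul_const t.val).comp (comulL (G := G)).continuous)
  · let p : Submodule ℂ (spatial (groupCStar G) (groupCStar G)) :=
      { carrier := {t | comul (lamC f) * t.val ∈ (spatial (groupCStar G) (groupCStar G)).toSub}
        add_mem' := fun {s t} hs ht => by
          rw [Set.mem_ofPred_eq, CAlg.val_add, mul_add]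
          exact add_mem hs ht
        zero_mem' := by
          rw [Set.mem_ofPred_eq, CAlg.val_zero, mul_zero]
          exact zero_mem _
        smul_mem' := fun c t ht => by
          rw [Set.mem_ofPred_eq, CAlg.val_smul, mul_smul_comm]
          exact SMulMemClass.smul_mem c ht }
    refine spatial_induction (p := p) ?_ (fun b c => ?_) t
    · exact (spatial (groupCStar G) (groupCStar G)).isClosed.preimage
        ((continuous_const_mul (comul (lamC f))).comp
          (CAlg.isometry_val (A := spatial (groupCStar G) (groupCStar G))).continuous)
    · change comul (lamC f) * (stmul b c).val ∈ (spatial (groupCStar G) (groupCStar G)).toSub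
      rw [comul_lamC_mul_stmul]
      exact CAlg.Elem.mem _

theorem comul_mem_multiplier (a : groupCStar G) :
    comul a ∈ multiplier (spatial (groupCStar G) (groupCStar G)) := by
  intro b hb
  refine ⟨comul_mul_mem a (CAlg.mkElem b hb), ?_⟩
  -- Multiplication by Δ(a) on the other side is the adjoint of multiplication by Δ(a*).
  have h := comul_mul_mem (star a) (star (CAlg.mkElem b hb : spatial (groupCStar G) (groupCStar G)))
  have h' := star_mem h
  rw [comul_star, CAlg.val_star, ← star_mul, star_star] at h'
  exact h'

/-! ### Approximate units of the tensor square -/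

theorem isClosed_setOf_tendsto {X α : Type*} [NormedAddCommGroup X] {l : Filter α}
    {T : α → X →+ X} (hT : ∀ i x, ‖T i x‖ ≤ ‖x‖) :
    IsClosed {x | Filter.Tendsto (fun i => T i x) l (nhds x)} := by
  rw [← closure_subset_iff_isClosed]
  intro x hx
  rw [Set.mem_ofPred_eq, Metric.tendsto_nhds]
  intro ε hε
  obtain ⟨y, hy, hxy⟩ := Metric.mem_closure_iff.1 hx (ε / 3) (by positivity)
  filter_upwards [Metric.tendsto_nhds.1 hy (ε / 3) (by positivity)] with i hi
  have h1 : dist (T i x) (T i y) ≤ dist x y := by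
    rw [dist_eq_norm, dist_eq_norm, ← map_sub]; exact hT i _
  have h2 := dist_triangle4 (T i x) (T i y) y x
  rw [dist_comm y x] at h2
  linarith

/-- The approximate unit `e ⊗ e` of the tensor square. -/
def bump₂ (U : Set G) : spatial (groupCStar G) (groupCStar G) :=
  stmul (lamC (bump U)) (lamC (bump U))

theorem norm_bump₂_le (U : Set G) : ‖bump₂ U‖ ≤ 1 := by
  refine (norm_btmul_le _ _).trans ?_
  exact mul_le_one₀ (norm_lam_bump_le U) (norm_nonneg _) (norm_lam_bump_le U)

theorem tendsto_bilinear {α E F X : Type*} [NormedAddCommGroup E] [NormedSpace ℂ E]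
    [NormedAddCommGroup F] [NormedSpace ℂ F] [NormedAddCommGroup X] [NormedSpace ℂ X]
    {l : Filter α} (L : E →L[ℂ] F →L[ℂ] X) {x : α → E} {y : α → F} {a : E} {b : F}
    (hx : Filter.Tendsto x l (nhds a)) (hy : Filter.Tendsto y l (nhds b)) :
    Filter.Tendsto (fun i => L (x i) (y i)) l (nhds (L a b)) :=
  (L.continuous₂.tendsto (a, b)).comp (hx.prodMk_nhds hy)

theorem tendsto_stmul {α : Type*} {l : Filter α} {x y : α → groupCStar G} {a b : groupCStar G}
    (hx : Filter.Tendsto x l (nhds a)) (hy : Filter.Tendsto y l (nhds b)) :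
    Filter.Tendsto (fun i => stmul (x i) (y i)) l (nhds (stmul a b)) := by
  have h := tendsto_bilinear (stmulL (groupCStar G) (groupCStar G)) hx hy
  simpa only [stmulL_apply] using h

theorem tendsto_bump₂_mul (t : spatial (groupCStar G) (groupCStar G)) :
    Filter.Tendsto (fun U => bump₂ U * t) (smallNhds G) (nhds t) := by
  let p : Submodule ℂ (spatial (groupCStar G) (groupCStar G)) :=
    { carrier := {t | Filter.Tendsto (fun U => bump₂ U * t) (smallNhds G) (nhds t)}
      add_mem' := fun {s t} hs ht => by
        simp only [Set.mem_ofPred_eq, mul_add]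
        exact hs.add ht
      zero_mem' := by simp
      smul_mem' := fun c t ht => by
        simp only [Set.mem_ofPred_eq, mul_smul_comm]
        exact ht.const_smul c }
  refine spatial_induction (p := p) ?_ (fun b c => ?_) t
  · exact isClosed_setOf_tendsto (T := fun U => AddMonoidHom.mulLeft (bump₂ U)) fun U x =>
      (norm_mul_le _ _).trans (mul_le_of_le_one_left (norm_nonneg _) (norm_bump₂_le U))
  · change Filter.Tendsto (fun U => bump₂ U * stmul b c) (smallNhds G) (nhds (stmul b c))
    simp only [bump₂, stmul_mul]
    exact tendsto_stmul (tendsto_bump_mul b) (tendsto_bump_mul c)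

theorem tendsto_mul_bump₂ (t : spatial (groupCStar G) (groupCStar G)) :
    Filter.Tendsto (fun U => t * bump₂ U) (smallNhds G) (nhds t) := by
  let p : Submodule ℂ (spatial (groupCStar G) (groupCStar G)) :=
    { carrier := {t | Filter.Tendsto (fun U => t * bump₂ U) (smallNhds G) (nhds t)}
      add_mem' := fun {s t} hs ht => by
        simp only [Set.mem_ofPred_eq, add_mul]
        exact hs.add ht
      zero_mem' := by simp
      smul_mem' := fun c t ht => by
        simp only [Set.mem_ofPred_eq, smul_mul_assoc]
        exact ht.const_smul c }
  refine spatial_induction (p := p) ?_ (fun b c => ?_) t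
  · exact isClosed_setOf_tendsto (T := fun U => AddMonoidHom.mulRight (bump₂ U)) fun U x =>
      (norm_mul_le _ _).trans (mul_le_of_le_one_right (norm_nonneg _) (norm_bump₂_le U))
  · change Filter.Tendsto (fun U => stmul b c * bump₂ U) (smallNhds G) (nhds (stmul b c))
    simp only [bump₂, stmul_mul]
    exact tendsto_stmul (tendsto_mul_bump b) (tendsto_mul_bump c)

/-- The product of a multiplier and an element of the algebra. -/
def multMul (T : multiplier (spatial (groupCStar G) (groupCStar G)))
    (t : spatial (groupCStar G) (groupCStar G)) : spatial (groupCStar G) (groupCStar G) :=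
  CAlg.mkElem ((T : BGG G) * t.val) (T.2 t.val t.mem).1

/-- The product of an element of the algebra and a multiplier. -/
def mulMult (t : spatial (groupCStar G) (groupCStar G))
    (T : multiplier (spatial (groupCStar G) (groupCStar G))) :
    spatial (groupCStar G) (groupCStar G) :=
  CAlg.mkElem (t.val * (T : BGG G)) (T.2 t.val t.mem).2

/-- A strict extension is the limit of its values along the approximate unit. -/
theorem IsStrictExtension.tendsto {X : Type*} [NormedAddCommGroup X] [NormedSpace ℂ X]
    {Φ : spatial (groupCStar G) (groupCStar G) →L[ℂ] X}
    {Ψ : multiplier (spatial (groupCStar G) (groupCStar G)) →ₗ[ℂ] X}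
    (h : IsStrictExtension Φ Ψ) (T : multiplier (spatial (groupCStar G) (groupCStar G))) :
    Filter.Tendsto (fun U => Φ (multMul T (bump₂ U))) (smallNhds G) (nhds (Ψ T)) := by
  obtain ⟨h1, F, C, h2⟩ := h
  rw [tendsto_iff_norm_sub_tendsto_zero]
  -- The strict bound is applied to T(e ⊗ e) - T. In each seminorm the factor (e ⊗ e) meets either b
  -- on its right or bT on its left, and both products converge in norm.
  have h3 : ∀ U, ‖Φ (multMul T (bump₂ U)) - Ψ T‖ ≤
      C * ∑ b ∈ F, (‖multMul T (bump₂ U * b - b)‖ +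
        ‖mulMult b T * bump₂ U - mulMult b T‖) := by
    intro U
    rw [← h1, ← map_sub]
    refine (h2 _).trans_eq ?_
    congr 1
    refine Finset.sum_congr rfl fun b _ => ?_
    congr 1
    · rw [← CAlg.norm_val]
      congr 1
      change ((T : BGG G) * (bump₂ U).val - (T : BGG G)) * b.val =
        (T : BGG G) * ((bump₂ U).val * b.val - b.val)
      rw [sub_mul, mul_sub, mul_assoc]
    · rw [← CAlg.norm_val]
      congr 1
      change b.val * ((T : BGG G) * (bump₂ U).val - (T : BGG G)) =
        (b.val * (T : BGG G)) * (bump₂ U).val - b.val * (T : BGG G)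
      rw [mul_sub, mul_assoc]
  refine squeeze_zero (fun _ => norm_nonneg _) h3 ?_
  rw [← mul_zero C]
  refine Filter.Tendsto.const_mul C ?_
  rw [← Finset.sum_const_zero (s := F)]
  refine tendsto_finsetSum _ fun b _ => ?_
  rw [← add_zero (0 : ℝ)]
  refine Filter.Tendsto.add ?_ ?_
  · have h4 := tendsto_iff_norm_sub_tendsto_zero.1 (tendsto_bump₂_mul b)
    have h5 := h4.const_mul ‖(T : BGG G)‖
    rw [mul_zero] at h5
    exact squeeze_zero (fun _ => norm_nonneg _) (fun U =>
      norm_mul_le (T : BGG G) (bump₂ U * b - b).val) h5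
  · exact tendsto_iff_norm_sub_tendsto_zero.1 (tendsto_mul_bump₂ _)

/-! ### Convolution of vector functionals -/

/-- The vector functional `T ↦ ⟨y, Tᵢ x⟩` on families of operators. -/
def bvf {ι : Type*} {H : ι → Type*} [∀ i, NormedAddCommGroup (H i)]
    [∀ i, InnerProductSpace ℂ (H i)] [∀ i, CompleteSpace (H i)] (i : ι) (x y : H i) :
    BProd H →ₗ[ℂ] ℂ where
  toFun T := Inner.inner ℂ y (T.comp i x)
  map_add' S T := by rw [BProd.comp_add, add_apply, inner_add_right]
  map_smul' c T := by rw [BProd.comp_smul, smul_apply, inner_smul_right]; rfl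

/-- If b fixes x, then T may be replaced by Tb, so the functional is bounded by a single strict
seminorm. -/
theorem norm_bvf_le_of_fixed {ι : Type*} {H : ι → Type*} [∀ i, NormedAddCommGroup (H i)]
    [∀ i, InnerProductSpace ℂ (H i)] [∀ i, CompleteSpace (H i)] {i : ι} {x y : H i}
    {b : BProd H} (hb : b.comp i x = x) (T : BProd H) :
    ‖bvf i x y T‖ ≤ ‖y‖ * ‖x‖ * ‖T * b‖ := by
  have e : T.comp i x = (T * b).comp i x := by
    conv_lhs => rw [← hb]
    rfl
  change ‖Inner.inner ℂ y (T.comp i x)‖ ≤ _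
  rw [e]
  calc _ ≤ ‖y‖ * ‖(T * b).comp i x‖ := norm_inner_le_norm _ _
    _ ≤ ‖y‖ * (‖T * b‖ * ‖x‖) := by
      gcongr
      exact (ContinuousLinearMap.le_opNorm _ _).trans
        (mul_le_mul_of_nonneg_right (BProd.norm_comp_le _ _) (norm_nonneg _))
    _ = _ := by ring

theorem extendsToTensor_vf {π σ : UnitaryRep G} {ξ η : π.space} {ξ' η' : σ.space} :
    ExtendsToTensor (fun a b => vf (groupCStar G) π ξ η a * vf (groupCStar G) σ ξ' η' b)
      (vf (spatial (groupCStar G) (groupCStar G)) (π, σ) (htmul ξ ξ') (htmul η η')) := by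
  intro a b
  change Inner.inner ℂ (htmul η η') (opTensor (a.val.comp π) (b.val.comp σ) (htmul ξ ξ')) = _
  rw [opTensor_htmul, inner_htmul]
  rfl

/-- Nothing in a convolution is free: Ω is determined on elementary tensors and Ψ is its limit along
e ⊗ e. The limit is computed on vectors, where π(e)ξ ⊗ σ(e)ξ' tends to ξ ⊗ ξ'. -/
theorem IsConvolution.eq_vf {π σ : UnitaryRep G} {ξ η : π.space} {ξ' η' : σ.space}
    {ν : StrongDual ℂ (groupCStar G)}
    (h : IsConvolution (vf (groupCStar G) π ξ η) (vf (groupCStar G) σ ξ' η') ν) :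
    ν = vf (groupCStar G) (π.tensor σ) (htmul ξ ξ') (htmul η η') := by
  obtain ⟨Ω, hΩ, Ψ, hΨ, hν⟩ := h
  obtain rfl : Ω = vf (spatial (groupCStar G) (groupCStar G)) (π, σ) (htmul ξ ξ') (htmul η η') :=
    spatial_ext fun a b => (hΩ a b).trans (extendsToTensor_vf a b).symm
  ext a
  obtain ⟨hm, ha⟩ := hν a
  rw [← ha]
  refine tendsto_nhds_unique (hΨ.tendsto ⟨comul a, hm⟩) ?_
  have h1 : Filter.Tendsto (fun U => htmul (π.integrated (bump U) ξ) (σ.integrated (bump U) ξ'))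
      (smallNhds G) (nhds (htmul ξ ξ')) := by
    have h := tendsto_bilinear (htmulL π.space σ.space) (tendsto_integrated_bump π ξ)
      (tendsto_integrated_bump σ ξ')
    simpa only [htmulL_apply] using h
  have h2 : Continuous fun v : HTensor π.space σ.space =>
      Inner.inner ℂ (htmul η η') (a.val.comp (π.tensor σ) v) :=
    continuous_const.inner (a.val.comp (π.tensor σ)).continuous
  refine ((h2.tendsto _).comp h1).congr fun U => ?_
  change _ = Inner.inner ℂ (htmul η η') (a.val.comp (π.tensor σ)
    (opTensor (π.integrated (bump U)) (σ.integrated (bump U)) (htmul ξ ξ')))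
  rw [opTensor_htmul]
  rfl

/-- The coefficient of π ⊗ σ is always the candidate; functions k, k' that fix ξ, ξ' make its
extension to the multipliers strictly continuous through the one seminorm of k ⊗ k'. -/
theorem isConvolution_vf {π σ : UnitaryRep G} {ξ η : π.space} {ξ' η' : σ.space}
    {k k' : C_c(G, ℂ)} (hk : π.integrated k ξ = ξ) (hk' : σ.integrated k' ξ' = ξ') :
    IsConvolution (vf (groupCStar G) π ξ η) (vf (groupCStar G) σ ξ' η')
      (vf (groupCStar G) (π.tensor σ) (htmul ξ ξ') (htmul η η')) := by
  refine ⟨_, extendsToTensor_vf, (bvf (H := TensorFam (fun π : UnitaryRep G => π.space)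
    (fun π : UnitaryRep G => π.space)) (π, σ) (htmul ξ ξ') (htmul η η')).comp
    (multiplier (spatial (groupCStar G) (groupCStar G))).subtype,
    ⟨fun b => rfl, {stmul (lamC k) (lamC k')}, ‖htmul η η'‖ * ‖htmul ξ ξ'‖, fun T => ?_⟩,
    fun a => ⟨comul_mem_multiplier a, rfl⟩⟩
  rw [Finset.sum_singleton]
  refine (norm_bvf_le_of_fixed (b := (stmul (lamC k) (lamC k')).val) ?_ (T : BGG G)).trans ?_
  · change opTensor (π.integrated k) (σ.integrated k') (htmul ξ ξ') = htmul ξ ξ'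
    rw [opTensor_htmul, hk, hk']
  · gcongr
    exact le_add_of_nonneg_right (norm_nonneg _)

theorem integral_translate_bump {φ : G → ℂ} (x : G) (U : Set G) :
    ∫ g, translate x (bump U) g * φ g ∂(Measure.haar : Measure G) =
      ∫ g, bump U g • φ (x * g) ∂(Measure.haar : Measure G) := by
  rw [← integral_mul_left_eq_self _ x]
  simp

/-- Testing on bump functions near x recovers φ(x). Hence φ is unique and bounded by ‖ω‖. -/
theorem Represents.tendsto {ω : StrongDual ℂ (groupCStar G)} {φ : G → ℂ} (h : Represents ω φ)
    (x : G) : Filter.Tendsto (fun U => ω (lamC (translate x (bump U)))) (smallNhds G)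
      (nhds (φ x)) := by
  have h1 := tendsto_bump (F := fun g => φ (x * g)) (h.1.comp (by fun_prop))
  rw [mul_one] at h1
  simpa only [h.2, integral_translate_bump] using h1

theorem Represents.unique {ω : StrongDual ℂ (groupCStar G)} {φ ψ : G → ℂ} (h : Represents ω φ)
    (h' : Represents ω ψ) : φ = ψ :=
  funext fun x => tendsto_nhds_unique (h.tendsto x) (h'.tendsto x)

theorem norm_lam_translate_bump_le (x : G) (U : Set G) :
    ‖lamC (translate x (bump U))‖ ≤ 1 := by
  rw [← umul_lamC, norm_umul]; exact norm_lamC_bump_le U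

theorem Represents.norm_le {ω : StrongDual ℂ (groupCStar G)} {φ : G → ℂ} (h : Represents ω φ)
    (x : G) : ‖φ x‖ ≤ ‖ω‖ := by
  refine le_of_tendsto (h.tendsto x).norm (Filter.Eventually.of_forall fun U => ?_)
  exact (ω.le_opNorm _).trans (mul_le_of_le_one_right (norm_nonneg _)
    (norm_lam_translate_bump_le x U))

/-! ### Contractive idempotents are indicator functions of open cosets -/

theorem IsContractiveIdempotent.exists_openCoset {ω : StrongDual ℂ (groupCStar G)}
    (h : IsContractiveIdempotent ω) :
    ∃ C : Set G, IsOpenCoset C ∧ Represents ω (C.indicator 1) := by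
  obtain ⟨⟨h0, hconv⟩, hn⟩ := h
  obtain ⟨π, ξ, η, hξ, hη, rfl⟩ := exists_eq_vf_of_norm_le_one ω hn
  have hrep := represents_vf π ξ η
  -- The coefficient of π ⊗ π at ξ ⊗ ξ, η ⊗ η is the square of the coefficient of π, and idempotency
  -- identifies the two functionals.
  have hsq : ∀ g, Inner.inner ℂ η (π.op g ξ) * Inner.inner ℂ η (π.op g ξ) =
      Inner.inner ℂ η (π.op g ξ) := by
    have h1 := represents_vf (π.tensor π) (htmul ξ ξ) (htmul η η)
    rw [← hconv.eq_vf] at h1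
    have h2 := h1.unique hrep
    intro g
    have h3 := congrFun h2 g
    rw [tensor_op_apply, opTensor_htmul] at h3
    exact (inner_htmul _ _ _ _).symm.trans h3
  have h01 : ∀ g, Inner.inner ℂ η (π.op g ξ) = 0 ∨ Inner.inner ℂ η (π.op g ξ) = 1 := by
    intro g
    exact IsIdempotentElem.iff_eq_zero_or_one.1 (hsq g)
  -- Both vectors have norm at most 1, so the value 1 is equality in Cauchy-Schwarz.
  have h1 : ∀ g, Inner.inner ℂ η (π.op g ξ) = 1 ↔ π.op g ξ = η ∧ ‖η‖ = 1 := by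
    intro g
    constructor
    · intro hg
      have hle : ‖π.op g ξ‖ ≤ 1 := by rw [π.norm_op]; exact hξ
      have h2 : (1 : ℝ) ≤ ‖η‖ * ‖π.op g ξ‖ := by
        have := norm_inner_le_norm (𝕜 := ℂ) η (π.op g ξ)
        rwa [hg, norm_one] at this
      have h3 : ‖η‖ = 1 := le_antisymm hη (by nlinarith [norm_nonneg η, norm_nonneg (π.op g ξ)])
      have h4 : ‖π.op g ξ‖ = 1 :=
        le_antisymm hle (by nlinarith [norm_nonneg η, norm_nonneg (π.op g ξ)])
      exact ⟨((inner_eq_one_iff_of_norm_eq_one h3 h4).1 hg).symm, h3⟩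
    · rintro ⟨hg, hn⟩
      rw [hg, inner_self_eq_norm_sq_to_K, hn]
      simp
  set C : Set G := {g | Inner.inner ℂ η (π.op g ξ) = 1} with hC
  have hind : (fun g => Inner.inner ℂ η (π.op g ξ)) = C.indicator 1 := by
    funext g
    rcases h01 g with h | h
    · rw [Set.indicator_of_notMem (by simp [hC, h]), h]
    · rw [Set.indicator_of_mem (by simpa [hC] using h), h]; rfl
  refine ⟨C, ⟨?_, ?_⟩, hind ▸ hrep⟩
  -- With only the values 0 and 1, the set where φ = 1 is also the set where φ ≠ 0.
  · have : C = (fun g => Inner.inner ℂ η (π.op g ξ)) ⁻¹' {0}ᶜ := by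
      ext g
      rcases h01 g with h | h <;> simp [hC, h]
    rw [this]
    exact isOpen_compl_singleton.preimage hrep.1
  -- Were C empty, φ would vanish identically and ω would be 0.
  · obtain ⟨s, hs⟩ : ∃ s, s ∈ C := by
      by_contra hne
      push Not at hne
      apply h0
      refine hrep.functional_unique ⟨?_, fun f => ?_⟩
      · exact hrep.1
      · rw [hind, Set.eq_empty_of_forall_notMem hne]; simp
    have hs' := (h1 s).1 hs
    -- C is the set of g with π(g)ξ = η = π(s)ξ, a left coset of the stabilizer of ξ.
    let N : Subgroup G :=
      { carrier := {g | π.op g ξ = ξ}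
        mul_mem' := fun {a b} ha hb => by
          rw [Set.mem_ofPred_eq] at *
          rw [π.op_mul_apply, hb, ha]
        one_mem' := π.op_one_apply ξ
        inv_mem' := fun {a} ha => by
          rw [Set.mem_ofPred_eq] at *
          conv_lhs => rw [← ha]
          rw [← π.op_mul_apply, inv_mul_cancel, π.op_one_apply] }
    refine ⟨N, s, ?_⟩
    ext g
    rw [Set.mem_smul_set_iff_inv_smul_mem, smul_eq_mul]
    change _ ↔ π.op (s⁻¹ * g) ξ = ξ
    rw [hC, Set.mem_ofPred_eq, h1, π.op_mul_apply]
    constructor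
    · rintro ⟨hg, -⟩
      rw [hg, ← hs'.1, ← π.op_mul_apply, inv_mul_cancel, π.op_one_apply]
    · intro hg
      refine ⟨?_, hs'.2⟩
      rw [← hs'.1]
      conv_rhs => rw [← hg]
      rw [← π.op_mul_apply, mul_inv_cancel, π.op_one_apply]

end Convolution

end CIdem

end

/-! ### The space ℓ²(X) and its coordinate permutations. -/

noncomputable section

namespace CIdem

set_option linter.unusedSectionVars false

section SquareSummable

/-- The Hilbert space `ℓ²(X)`. -/
abbrev L2 (X : Type*) : Type _ := lp (fun _ : X => ℂ) 2

variable {X : Type*}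

open Classical in
/-- The canonical basis vector at `x`. -/
def dlt (x : X) : L2 X := lp.single 2 x (1 : ℂ)

theorem dlt_apply (x y : X) [Decidable (y = x)] : dlt x y = if y = x then 1 else 0 := by
  classical
  rw [dlt, lp.single_apply, Pi.single_apply]
  congr

@[simp] theorem inner_dlt_left (x : X) (f : L2 X) : Inner.inner ℂ (dlt x) f = f x := by
  classical
  rw [dlt, lp.inner_single_left]
  simp

theorem norm_dlt (x : X) : ‖dlt x‖ = 1 := by
  classical
  rw [dlt, lp.norm_single (by norm_num), norm_one]

theorem inner_dlt_dlt (x y : X) [Decidable (x = y)] :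
    Inner.inner ℂ (dlt x) (dlt y) = if x = y then (1 : ℂ) else 0 := by
  rw [inner_dlt_left, dlt_apply]

theorem dense_span_dlt (X : Type*) :
    Dense (Submodule.span ℂ (Set.range (dlt (X := X))) : Set (L2 X)) := by
  classical
  intro f
  have h := lp.hasSum_single (p := 2) (by norm_num) f
  refine mem_closure_of_tendsto h (Filter.Eventually.of_forall fun s => ?_)
  refine sum_mem fun x _ => ?_
  have : (lp.single 2 x (f x) : L2 X) = f x • dlt x := by
    ext y
    rw [lp.coeFn_smul, Pi.smul_apply, dlt_apply, lp.single_apply, Pi.single_apply]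
    split_ifs <;> simp
  rw [this]
  exact Submodule.smul_mem _ _ (Submodule.subset_span ⟨x, rfl⟩)

theorem dlt_ext {E : Type*} [NormedAddCommGroup E] [NormedSpace ℂ E] {S T : L2 X →L[ℂ] E}
    (h : ∀ x, S (dlt x) = T (dlt x)) : S = T := by
  refine ContinuousLinearMap.ext_on (dense_span_dlt X) ?_
  rintro _ ⟨x, rfl⟩
  exact h x

/-- The permutation of the coordinates. -/
def permL2 (e : Equiv.Perm X) : L2 X →ₗᵢ[ℂ] L2 X where
  toFun f := ⟨fun x => f (e.symm x), by
    refine (memℓp_gen_iff (by norm_num)).2 ?_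
    exact ((lp.memℓp f).summable (by norm_num)).comp_injective e.symm.injective⟩
  map_add' f k := by ext x; rfl
  map_smul' c f := by ext x; rfl
  norm_map' f := by
    rw [lp.norm_eq_tsum_rpow (by norm_num), lp.norm_eq_tsum_rpow (by norm_num)]
    congr 1
    exact e.symm.tsum_eq fun x => ‖f x‖ ^ (2 : ℝ≥0∞).toReal

theorem permL2_apply (e : Equiv.Perm X) (f : L2 X) (x : X) : permL2 e f x = f (e.symm x) := rfl

theorem permL2_dlt (e : Equiv.Perm X) (x : X) : permL2 e (dlt x) = dlt (e x) := by
  classical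
  ext y
  rw [permL2_apply, dlt_apply, dlt_apply]
  simp only [Equiv.symm_apply_eq]

end SquareSummable

/-! ### Quasi-regular representations of open subgroups; the converse in (1). -/

section QuasiRegular

variable {G : Type u} [Group G] [TopologicalSpace G] [IsTopologicalGroup G]

/-- Since N is open, G/N is discrete and the orbit of a basis vector is locally constant. Vectors
with continuous orbit form a closed subspace. -/
theorem continuous_quasiReg {N : Subgroup G} (hN : IsOpen (N : Set G)) (f : L2 (G ⧸ N)) :
    Continuous fun g : G => permL2 (MulAction.toPerm g : Equiv.Perm (G ⧸ N)) f := by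
  have hcl := isClosed_continuous_orbit (X := G) (E := L2 (G ⧸ N))
    (fun g => (permL2 (MulAction.toPerm g)).toContinuousLinearMap)
    (fun g x => (permL2 (MulAction.toPerm g)).norm_map x)
  refine closure_minimal (t := {f | Continuous fun g : G =>
    permL2 (MulAction.toPerm g : Equiv.Perm (G ⧸ N)) f}) ?_ hcl (dense_span_dlt (G ⧸ N) f)
  intro v hv
  rw [Set.mem_ofPred_eq]
  rw [SetLike.mem_coe] at hv
  induction hv using Submodule.span_induction with
  | zero => simpa using continuous_const
  | add a b _ _ ha hb => simpa using! ha.add hb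
  | smul c a _ ha => simpa using! ha.const_smul c
  | mem v hv =>
    obtain ⟨x, rfl⟩ := hv
    have : DiscreteTopology (G ⧸ N) := QuotientGroup.discreteTopology hN
    have h1 : Continuous fun g : G => g • x := by
      induction x using QuotientGroup.induction_on with
      | H s => exact continuous_quotient_mk'.comp (continuous_mul_const s)
    have h2 : Continuous (dlt (X := G ⧸ N)) := continuous_of_discreteTopology
    refine (h2.comp h1).congr fun g => ?_
    rw [permL2_dlt]
    rfl

/-- The quasi-regular representation on `ℓ²(G/N)`, for an open subgroup `N`. -/
def quasiReg (N : Subgroup G) (hN : IsOpen (N : Set G)) : UnitaryRep G where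
  space := L2 (G ⧸ N)
  op :=
    { toFun := fun g => (permL2 (MulAction.toPerm g : Equiv.Perm (G ⧸ N))).toContinuousLinearMap
      map_one' := by
        refine dlt_ext fun x => (permL2_dlt _ _).trans ?_
        simp
      map_mul' := fun g h => by
        refine dlt_ext fun x => (permL2_dlt _ _).trans ?_
        change _ = permL2 _ (permL2 _ (dlt x))
        rw [permL2_dlt, permL2_dlt]
        simp [mul_smul] }
  norm_op := fun g ξ => (permL2 _).norm_map ξ
  continuous_op := continuous_quasiReg hN

variable (N : Subgroup G) (hN : IsOpen (N : Set G))

/-- The basis vector of a coset as a vector of the quasi-regular representation. -/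
def qv (x : G ⧸ N) : (quasiReg N hN).space := dlt x

theorem quasiReg_op_qv (g : G) (x : G ⧸ N) :
    (quasiReg N hN).op g (qv N hN x) = qv N hN (g • x) := permL2_dlt _ _

theorem norm_qv (x : G ⧸ N) : ‖qv N hN x‖ = 1 := norm_dlt x

theorem inner_qv_qv (x y : G ⧸ N) [Decidable (x = y)] :
    Inner.inner ℂ (qv N hN x) (qv N hN y) = if x = y then (1 : ℂ) else 0 := inner_dlt_dlt x y

variable [LocallyCompactSpace G] [MeasurableSpace G] [BorelSpace G]

include hN in
theorem subgroup_mem_nhds : (N : Set G) ∈ nhds (1 : G) := hN.mem_nhds N.one_mem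

/-- The bump is supported in N, which fixes the coset N. This supplies the fixing function required
by `isConvolution_vf`. -/
theorem integrated_bump_qv_one :
    (quasiReg N hN).integrated (bump (N : Set G)) (qv N hN ((1 : G) : G ⧸ N)) =
      qv N hN ((1 : G) : G ⧸ N) := by
  refine integrated_bump_fixed _ (subgroup_mem_nhds N hN) fun g hg => ?_
  rw [quasiReg_op_qv]
  congr 1
  change ((g * 1 : G) : G ⧸ N) = _
  rw [mul_one]
  exact (QuotientGroup.eq.2 (by simpa using hg)).symm

/-- The functional of the indicator function of the open coset `s N`. -/
def cosetFun (s : G) : StrongDual ℂ (groupCStar G) :=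
  vf (groupCStar G) (quasiReg N hN) (qv N hN ((1 : G) : G ⧸ N)) (qv N hN (s : G ⧸ N))

theorem represents_cosetFun (s : G) :
    Represents (cosetFun N hN s) ((s • (N : Set G)).indicator 1) := by
  classical
  have h := represents_vf (quasiReg N hN) (qv N hN ((1 : G) : G ⧸ N)) (qv N hN (s : G ⧸ N))
  refine cast (congrArg _ (funext fun g => ?_)) h
  rw [quasiReg_op_qv, inner_qv_qv, Set.indicator_apply, Set.mem_smul_set_iff_inv_smul_mem]
  change (if (s : G ⧸ N) = ((g * 1 : G) : G ⧸ N) then (1 : ℂ) else 0) = _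
  rw [mul_one]
  simp only [QuotientGroup.eq]
  rfl

theorem exists_represents_of_isOpenCoset {C : Set G} (hC : IsOpenCoset C) :
    ∃ (N : Subgroup G) (hN : IsOpen (N : Set G)) (s : G), C = s • (N : Set G) ∧
      Represents (cosetFun N hN s) (C.indicator 1) := by
  obtain ⟨hCo, N, s, rfl⟩ := hC
  have hN : IsOpen (N : Set G) := by
    have := hCo.smul s⁻¹
    rwa [inv_smul_smul] at this
  exact ⟨N, hN, s, rfl, represents_cosetFun N hN s⟩

theorem norm_cosetFun_le (s : G) : ‖cosetFun N hN s‖ ≤ 1 := by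
  refine (norm_vf_le _ _ _).trans ?_
  rw [norm_qv, norm_qv, one_mul]

theorem one_le_norm_cosetFun (s : G) : 1 ≤ ‖cosetFun N hN s‖ := by
  have h := (represents_cosetFun N hN s).norm_le s
  rwa [Set.indicator_of_mem (Set.mem_smul_set_iff_inv_smul_mem.2
    (by simp)), Pi.one_apply, norm_one] at h

theorem isIdempotentFunctional_cosetFun (s : G) : IsIdempotentFunctional (cosetFun N hN s) := by
  classical
  refine ⟨fun h => ?_, ?_⟩
  · have := one_le_norm_cosetFun N hN s
    rw [h, norm_zero] at this
    exact absurd this (by norm_num)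
  · have h1 := isConvolution_vf (η := qv N hN (s : G ⧸ N)) (η' := qv N hN (s : G ⧸ N))
      (integrated_bump_qv_one N hN) (integrated_bump_qv_one N hN)
    have h2 : cosetFun N hN s = vf (groupCStar G) ((quasiReg N hN).tensor (quasiReg N hN))
        (htmul (qv N hN ((1 : G) : G ⧸ N)) (qv N hN ((1 : G) : G ⧸ N)))
        (htmul (qv N hN (s : G ⧸ N)) (qv N hN (s : G ⧸ N))) := by
      refine (represents_vf _ _ _).functional_unique ?_
      have h3 := represents_vf ((quasiReg N hN).tensor (quasiReg N hN))
        (htmul (qv N hN ((1 : G) : G ⧸ N)) (qv N hN ((1 : G) : G ⧸ N)))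
        (htmul (qv N hN (s : G ⧸ N)) (qv N hN (s : G ⧸ N)))
      refine cast (congrArg _ (funext fun g => ?_)) h3
      symm
      rw [tensor_op_apply, opTensor_htmul]
      refine Eq.trans ?_ (inner_htmul _ _ _ _).symm
      rw [quasiReg_op_qv, inner_qv_qv]
      split_ifs <;> simp
    rw [← h2] at h1
    exact h1

theorem isContractiveIdempotent_iff (ω : StrongDual ℂ (groupCStar G)) :
    IsContractiveIdempotent ω ↔
      ∃ C : Set G, IsOpenCoset C ∧ Represents ω (C.indicator 1) := by
  refine ⟨fun h => h.exists_openCoset, ?_⟩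
  rintro ⟨C, hC, hω⟩
  obtain ⟨N, hN, s, rfl, h⟩ := exists_represents_of_isOpenCoset hC
  rw [hω.functional_unique h]
  exact ⟨isIdempotentFunctional_cosetFun N hN s, norm_cosetFun_le N hN s⟩

end QuasiRegular

end CIdem

end

/-! ### The bidual acting on representation spaces. -/

noncomputable section

namespace CIdem

set_option linter.unusedSectionVars false

section BidualOperators

variable {ι : Type*} {H : ι → Type*} [∀ i, NormedAddCommGroup (H i)]
  [∀ i, InnerProductSpace ℂ (H i)] [∀ i, CompleteSpace (H i)] {A : CAlg H}

theorem lact_bmul {A : Type*} [NonUnitalCStarAlgebra A] (x y : StrongDual ℂ (StrongDual ℂ A))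
    (φ : StrongDual ℂ A) : lact (bmul x y) φ = lact x (lact y φ) := by
  ext a
  change x (lact y _) = x _
  congr 1
  ext b
  change y _ = y _
  congr 1
  ext c
  change φ (a * (b * c)) = φ (a * b * c)
  rw [mul_assoc]

theorem norm_lact_le {A : Type*} [NonUnitalCStarAlgebra A] (x : StrongDual ℂ (StrongDual ℂ A))
    (φ : StrongDual ℂ A) : ‖lact x φ‖ ≤ ‖x‖ * ‖φ‖ := by
  refine ContinuousLinearMap.opNorm_le_bound _ (by positivity) fun a => ?_
  calc ‖lact x φ a‖ ≤ ‖x‖ * ‖φ.comp (ContinuousLinearMap.mul ℂ A a)‖ := x.le_opNorm _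
    _ ≤ ‖x‖ * (‖φ‖ * ‖a‖) := by
      gcongr
      exact (ContinuousLinearMap.opNorm_comp_le _ _).trans
        (mul_le_mul_of_nonneg_left (ContinuousLinearMap.opNorm_mul_apply_le ℂ A a)
          (norm_nonneg _))
    _ = ‖x‖ * ‖φ‖ * ‖a‖ := by ring

/-- The sesquilinear form of an element of the bidual. -/
def bidualForm (i : ι) (x : StrongDual ℂ (StrongDual ℂ A)) : H i →L⋆[ℂ] H i →L[ℂ] ℂ :=
  LinearMap.mkContinuous₂
    (LinearMap.mk₂'ₛₗ (starRingEnd ℂ) (RingHom.id ℂ) (fun η ξ => x (vf A i ξ η))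
      (fun η η' ξ => by
        rw [← map_add]; congr 1; ext a; simp)
      (fun c η ξ => by
        rw [← map_smul]; congr 1; ext a; simp [mul_comm])
      (fun η ξ ξ' => by
        rw [← map_add]; congr 1; ext a; simp)
      (fun c η ξ => by
        rw [← map_smul]; congr 1; ext a; simp)) ‖x‖
    fun η ξ => by
      refine (x.le_opNorm _).trans ?_
      rw [mul_assoc, mul_comm ‖η‖]
      exact mul_le_mul_of_nonneg_left (norm_vf_le i ξ η) (norm_nonneg _)

/-- The operator on `H i` of an element of the bidual: `⟨η, xᵢ ξ⟩ = x(ω_{ξ,η})`. -/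
def bidualOp (i : ι) (x : StrongDual ℂ (StrongDual ℂ A)) : H i →L[ℂ] H i :=
  -- The operator of the form appears in the first slot of the inner product; the adjoint moves it
  -- to the second.
  star (InnerProductSpace.continuousLinearMapOfBilin (bidualForm i x))

theorem inner_bidualOp (i : ι) (x : StrongDual ℂ (StrongDual ℂ A)) (ξ η : H i) :
    Inner.inner ℂ η (bidualOp i x ξ) = x (vf A i ξ η) := by
  rw [bidualOp, ContinuousLinearMap.star_eq_adjoint, ContinuousLinearMap.adjoint_inner_right,
    InnerProductSpace.continuousLinearMapOfBilin_apply]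
  rfl

/-- Moving a to the other side of the inner product turns x applied to b ↦ ⟨η, abξ⟩ into the
defining relation of `bidualOp` at a*η. Thus the module action on coefficients only changes vectors.
-/
theorem lact_vf (i : ι) (x : StrongDual ℂ (StrongDual ℂ A)) (ξ η : H i) :
    lact x (vf A i ξ η) = vf A i (bidualOp i x ξ) η := by
  ext a
  rw [vf_apply, ← ContinuousLinearMap.adjoint_inner_left, inner_bidualOp]
  change x _ = x _
  congr 1
  ext b
  rw [vf_apply, ContinuousLinearMap.adjoint_inner_left]
  rfl

theorem bidualOp_bmul (i : ι) (x y : StrongDual ℂ (StrongDual ℂ A)) :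
    bidualOp i (bmul x y) = bidualOp i x * bidualOp i y := by
  ext ξ
  refine ext_inner_left ℂ fun η => ?_
  rw [inner_bidualOp]
  change x (lact y _) = _
  rw [lact_vf, ← inner_bidualOp]
  rfl

theorem bidualOp_bstar (i : ι) (x : StrongDual ℂ (StrongDual ℂ A)) :
    bidualOp i (bstar x) = star (bidualOp i x) := by
  ext ξ
  refine ext_inner_left ℂ fun η => ?_
  rw [inner_bidualOp, ContinuousLinearMap.star_eq_adjoint,
    ContinuousLinearMap.adjoint_inner_right, ← inner_conj_symm, inner_bidualOp]
  change star (x _) = star (x _)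
  congr 2
  ext a
  change star (Inner.inner ℂ η (star (a.val.comp i) ξ)) = _
  rw [ContinuousLinearMap.star_eq_adjoint, ContinuousLinearMap.adjoint_inner_right]
  exact inner_conj_symm _ _

theorem ract_vf (i : ι) (x : StrongDual ℂ (StrongDual ℂ A)) (ξ η : H i) :
    ract (vf A i ξ η) x = vf A i ξ (star (bidualOp i x) η) := by
  ext a
  rw [vf_apply, ContinuousLinearMap.star_eq_adjoint, ContinuousLinearMap.adjoint_inner_left,
    inner_bidualOp]
  rfl

/-- The operator T of u satisfies that T*T is a projection, so ‖T‖² = ‖T*T‖ ≤ 1. -/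
theorem norm_bidualOp_le_one (i : ι) (u : StrongDual ℂ (StrongDual ℂ A))
    (h : IsBProj (bmul (bstar u) u)) : ‖bidualOp i u‖ ≤ 1 := by
  set T := bidualOp i u with hT
  have hP : (star T * T) * (star T * T) = star T * T := by
    have := congrArg (bidualOp i) h.1
    simpa only [bidualOp_bmul, bidualOp_bstar] using this
  have hsa : star (star T * T) = star T * T := by rw [star_mul, star_star]
  have h1 : ‖star T * T‖ * ‖star T * T‖ = ‖star T * T‖ := by
    rw [← CStarRing.norm_star_mul_self (x := star T * T), hsa, hP]
  have h2 : ‖star T * T‖ ≤ 1 := by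
    nlinarith [norm_nonneg (star T * T)]
  rw [CStarRing.norm_star_mul_self] at h2
  nlinarith [norm_nonneg T]

end BidualOperators

/-! ### Absolute values of coset functionals, and necessity of normality. -/

section Polar

variable {G : Type u} [Group G] [TopologicalSpace G] [IsTopologicalGroup G]
  [LocallyCompactSpace G] [MeasurableSpace G] [BorelSpace G]

/-- Every functional φ is a coefficient with ‖ξ‖ ≤ ‖φ‖ and ‖η‖ ≤ 1, so the norm of u is controlled
by the operators of u. -/
theorem norm_bidual_le_one (u : StrongDual ℂ (StrongDual ℂ (groupCStar G)))
    (h : IsBProj (bmul (bstar u) u)) : ‖u‖ ≤ 1 := by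
  refine ContinuousLinearMap.opNorm_le_bound _ zero_le_one fun φ => ?_
  obtain ⟨π, ξ, η, hξ, hη, hφ⟩ := exists_eq_vf φ
  conv_lhs => rw [hφ]
  rw [← inner_bidualOp, one_mul]
  calc _ ≤ ‖η‖ * ‖bidualOp π u ξ‖ := norm_inner_le_norm _ _
    _ ≤ 1 * (1 * ‖ξ‖) := by
      gcongr
      exact (ContinuousLinearMap.le_opNorm _ _).trans
        (mul_le_mul_of_nonneg_right (norm_bidualOp_le_one π u h) (norm_nonneg _))
    _ ≤ ‖φ‖ := by rw [one_mul, one_mul]; exact hξ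

theorem IsPolarDecomposition.lact_bstar {A : Type*} [NonUnitalCStarAlgebra A]
    {ω τ : StrongDual ℂ A} {u : StrongDual ℂ (StrongDual ℂ A)}
    (h : IsPolarDecomposition ω u τ) : lact (bstar u) ω = τ := by
  obtain ⟨-, rfl, -, hc, -⟩ := h
  rw [← lact_bmul]
  ext a
  exact (hc (ContinuousLinearMap.apply ℂ ℂ a)).2

theorem IsPositive.conj_symm {A : Type*} [NonUnitalCStarAlgebra A] {φ : StrongDual ℂ A}
    (h : IsPositive φ) (a b : A) : star (φ (star b * a)) = φ (star a * b) := by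
  have h1 := (h (a + b)).2
  have h2 := (h (a + Complex.I • b)).2
  have ha := (h a).2
  have hb := (h b).2
  simp only [star_add, star_smul, add_mul, mul_add, map_add, smul_mul_assoc, mul_smul_comm,
    map_smul, smul_eq_mul, Complex.add_im, Complex.mul_im, Complex.star_def, Complex.conj_I,
    Complex.neg_re, Complex.neg_im, Complex.I_re, Complex.I_im, Complex.mul_re] at h1 h2
  apply Complex.ext
  · simp only [Complex.star_def, Complex.conj_re]
    linarith
  · simp only [Complex.star_def, Complex.conj_im]
    linarith

/-- The Cauchy-Schwarz inequality for positive functionals. -/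
theorem IsPositive.norm_sq_le {A : Type*} [NonUnitalCStarAlgebra A] {φ : StrongDual ℂ A}
    (h : IsPositive φ) (a b : A) :
    ‖φ (star b * a)‖ ^ 2 ≤ (φ (star b * b)).re * (φ (star a * a)).re := by
  let c : PreInnerProductSpace.Core ℂ A :=
    { inner := fun a b => φ (star a * b)
      conj_inner_symm := fun a b => h.conj_symm a b
      re_inner_nonneg := fun a => (h a).1
      add_left := fun a b c => by rw [star_add, add_mul, map_add]
      smul_left := fun a b c => by rw [star_smul, smul_mul_assoc, map_smul]; rfl }
  have h1 := InnerProductSpace.Core.inner_mul_inner_self_le (c := c) b a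
  change ‖φ (star b * a)‖ * ‖φ (star a * b)‖ ≤ _ at h1
  rw [← h.conj_symm a b, norm_star, ← sq] at h1
  exact h1

/-- Cauchy-Schwarz for φ with the approximate unit e in place of 1; φ(e*e) = ⟨π(e)η, π(e)ζ⟩ tends to
⟨η, ζ⟩. -/
theorem norm_sq_apply_le_of_isPositive {π : UnitaryRep G} {ζ η : π.space}
    (h : IsPositive (vf (groupCStar G) π ζ η)) (a : groupCStar G) :
    ‖vf (groupCStar G) π ζ η a‖ ^ 2 ≤
      (Inner.inner ℂ η ζ).re * (vf (groupCStar G) π ζ η (star a * a)).re := by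
  have h1 := (((vf (groupCStar G) π ζ η).continuous.tendsto _).comp
    (tendsto_star_bump_mul a)).norm.pow 2
  have h2 : Filter.Tendsto (fun U => (vf (groupCStar G) π ζ η
      (star (lamC (bump U)) * lamC (bump U))).re) (smallNhds G)
      (nhds (Inner.inner ℂ η ζ).re) := by
    have h3 := (tendsto_integrated_bump π η).inner (𝕜 := ℂ) (tendsto_integrated_bump π ζ)
    refine ((Complex.continuous_re.tendsto _).comp h3).congr fun U => ?_
    change _ = (Inner.inner ℂ η (star (π.integrated (bump U)) (π.integrated (bump U) ζ))).re
    rw [ContinuousLinearMap.star_eq_adjoint, ContinuousLinearMap.adjoint_inner_right]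
    rfl
  exact le_of_tendsto_of_tendsto' h1 (h2.mul_const _) fun U => h.norm_sq_le a _

/-- The norm of a positive functional is bounded by its value "at 1", here ⟨η, ζ⟩: the preceding
inequality gives ‖φ‖² ≤ Re⟨η, ζ⟩ ‖φ‖. -/
theorem norm_le_inner_of_isPositive {π : UnitaryRep G} {ζ η : π.space}
    (h : IsPositive (vf (groupCStar G) π ζ η)) :
    ‖vf (groupCStar G) π ζ η‖ ≤ (Inner.inner ℂ η ζ).re := by
  set φ := vf (groupCStar G) π ζ η with hφ
  by_cases h0 : φ = 0
  · rw [h0, norm_zero]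
    have h2 : Filter.Tendsto (fun U => (φ (star (lamC (bump U)) * lamC (bump U))).re)
        (smallNhds G) (nhds (Inner.inner ℂ η ζ).re) := by
      have h3 := (tendsto_integrated_bump π η).inner (𝕜 := ℂ) (tendsto_integrated_bump π ζ)
      refine ((Complex.continuous_re.tendsto _).comp h3).congr fun U => ?_
      change _ = (Inner.inner ℂ η (star (π.integrated (bump U)) (π.integrated (bump U) ζ))).re
      rw [ContinuousLinearMap.star_eq_adjoint, ContinuousLinearMap.adjoint_inner_right]
      rfl
    exact ge_of_tendsto h2 (Filter.Eventually.of_forall fun U => (h _).1)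
  have hn : 0 < ‖φ‖ := norm_pos_iff.2 h0
  obtain ⟨a, ha⟩ : ∃ a, φ a ≠ 0 := by
    by_contra hne
    push Not at hne
    exact h0 (ContinuousLinearMap.ext hne)
  have hc : 0 ≤ (Inner.inner ℂ η ζ).re := by
    have h1 := norm_sq_apply_le_of_isPositive h a
    have h2 := (h a).1
    have h3 : 0 < ‖vf (groupCStar G) π ζ η a‖ ^ 2 := by
      have := norm_pos_iff.2 ha
      positivity
    by_contra hneg
    push Not at hneg
    nlinarith
  have h1 : ‖φ‖ ≤ Real.sqrt ((Inner.inner ℂ η ζ).re * ‖φ‖) := by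
    refine ContinuousLinearMap.opNorm_le_bound _ (Real.sqrt_nonneg _) fun a => ?_
    refine abs_le_of_sq_le_sq' ?_ (by positivity) |>.2
    rw [mul_pow, Real.sq_sqrt (by positivity), mul_assoc]
    refine (norm_sq_apply_le_of_isPositive h a).trans (mul_le_mul_of_nonneg_left ?_ hc)
    calc (φ (star a * a)).re ≤ ‖φ (star a * a)‖ := Complex.re_le_norm _
      _ ≤ ‖φ‖ * ‖star a * a‖ := φ.le_opNorm _
      _ = ‖φ‖ * ‖a‖ ^ 2 := by rw [CStarRing.norm_star_mul_self, sq]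
  have h2 : ‖φ‖ ^ 2 ≤ (Inner.inner ℂ η ζ).re * ‖φ‖ := by
    rw [← Real.sq_sqrt (show 0 ≤ (Inner.inner ℂ η ζ).re * ‖φ‖ by positivity)]
    gcongr
  rw [sq] at h2
  exact le_of_mul_le_mul_right h2 hn

theorem eq_of_one_le_inner {E : Type*} [NormedAddCommGroup E] [InnerProductSpace ℂ E] {x y : E}
    (hx : ‖x‖ ≤ 1) (hy : ‖y‖ ≤ 1) (h : 1 ≤ (Inner.inner ℂ x y).re) : x = y := by
  have h1 := norm_sub_sq (𝕜 := ℂ) x y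
  rw [RCLike.re_eq_complex_re] at h1
  have h2 : ‖x - y‖ ^ 2 ≤ 0 := by nlinarith [norm_nonneg x, norm_nonneg y]
  have h3 : ‖x - y‖ = 0 := by nlinarith [norm_nonneg (x - y)]
  exact sub_eq_zero.1 (norm_eq_zero.1 h3)

variable (N : Subgroup G) (hN : IsOpen (N : Set G))

/-- The absolute values of the functional of an open coset. -/
theorem polar_cosetFun {s : G} {u : StrongDual ℂ (StrongDual ℂ (groupCStar G))}
    {τ : StrongDual ℂ (groupCStar G)} (h : IsPolarDecomposition (cosetFun N hN s) u τ) :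
    τ = vf (groupCStar G) (quasiReg N hN) (qv N hN (s : G ⧸ N)) (qv N hN (s : G ⧸ N)) ∧
    leftAbs u τ = cosetFun N hN 1 := by
  have hproj := h.2.2.1
  set π := quasiReg N hN
  set ξ := qv N hN ((1 : G) : G ⧸ N)
  set η := qv N hN (s : G ⧸ N)
  set U := bidualOp π u with hU
  have hU1 : ‖U‖ ≤ 1 := norm_bidualOp_le_one π u hproj
  have hUs1 : ‖star U‖ ≤ 1 := by rwa [norm_star]
  have hξ : ‖ξ‖ = 1 := norm_qv N hN _
  have hη : ‖η‖ = 1 := norm_qv N hN _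
  have hτ : τ = vf (groupCStar G) π (star U ξ) η := by
    rw [← h.lact_bstar, cosetFun, lact_vf, bidualOp_bstar]
  -- Since ω = u.τ, ‖u‖ ≤ 1 and ‖ω‖ ≥ 1.
  have hle : 1 ≤ ‖τ‖ := by
    have h1 := one_le_norm_cosetFun N hN s
    rw [h.2.1] at h1
    refine h1.trans ((norm_lact_le u τ).trans ?_)
    exact mul_le_of_le_one_left (norm_nonneg _) (norm_bidual_le_one u hproj)
  have hpos : IsPositive (vf (groupCStar G) π (star U ξ) η) := hτ ▸ h.1
  -- Positivity makes Re⟨δ_{sN}, U*δ_N⟩ at least ‖τ‖. As both vectors lie in the unit ball, they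
  -- must coincide.
  have hinner : 1 ≤ (Inner.inner ℂ η (star U ξ)).re := by
    refine le_trans ?_ (norm_le_inner_of_isPositive hpos)
    rw [← hτ]; exact hle
  have hζ : η = star U ξ := by
    refine eq_of_one_le_inner hη.le ?_ hinner
    refine ((star U).le_opNorm ξ).trans ?_
    rw [hξ, mul_one]; exact hUs1
  have hUη : U η = ξ := by
    refine eq_of_one_le_inner ?_ hξ.le ?_
    · refine (U.le_opNorm η).trans ?_
      rw [hη, mul_one]; exact hU1
    · rwa [← ContinuousLinearMap.adjoint_inner_right, ← ContinuousLinearMap.star_eq_adjoint]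
  refine ⟨by rw [hτ, ← hζ], ?_⟩
  rw [leftAbs, ← h.2.1, cosetFun, ract_vf, bidualOp_bstar, star_star, hUη, cosetFun]

include hN in
theorem isOpen_conj (s : G) : IsOpen ((MulAut.conj s • N : Subgroup G) : Set G) := by
  have : ((MulAut.conj s • N : Subgroup G) : Set G) = (fun g => s⁻¹ * g * s) ⁻¹' (N : Set G) := by
    ext g
    rw [SetLike.mem_coe, Subgroup.mem_pointwise_smul_iff_inv_smul_mem]
    simp [← map_inv, MulAut.smul_def]
  rw [this]
  exact hN.preimage (by fun_prop)

/-- The stabilizer of the point sN of G/N is sNs⁻¹. -/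
theorem vf_qv_self (s : G) :
    vf (groupCStar G) (quasiReg N hN) (qv N hN (s : G ⧸ N)) (qv N hN (s : G ⧸ N)) =
      cosetFun (MulAut.conj s • N) (isOpen_conj N hN s) 1 := by
  classical
  have h := represents_cosetFun (MulAut.conj s • N) (isOpen_conj N hN s) 1
  have h' := represents_vf (quasiReg N hN) (qv N hN (s : G ⧸ N)) (qv N hN (s : G ⧸ N))
  refine h'.functional_unique (cast (congrArg _ (funext fun g => ?_)) h)
  rw [one_smul, quasiReg_op_qv, inner_qv_qv, Set.indicator_apply]
  change _ = (if (s : G ⧸ N) = ((g * s : G) : G ⧸ N) then (1 : ℂ) else 0)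
  simp only [QuotientGroup.eq, SetLike.mem_coe, Subgroup.mem_pointwise_smul_iff_inv_smul_mem]
  simp [← map_inv, MulAut.smul_def, mul_assoc]

/-- If the functional of an open subgroup is a Haar idempotent, the subgroup is normal. -/
theorem normal_of_isHaarIdempotent (h : IsHaarIdempotent (cosetFun N hN 1)) : N.Normal := by
  obtain ⟨-, ℍ, θ, -, -, hτ⟩ := h
  set π := quasiReg N hN
  set ξ := qv N hN ((1 : G) : G ⧸ N)
  -- Both conditions say that τ(a*a) = 0: one through τ(a*a) = ‖aξ‖², the other through faithfulness
  -- of the Haar state.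
  have hnull : ∀ a : groupCStar G, a.val.comp π ξ = 0 ↔ θ a = 0 := by
    intro a
    have h1 : cosetFun N hN 1 (star a * a) = ((‖a.val.comp π ξ‖ ^ 2 : ℝ) : ℂ) :=
      inner_star_mul_self a π ξ
    constructor
    · intro ha
      apply ℍ.haar_faithful
      rw [← map_star, ← map_mul, ← hτ, h1, ha]
      simp
    · intro ha
      rw [hτ, map_mul, ha, mul_zero, map_zero] at h1
      simpa using h1.symm
  have key : ∀ n ∈ N, ∀ g : G, ((n⁻¹ * g : G) : G ⧸ N) = (g : G ⧸ N) := by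
    intro n hn g
    set v := qv N hN ((n⁻¹ * g : G) : G ⧸ N) - qv N hN (g : G ⧸ N) with hv
    have h1 : ∀ b : groupCStar G, star (b.val.comp π) v = 0 := by
      intro b
      -- The adjoint of u_n b - b sends w to b*(π(n⁻¹)w - w), which vanishes at the N-fixed vector
      -- ξ.
      have ha : ∀ w : π.space, (star (umul n b - b)).val.comp π w =
          star (b.val.comp π) (π.op n⁻¹ w - w) := by
        intro w
        refine ext_inner_left ℂ fun y => ?_
        change Inner.inner ℂ y (star (π.op n * b.val.comp π - b.val.comp π) w) = _
        rw [ContinuousLinearMap.star_eq_adjoint, ContinuousLinearMap.star_eq_adjoint,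
          ContinuousLinearMap.adjoint_inner_right, ContinuousLinearMap.adjoint_inner_right,
          inner_sub_right, ← π.inner_op_left, ← inner_sub_left]
        rfl
      have h2 : θ (star (umul n b - b)) = 0 := by
        rw [← hnull, ha]
        have : π.op n⁻¹ ξ = ξ := by
          rw [quasiReg_op_qv]
          congr 1
          change ((n⁻¹ * 1 : G) : G ⧸ N) = _
          rw [QuotientGroup.eq]
          simpa using hn
        rw [this, sub_self, map_zero]
      -- The kernel of θ is also a right ideal. The extra factor u_g e moves ξ to the basis vector
      -- of gN.
      have h3 : θ (star (umul n b - b) * umul g (lamC (bump (N : Set G)))) = 0 := by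
        rw [map_mul, h2, zero_mul]
      rw [← hnull] at h3
      change (star (umul n b - b)).val.comp π
        (π.op g (π.integrated (bump (N : Set G)) ξ)) = 0 at h3
      rw [integrated_bump_qv_one, ha, quasiReg_op_qv, quasiReg_op_qv] at h3
      have e1 : g • ((1 : G) : G ⧸ N) = (g : G ⧸ N) := by
        change ((g * 1 : G) : G ⧸ N) = _
        rw [mul_one]
      rw [e1] at h3
      exact h3
    -- Let b run through the approximate unit: b*v = 0 for all of them leaves only v = 0.
    have h4 : Inner.inner ℂ v v = (0 : ℂ) := by
      have h5 := (tendsto_integrated_bump π v).inner (𝕜 := ℂ) (tendsto_const_nhds (x := v))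
      refine tendsto_nhds_unique h5 (tendsto_const_nhds.congr fun U => ?_)
      have h6 := h1 (lamC (bump U))
      change star (π.integrated (bump U)) v = 0 at h6
      rw [← ContinuousLinearMap.adjoint_inner_right, ← ContinuousLinearMap.star_eq_adjoint, h6,
        inner_zero_right]
    have h7 : v = 0 := inner_self_eq_zero.1 h4
    by_contra hne
    classical
    have h8 := inner_qv_qv N hN ((n⁻¹ * g : G) : G ⧸ N) (g : G ⧸ N)
    rw [if_neg hne, ← sub_eq_zero.1 h7, inner_self_eq_norm_sq_to_K, norm_qv] at h8
    simp at h8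
  refine ⟨fun n hn g => ?_⟩
  have := QuotientGroup.eq.1 (key n hn g⁻¹)
  simpa [mul_assoc] using this

end Polar

end CIdem

end

/-! ### Hilbert bases of tensor products, and amplifications. -/

noncomputable section

namespace CIdem

set_option linter.unusedSectionVars false

section TensorBasis

variable {ι κ : Type*} {E F K : Type*} [NormedAddCommGroup E] [InnerProductSpace ℂ E]
  [NormedAddCommGroup F] [InnerProductSpace ℂ F] [NormedAddCommGroup K] [InnerProductSpace ℂ K]

theorem orthonormal_htmul {v : ι → E} {w : κ → F} (hv : Orthonormal ℂ v) (hw : Orthonormal ℂ w) :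
    Orthonormal ℂ fun p : ι × κ => htmul (v p.1) (w p.2) := by
  classical
  rw [orthonormal_iff_ite] at *
  intro p q
  simp only [inner_htmul, hv, hw, Prod.ext_iff]
  split_ifs <;> simp_all

/-- A closed subspace containing the tensors of two total families is everything. -/
theorem top_le_span_htmul {v : ι → E} {w : κ → F}
    (hv : ⊤ ≤ (Submodule.span ℂ (Set.range v)).topologicalClosure)
    (hw : ⊤ ≤ (Submodule.span ℂ (Set.range w)).topologicalClosure)
    {S : Submodule ℂ (HTensor E F)} (hS : IsClosed (S : Set (HTensor E F)))
    (h : ∀ i j, htmul (v i) (w j) ∈ S) : ⊤ ≤ S := by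
  have h1 : ∀ i y, htmul (v i) y ∈ S := by
    intro i
    have : (Submodule.span ℂ (Set.range w)).topologicalClosure ≤
        S.comap (htmulL E F (v i)).toLinearMap := by
      refine Submodule.topologicalClosure_minimal _ ?_ (hS.preimage (htmulL E F (v i)).continuous)
      rw [Submodule.span_le]
      rintro _ ⟨j, rfl⟩
      exact h i j
    exact fun y => this (hw trivial)
  have h2 : ∀ x y, htmul x y ∈ S := by
    intro x y
    have : (Submodule.span ℂ (Set.range v)).topologicalClosure ≤
        S.comap ((htmulL E F).flip y).toLinearMap := by
      refine Submodule.topologicalClosure_minimal _ ?_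
        (hS.preimage ((htmulL E F).flip y).continuous)
      rw [Submodule.span_le]
      rintro _ ⟨i, rfl⟩
      exact h1 i y
    exact this (hv trivial)
  have h3 : Submodule.span ℂ {z : HTensor E F | ∃ x y, z = htmul x y} ≤ S := by
    rw [Submodule.span_le]
    rintro _ ⟨x, y, rfl⟩
    exact h2 x y
  exact fun z _ => hS.closure_subset_iff.2 h3 (dense_span_htmul E F z)

variable [CompleteSpace E] [CompleteSpace F] [CompleteSpace K]

theorem hilbertBasis_top_le (b : HilbertBasis ι ℂ E) :
    ⊤ ≤ (Submodule.span ℂ (Set.range b)).topologicalClosure := b.dense_span.ge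

/-- The tensor product of two Hilbert bases. -/
def tensorBasis (b : HilbertBasis ι ℂ E) (c : HilbertBasis κ ℂ F) :
    HilbertBasis (ι × κ) ℂ (HTensor E F) :=
  HilbertBasis.mk (orthonormal_htmul b.orthonormal c.orthonormal)
    (top_le_span_htmul (hilbertBasis_top_le b) (hilbertBasis_top_le c)
      (Submodule.isClosed_topologicalClosure _)
      fun i j => Submodule.le_topologicalClosure _ (Submodule.subset_span ⟨(i, j), rfl⟩))

@[simp] theorem tensorBasis_apply (b : HilbertBasis ι ℂ E) (c : HilbertBasis κ ℂ F) (p : ι × κ) :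
    tensorBasis b c p = htmul (b p.1) (c p.2) := by
  rw [tensorBasis, HilbertBasis.coe_mk]

/-- The unitary between two Hilbert spaces that maps one Hilbert basis to another one. -/
def basisUnitary (b : HilbertBasis ι ℂ E) (c : HilbertBasis κ ℂ F) (e : ι ≃ κ) : E ≃ₗᵢ[ℂ] F :=
  b.repr.trans (HilbertBasis.mk (v := fun i => c (e i)) (c.orthonormal.comp e e.injective)
    (by
      have : Set.range (fun i => c (e i)) = Set.range c := e.surjective.range_comp c
      rw [this]
      exact hilbertBasis_top_le c)).repr.symm

@[simp] theorem basisUnitary_apply (b : HilbertBasis ι ℂ E) (c : HilbertBasis κ ℂ F) (e : ι ≃ κ)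
    (i : ι) : basisUnitary b c e (b i) = c (e i) := by
  classical
  rw [basisUnitary, LinearIsometryEquiv.trans_apply, b.repr_self, HilbertBasis.repr_symm_single,
    HilbertBasis.coe_mk]

/-- The Hilbert basis of `ℓ²(X)`. -/
def dltBasis (X : Type*) : HilbertBasis X ℂ (L2 X) :=
  HilbertBasis.mk (v := dlt (X := X))
    (by classical exact orthonormal_iff_ite.2 fun x y => inner_dlt_dlt x y)
    (Submodule.dense_iff_topologicalClosure_eq_top.1 (dense_span_dlt X)).ge

@[simp] theorem dltBasis_apply (X : Type*) (x : X) : dltBasis X x = dlt x := by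
  rw [dltBasis, HilbertBasis.coe_mk]

theorem hilbertBasis_clm_ext {Y : Type*} [NormedAddCommGroup Y] [NormedSpace ℂ Y]
    (b : HilbertBasis ι ℂ E) {S T : E →L[ℂ] Y} (h : ∀ i, S (b i) = T (b i)) : S = T := by
  refine ContinuousLinearMap.ext_on (s := Set.range b) (fun x => ?_) ?_
  · exact hilbertBasis_top_le b (x := x) trivial
  · rintro _ ⟨i, rfl⟩
    exact h i

end TensorBasis

section Amplification

variable {E F K : Type*} [NormedAddCommGroup E] [InnerProductSpace ℂ E]
  [NormedAddCommGroup F] [InnerProductSpace ℂ F] [NormedAddCommGroup K] [InnerProductSpace ℂ K]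

variable (F) in
/-- The amplification `T ↦ T ⊗ 1`. -/
def ampL : (E →L[ℂ] E) →L[ℂ] (HTensor E F →L[ℂ] HTensor E F) :=
  LinearMap.mkContinuous
    { toFun := fun T => opTensor T 1
      map_add' := fun S T => opTensor_ext fun x y => by
        simp [opTensor_htmul, add_htmul]
      map_smul' := fun c T => opTensor_ext fun x y => by
        simp [opTensor_htmul, smul_htmul] } 1 fun T => by
    rw [one_mul]
    refine (norm_opTensor_le _ _).trans (mul_le_of_le_one_right (norm_nonneg _) ?_)
    exact ContinuousLinearMap.norm_id_le

/-- The map `T ↦ R T L` between operators on different spaces. -/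
def sandwichL (R : E →L[ℂ] K) (L : K →L[ℂ] E) : (E →L[ℂ] E) →L[ℂ] (K →L[ℂ] K) :=
  (ContinuousLinearMap.compL ℂ K E K R).comp ((ContinuousLinearMap.compL ℂ K E E).flip L)

@[simp] theorem sandwichL_apply (R : E →L[ℂ] K) (L : K →L[ℂ] E) (T : E →L[ℂ] E) (x : K) :
    sandwichL R L T x = R (T (L x)) := rfl

theorem norm_sandwichL_le {R : E →L[ℂ] K} {L : K →L[ℂ] E} (hR : ‖R‖ ≤ 1) (hL : ‖L‖ ≤ 1)
    (T : E →L[ℂ] E) : ‖sandwichL R L T‖ ≤ ‖T‖ := by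
  refine ContinuousLinearMap.opNorm_le_bound _ (norm_nonneg _) fun x => ?_
  rw [sandwichL_apply]
  calc ‖R (T (L x))‖ ≤ 1 * ‖T (L x)‖ := R.le_of_opNorm_le hR _
    _ ≤ ‖T‖ * ‖L x‖ := by rw [one_mul]; exact T.le_opNorm _
    _ ≤ ‖T‖ * (1 * ‖x‖) := by gcongr; exact L.le_of_opNorm_le hL _
    _ = ‖T‖ * ‖x‖ := by rw [one_mul]

variable {ι κ : Type*} {H : ι → Type*} {M : κ → Type*}
  [∀ i, NormedAddCommGroup (H i)] [∀ i, InnerProductSpace ℂ (H i)] [∀ i, CompleteSpace (H i)]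
  [∀ j, NormedAddCommGroup (M j)] [∀ j, InnerProductSpace ℂ (M j)] [∀ j, CompleteSpace (M j)]

/-- A bounded linear map into `∏ⱼ B(Mⱼ)` with values in a C*-subalgebra. -/
def CAlg.codRestrict {A : Type*} [NormedAddCommGroup A] [NormedSpace ℂ A] (B : CAlg M)
    (f : A →L[ℂ] BProd M) (hf : ∀ a, f a ∈ B.toSub) : A →L[ℂ] B :=
  LinearMap.mkContinuous
    { toFun := fun a => CAlg.mkElem (f a) (hf a)
      map_add' := fun a b => CAlg.val_injective (map_add f a b)
      map_smul' := fun c a => CAlg.val_injective (map_smul f c a) } ‖f‖ f.le_opNorm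

variable [CompleteSpace K]

/-- The constant family of operators. -/
def constL (κ : Type*) : (K →L[ℂ] K) →L[ℂ] BProd (fun _ : κ => K) :=
  LinearMap.mkContinuous
    { toFun := fun T => BProd.mk (fun _ => T) ‖T‖ fun _ => le_rfl
      map_add' := fun _ _ => rfl
      map_smul' := fun _ _ => rfl } 1 fun T => by
    rw [one_mul]
    exact BProd.norm_le_of_comp (norm_nonneg _) fun _ => le_rfl

end Amplification

end CIdem

end

/-! ### Pointwise limits of contractions, and the reduced C*-algebra of a discrete group. -/

noncomputable section

namespace CIdem

set_option linter.unusedSectionVars false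

section PointwiseLimits

variable {α Y Z : Type*} [NormedAddCommGroup Y] [NormedSpace ℂ Y] [NormedAddCommGroup Z]
  [NormedSpace ℂ Z]

/-- The subspace of the vectors at which a net of operators converges. -/
def convergenceSet (T : α → Y →L[ℂ] Z) (l : Filter α) : Submodule ℂ Y where
  carrier := {y | ∃ z, Filter.Tendsto (fun i => T i y) l (nhds z)}
  add_mem' := by
    rintro a b ⟨z, hz⟩ ⟨w, hw⟩
    exact ⟨z + w, by simpa only [map_add] using hz.add hw⟩
  zero_mem' := ⟨0, by simpa only [map_zero] using tendsto_const_nhds⟩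
  smul_mem' := by
    rintro c a ⟨z, hz⟩
    exact ⟨c • z, by simpa only [map_smul] using hz.const_smul c⟩

/-- Uniform contractivity makes the net Cauchy at limits of convergence points. It is then enough to
test convergence on generators. -/
theorem isClosed_convergenceSet [CompleteSpace Z] {l : Filter α} [l.NeBot] {T : α → Y →L[ℂ] Z}
    (hT : ∀ i y, ‖T i y‖ ≤ ‖y‖) : IsClosed (convergenceSet T l : Set Y) := by
  rw [← closure_subset_iff_isClosed]
  intro x hx
  suffices h : Cauchy (Filter.map (fun i => T i x) l) from CompleteSpace.complete h
  rw [Metric.cauchy_iff]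
  refine ⟨inferInstance, fun ε hε => ?_⟩
  obtain ⟨y, ⟨z, hz⟩, hxy⟩ := Metric.mem_closure_iff.1 hx (ε / 4) (by positivity)
  refine ⟨Metric.ball z (ε / 2), ?_, fun a ha b hb => ?_⟩
  · rw [Filter.mem_map]
    filter_upwards [Metric.tendsto_nhds.1 hz (ε / 4) (by positivity)] with i hi
    have h1 : dist (T i x) (T i y) ≤ dist x y := by
      rw [dist_eq_norm, dist_eq_norm, ← map_sub]; exact hT i _
    have h2 := dist_triangle (T i x) (T i y) z
    change dist (T i x) z < ε / 2
    linarith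
  · have := dist_triangle_right a b z
    rw [Metric.mem_ball] at ha hb
    linarith

/-- A pointwise convergent net of contractions converges to a bounded operator. -/
theorem exists_clm_tendsto {l : Filter α} [l.NeBot] {T : α → Y →L[ℂ] Z}
    (hT : ∀ i y, ‖T i y‖ ≤ ‖y‖) (h : ∀ y, y ∈ convergenceSet T l) :
    ∃ E : Y →L[ℂ] Z, ∀ y, Filter.Tendsto (fun i => T i y) l (nhds (E y)) := by
  choose E hE using h
  refine ⟨LinearMap.mkContinuous
    { toFun := E
      map_add' := fun a b => tendsto_nhds_unique (hE _) (by
        simpa only [map_add] using (hE a).add (hE b))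
      map_smul' := fun c a => tendsto_nhds_unique (hE _) (by
        simpa only [map_smul, RingHom.id_apply] using (hE a).const_smul c) } 1 fun y => ?_, hE⟩
  rw [one_mul]
  exact le_of_tendsto (hE y).norm (Filter.Eventually.of_forall fun i => hT i y)

end PointwiseLimits

/-! ### The reduced C*-algebra of a discrete group -/

section Reduced

variable {X : Type u} [Group X]

/-- The left regular representation. -/
def lreg (x : X) : L2 X →L[ℂ] L2 X := (permL2 (Equiv.mulLeft x)).toContinuousLinearMap

@[simp] theorem lreg_dlt (x y : X) : lreg x (dlt y) = dlt (x * y) := permL2_dlt _ _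

theorem lreg_apply (x : X) (f : L2 X) (y : X) : lreg x f y = f (x⁻¹ * y) := rfl

theorem lreg_mul (x y : X) : lreg x * lreg y = lreg (x * y) :=
  dlt_ext fun z => by
    change lreg x (lreg y (dlt z)) = _
    simp [mul_assoc]

@[simp] theorem lreg_one : lreg (1 : X) = 1 := dlt_ext fun z => by simp

theorem star_lreg (x : X) : star (lreg x) = lreg x⁻¹ := by
  classical
  refine dlt_ext fun z => ext_inner_left ℂ fun v => ?_
  rw [ContinuousLinearMap.star_eq_adjoint, ContinuousLinearMap.adjoint_inner_right,
    ← inner_conj_symm, inner_dlt_left, lreg_apply, lreg_dlt, ← inner_conj_symm v, inner_dlt_left]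

variable (X) in
/-- The reduced C*-algebra acts on one Hilbert space. -/
abbrev redFam : PUnit.{u + 1} → Type u := fun _ => L2 X

variable (X) in
/-- The linear span of the operators of the left regular representation. -/
def redSub : NonUnitalStarSubalgebra ℂ (BProd (redFam X)) where
  carrier := (Submodule.span ℂ (Set.range fun x : X => constL PUnit (lreg x)) :
    Submodule ℂ (BProd (redFam X)))
  add_mem' := add_mem
  zero_mem' := zero_mem _
  smul_mem' c _ h := Submodule.smul_mem _ c h
  mul_mem' := by
    intro a b ha hb
    rw [SetLike.mem_coe] at *
    induction ha using Submodule.span_induction with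
    | zero => rw [zero_mul]; exact zero_mem _
    | add a b _ _ ha hb => rw [add_mul]; exact add_mem ha hb
    | smul c a _ ha => rw [smul_mul_assoc]; exact Submodule.smul_mem _ c ha
    | mem a ha =>
      obtain ⟨x, rfl⟩ := ha
      induction hb using Submodule.span_induction with
      | zero => rw [mul_zero]; exact zero_mem _
      | add c d _ _ hc hd => rw [mul_add]; exact add_mem hc hd
      | smul c d _ hd => rw [mul_smul_comm]; exact Submodule.smul_mem _ c hd
      | mem y hy =>
        obtain ⟨y, rfl⟩ := hy
        exact Submodule.subset_span ⟨x * y, BProd.ext_comp fun _ => (lreg_mul x y).symm⟩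
  star_mem' := by
    intro a ha
    rw [SetLike.mem_coe] at *
    induction ha using Submodule.span_induction with
    | zero => rw [star_zero]; exact zero_mem _
    | add a b _ _ ha hb => rw [star_add]; exact add_mem ha hb
    | smul c a _ ha => rw [star_smul]; exact Submodule.smul_mem _ _ ha
    | mem a ha =>
      obtain ⟨x, rfl⟩ := ha
      exact Submodule.subset_span ⟨x⁻¹, BProd.ext_comp fun _ => (star_lreg x).symm⟩

variable (X) in
/-- The reduced group C*-algebra of the discrete group `X`. -/
def redAlg : CAlg (redFam X) where
  toSub := (redSub X).topologicalClosure
  isClosed := NonUnitalStarSubalgebra.isClosed_topologicalClosure _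

/-- The canonical unitaries of the reduced group C*-algebra. -/
def lamR (x : X) : redAlg X :=
  CAlg.mkElem (constL PUnit (lreg x)) (NonUnitalStarSubalgebra.le_topologicalClosure _
    (Submodule.subset_span ⟨x, rfl⟩))

theorem lamR_mul (x y : X) : lamR x * lamR y = lamR (x * y) :=
  CAlg.val_ext fun _ => lreg_mul x y

/-- A closed subspace containing the canonical unitaries is everything. -/
theorem redAlg_induction {p : Submodule ℂ (redAlg X)} (hp : IsClosed (p : Set (redAlg X)))
    (h : ∀ x, lamR x ∈ p) (a : redAlg X) : a ∈ p := by
  have h1 : (redSub X : Set (BProd (redFam X))) ⊆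
      (fun a : redAlg X => a.val) '' (p : Set (redAlg X)) := by
    intro b hb
    change b ∈ Submodule.span ℂ _ at hb
    induction hb using Submodule.span_induction with
    | zero => exact ⟨0, p.zero_mem, rfl⟩
    | add a b _ _ ha hb =>
      obtain ⟨a', ha', rfl⟩ := ha
      obtain ⟨b', hb', rfl⟩ := hb
      exact ⟨a' + b', p.add_mem ha' hb', rfl⟩
    | smul c a _ ha =>
      obtain ⟨a', ha', rfl⟩ := ha
      exact ⟨c • a', p.smul_mem c ha', rfl⟩
    | mem a ha =>
      obtain ⟨x, rfl⟩ := ha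
      exact ⟨lamR x, h x, rfl⟩
  have h2 : a.val ∈ closure ((fun a : redAlg X => a.val) '' (p : Set (redAlg X))) :=
    closure_mono h1 a.mem
  have h3 : a ∈ closure (p : Set (redAlg X)) :=
    ((CAlg.isometry_val (A := redAlg X)).isEmbedding.isInducing.closure_eq_preimage_closure_image
      _).symm ▸ h2
  rwa [hp.closure_eq] at h3

theorem redAlg_ext {Y : Type*} [NormedAddCommGroup Y] [NormedSpace ℂ Y]
    {S T : redAlg X →L[ℂ] Y} (h : ∀ x, S (lamR x) = T (lamR x)) (a : redAlg X) : S a = T a := by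
  refine redAlg_induction (p := LinearMap.eqLocus S.toLinearMap T.toLinearMap)
    (isClosed_eq S.continuous T.continuous) h a

section Membership

variable {κ : Type*} {M : κ → Type*}
  [∀ j, NormedAddCommGroup (M j)] [∀ j, InnerProductSpace ℂ (M j)] [∀ j, CompleteSpace (M j)]

theorem mem_of_redAlg {B : CAlg M} (f : redAlg X →L[ℂ] BProd M)
    (h : ∀ x, f (lamR x) ∈ B.toSub) (a : redAlg X) : f a ∈ B.toSub :=
  redAlg_induction (p := B.toSub.toSubmodule.comap f.toLinearMap)
    (B.isClosed.preimage f.continuous) h a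

theorem mem_of_spatial {ι κ' : Type*} {H : ι → Type*} {K : κ' → Type*}
    [∀ i, NormedAddCommGroup (H i)] [∀ i, InnerProductSpace ℂ (H i)] [∀ i, CompleteSpace (H i)]
    [∀ j, NormedAddCommGroup (K j)] [∀ j, InnerProductSpace ℂ (K j)] [∀ j, CompleteSpace (K j)]
    {A : CAlg H} {A' : CAlg K} {B : CAlg M} (f : spatial A A' →L[ℂ] BProd M)
    (h : ∀ a b, f (stmul a b) ∈ B.toSub) (t : spatial A A') : f t ∈ B.toSub :=
  spatial_induction (p := B.toSub.toSubmodule.comap f.toLinearMap)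
    (B.isClosed.preimage f.continuous) h t

end Membership

/-! ### The comultiplication -/

variable (X) in
/-- The permutation `(x, y) ↦ (x, x y)`. -/
def mulShear : X × X ≃ X × X where
  toFun p := (p.1, p.1 * p.2)
  invFun p := (p.1, p.1⁻¹ * p.2)
  left_inv p := by simp
  right_inv p := by simp

variable (X) in
/-- The Hilbert basis of `ℓ²(X) ⊗ ℓ²(X)`. -/
abbrev dltBasis₂ : HilbertBasis (X × X) ℂ (HTensor (L2 X) (L2 X)) :=
  tensorBasis (dltBasis X) (dltBasis X)

variable (X) in
/-- The multiplicative unitary. -/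
def mulUnitary : HTensor (L2 X) (L2 X) ≃ₗᵢ[ℂ] HTensor (L2 X) (L2 X) :=
  basisUnitary (dltBasis₂ X) (dltBasis₂ X) (mulShear X)

@[simp] theorem mulUnitary_htmul (x y : X) :
    mulUnitary X (htmul (dlt x) (dlt y)) = htmul (dlt x) (dlt (x * y)) := by
  have := basisUnitary_apply (dltBasis₂ X) (dltBasis₂ X) (mulShear X) (x, y)
  rw [tensorBasis_apply, tensorBasis_apply] at this
  simp only [dltBasis_apply] at this
  exact this

theorem htmul_dlt_ext {Y : Type*} [NormedAddCommGroup Y] [NormedSpace ℂ Y]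
    {S T : HTensor (L2 X) (L2 X) →L[ℂ] Y}
    (h : ∀ x y, S (htmul (dlt x) (dlt y)) = T (htmul (dlt x) (dlt y))) : S = T :=
  hilbertBasis_clm_ext (dltBasis₂ X) fun p => by simpa using h p.1 p.2

/-- The operator `T ↦ V (T ⊗ 1) V*` for a unitary `V`. -/
def ampConj {E F K : Type*} [NormedAddCommGroup E] [InnerProductSpace ℂ E]
    [NormedAddCommGroup F] [InnerProductSpace ℂ F] [NormedAddCommGroup K] [InnerProductSpace ℂ K]
    (V : HTensor E F ≃ₗᵢ[ℂ] K) : (E →L[ℂ] E) →L[ℂ] (K →L[ℂ] K) :=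
  (sandwichL V.toContinuousLinearEquiv.toContinuousLinearMap
    V.symm.toContinuousLinearEquiv.toContinuousLinearMap).comp (ampL F)

theorem ampConj_apply {E F K : Type*} [NormedAddCommGroup E] [InnerProductSpace ℂ E]
    [NormedAddCommGroup F] [InnerProductSpace ℂ F] [NormedAddCommGroup K] [InnerProductSpace ℂ K]
    (V : HTensor E F ≃ₗᵢ[ℂ] K) (T : E →L[ℂ] E) (ξ : E) (η : F) :
    ampConj V T (V (htmul ξ η)) = V (htmul (T ξ) η) := by
  change V (opTensor T 1 (V.symm (V (htmul ξ η)))) = _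
  rw [LinearIsometryEquiv.symm_apply_apply, opTensor_htmul]
  rfl

theorem ampConj_mul {E F K : Type*} [NormedAddCommGroup E] [InnerProductSpace ℂ E]
    [NormedAddCommGroup F] [InnerProductSpace ℂ F] [NormedAddCommGroup K] [InnerProductSpace ℂ K]
    (V : HTensor E F ≃ₗᵢ[ℂ] K) (S T : E →L[ℂ] E) :
    ampConj V (S * T) = ampConj V S * ampConj V T := by
  ext x
  change V (opTensor (S * T) 1 (V.symm x)) =
    V (opTensor S 1 (V.symm (V (opTensor T 1 (V.symm x)))))
  rw [LinearIsometryEquiv.symm_apply_apply, ← mul_one (1 : F →L[ℂ] F), ← opTensor_mul]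
  rfl

theorem ampConj_star {E F K : Type*} [NormedAddCommGroup E] [InnerProductSpace ℂ E]
    [NormedAddCommGroup F] [InnerProductSpace ℂ F] [NormedAddCommGroup K] [InnerProductSpace ℂ K]
    [CompleteSpace E] [CompleteSpace F] [CompleteSpace K]
    (V : HTensor E F ≃ₗᵢ[ℂ] K) (T : E →L[ℂ] E) :
    ampConj V (star T) = star (ampConj V T) := by
  have h : ∀ T, ampConj V T = V.conjStarAlgEquiv (opTensor T 1) := fun T => rfl
  have h' : opTensor (star T) (1 : F →L[ℂ] F) = star (opTensor T 1) := by
    rw [opTensor_star, star_one]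
  rw [h, h, h']
  exact V.conjStarAlgEquiv.map_star' (opTensor T 1)

/-- On δ_y ⊗ δ_z = V(δ_y ⊗ δ_{y⁻¹z}): translating the first coordinate by x before the shear
translates both after it. Hence λ_x ↦ λ_x ⊗ λ_x extends to the reduced algebra as the *-homomorphism
T ↦ V(T ⊗ 1)V*. -/
theorem ampConj_mulUnitary_lreg (x : X) :
    ampConj (mulUnitary X) (lreg x) = opTensor (lreg x) (lreg x) := by
  refine htmul_dlt_ext fun y z => ?_
  have h := ampConj_apply (mulUnitary X) (lreg x) (dlt y) (dlt (y⁻¹ * z))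
  simpa [opTensor_htmul, mul_assoc] using h

variable (X) in
/-- The comultiplication of the reduced group C*-algebra as a family of operators. -/
def comulRB : redAlg X →L[ℂ] BProd (TensorFam (redFam X) (redFam X)) :=
  (constL (PUnit.{u + 1} × PUnit.{u + 1}) (K := HTensor (L2 X) (L2 X))).comp
    ((ampConj (mulUnitary X)).comp (CAlg.compL (A := redAlg X) PUnit.unit))

theorem comulRB_lamR (x : X) : comulRB X (lamR x) = (stmul (lamR x) (lamR x)).val :=
  BProd.ext_comp fun _ => ampConj_mulUnitary_lreg x

/-- The comultiplication of the reduced group C*-algebra as a bounded linear map. -/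
def comulRL : redAlg X →L[ℂ] spatial (redAlg X) (redAlg X) :=
  CAlg.codRestrict _ (comulRB X) (mem_of_redAlg _ fun x => by
    rw [comulRB_lamR]; exact CAlg.Elem.mem _)

theorem comulRL_lamR (x : X) : comulRL (lamR x) = stmul (lamR x) (lamR x) :=
  CAlg.val_injective (comulRB_lamR x)

/-- The comultiplication of the reduced group C*-algebra. -/
def comulR : redAlg X →⋆ₙₐ[ℂ] spatial (redAlg X) (redAlg X) where
  toFun := comulRL
  map_smul' := fun c a => map_smul comulRL c a
  map_zero' := map_zero comulRL
  map_add' := map_add comulRL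
  map_mul' := fun _ _ => CAlg.val_ext fun _ => ampConj_mul _ _ _
  map_star' := fun _ => CAlg.val_ext fun _ => ampConj_star _ _

theorem comulR_lamR (x : X) : comulR (lamR x) = stmul (lamR x) (lamR x) := comulRL_lamR x

theorem lamR_one_comp (i : PUnit.{u + 1}) : (lamR (1 : X)).val.comp i = 1 := lreg_one

end Reduced

end CIdem

end

/-! ### The dual of a discrete amenable group as a compact quantum group. -/

noncomputable section

namespace CIdem

set_option linter.unusedSectionVars false

section DiscreteDual

variable {X : Type u} [Group X]

theorem redAlg_ext₂ {Y : Type*} [NormedAddCommGroup Y] [NormedSpace ℂ Y]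
    {S T : redAlg X →L[ℂ] redAlg X →L[ℂ] Y}
    (h : ∀ x y, S (lamR x) (lamR y) = T (lamR x) (lamR y)) (a b : redAlg X) : S a b = T a b := by
  refine redAlg_ext (S := S.flip b) (T := T.flip b) (fun x => ?_) a
  exact redAlg_ext (S := S (lamR x)) (T := T (lamR x)) (h x) b

theorem spatial_redAlg_induction {p : Submodule ℂ (spatial (redAlg X) (redAlg X))}
    (hp : IsClosed (p : Set (spatial (redAlg X) (redAlg X))))
    (h : ∀ x y, stmul (lamR x) (lamR y) ∈ p) (t : spatial (redAlg X) (redAlg X)) : t ∈ p := by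
  have h1 : ∀ x b, stmul (lamR x) b ∈ p := fun x =>
    redAlg_induction (p := p.comap (stmulL (redAlg X) (redAlg X) (lamR x)).toLinearMap)
      (hp.preimage (stmulL (redAlg X) (redAlg X) (lamR x)).continuous) (h x)
  refine spatial_induction hp (fun a b => ?_) t
  exact redAlg_induction (p := p.comap ((stmulL (redAlg X) (redAlg X)).flip b).toLinearMap)
    (hp.preimage ((stmulL (redAlg X) (redAlg X)).flip b).continuous) (fun x => h1 x b) a

/-- A bilinear map need not extend boundedly to the spatial tensor product. Here boundedness comes
from an explicit operator formula f, and agreement with β on the canonical unitaries is all that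
must be checked. -/
theorem exists_extendsToTensor {κ : Type*} {M : κ → Type*} [∀ j, NormedAddCommGroup (M j)]
    [∀ j, InnerProductSpace ℂ (M j)] [∀ j, CompleteSpace (M j)] {B : CAlg M}
    (f : spatial (redAlg X) (redAlg X) →L[ℂ] BProd M) (β : redAlg X →L[ℂ] redAlg X →L[ℂ] B)
    (h : ∀ x y, f (stmul (lamR x) (lamR y)) = (β (lamR x) (lamR y)).val) :
    ∃ Φ : spatial (redAlg X) (redAlg X) →L[ℂ] B, (∀ t, (Φ t).val = f t) ∧
      ExtendsToTensor (fun a b => β a b) Φ := by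
  refine ⟨CAlg.codRestrict B f fun t => ?_, fun t => rfl, fun a b => ?_⟩
  · refine spatial_redAlg_induction (p := B.toSub.toSubmodule.comap f.toLinearMap)
      (B.isClosed.preimage f.continuous) (fun x y => ?_) t
    change f _ ∈ B.toSub
    rw [h]
    exact CAlg.Elem.mem _
  · refine redAlg_ext₂ (S := (ContinuousLinearMap.compL ℂ (redAlg X) (spatial (redAlg X) (redAlg X))
      B (CAlg.codRestrict B f _)).comp (stmulL (redAlg X) (redAlg X))) (T := β) (fun x y => ?_) a b
    exact CAlg.val_injective (h x y)

/-! ### Coassociativity -/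

variable (X) in
/-- The permutation `((x, y), z) ↦ (x, (y, y z))`. -/
def shearRight : (X × X) × X ≃ X × (X × X) where
  toFun p := (p.1.1, (p.1.2, p.1.2 * p.2))
  invFun p := ((p.1, p.2.1), p.2.1⁻¹ * p.2.2)
  left_inv p := by simp
  right_inv p := by simp

variable (X) in
/-- The permutation `((x, y), z) ↦ ((x, x z), y)`. -/
def shearLeft : (X × X) × X ≃ (X × X) × X where
  toFun p := ((p.1.1, p.1.1 * p.2), p.1.2)
  invFun p := ((p.1.1, p.2), p.1.1⁻¹ * p.1.2)
  left_inv p := by simp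
  right_inv p := by simp

section Families

variable {ι κ ν : Type*} {H : ι → Type*} {M : κ → Type*} {L : ν → Type*}
  [∀ i, NormedAddCommGroup (L i)] [∀ i, InnerProductSpace ℂ (L i)] [∀ i, CompleteSpace (L i)]
  [∀ i, NormedAddCommGroup (H i)] [∀ i, InnerProductSpace ℂ (H i)] [∀ i, CompleteSpace (H i)]
  [∀ j, NormedAddCommGroup (M j)] [∀ j, InnerProductSpace ℂ (M j)] [∀ j, CompleteSpace (M j)]

/-- A bounded linear map to `∏ₖ B(Mₖ)` from its components. -/
def famL {E : Type*} [NormedAddCommGroup E] [NormedSpace ℂ E]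
    (J : ∀ k, E →L[ℂ] (M k →L[ℂ] M k)) (hJ : ∀ k x, ‖J k x‖ ≤ ‖x‖) : E →L[ℂ] BProd M :=
  LinearMap.mkContinuous
    { toFun := fun T => BProd.mk (fun k => J k T) ‖T‖ fun k => hJ k T
      map_add' := fun a b => BProd.ext_comp fun k => map_add (J k) a b
      map_smul' := fun c a => BProd.ext_comp fun k => map_smul (J k) c a } 1 fun T => by
    rw [one_mul]
    exact BProd.norm_le_of_comp (norm_nonneg _) fun k => hJ k T

theorem norm_ampConj_le {E F K : Type*} [NormedAddCommGroup E] [InnerProductSpace ℂ E]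
    [NormedAddCommGroup F] [InnerProductSpace ℂ F] [NormedAddCommGroup K] [InnerProductSpace ℂ K]
    (V : HTensor E F ≃ₗᵢ[ℂ] K) (T : E →L[ℂ] E) : ‖ampConj V T‖ ≤ ‖T‖ := by
  refine (norm_sandwichL_le V.toLinearIsometry.norm_toContinuousLinearMap_le
    V.symm.toLinearIsometry.norm_toContinuousLinearMap_le _).trans ?_
  refine (norm_opTensor_le _ _).trans (mul_le_of_le_one_right (norm_nonneg _) ?_)
  exact ContinuousLinearMap.norm_id_le

variable (b : ∀ i, HilbertBasis X ℂ (H i)) (c : ∀ k, HilbertBasis (X × X) ℂ (M k))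
  (d : ∀ k, HilbertBasis (X × X) ℂ (L k))

/-- The unitary implementing `id ⊗ Δ`. -/
def rightUnitary (q : ν) (k : ι) (p : ι × κ) : HTensor (L q) (H k) ≃ₗᵢ[ℂ] HTensor (H p.1) (M p.2) :=
  basisUnitary (tensorBasis (d q) (b k)) (tensorBasis (b p.1) (c p.2)) (shearRight X)

/-- The unitary implementing `Δ ⊗ id`. -/
def leftUnitary (q : ν) (k : ι) (p : κ × ι) : HTensor (L q) (H k) ≃ₗᵢ[ℂ] HTensor (M p.1) (H p.2) :=
  basisUnitary (tensorBasis (d q) (b k)) (tensorBasis (c p.1) (b p.2)) (shearLeft X)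

theorem rightUnitary_htmul (q : ν) (k : ι) (p : ι × κ) (x y z : X) :
    rightUnitary b c d q k p (htmul (d q (x, y)) (b k z)) =
      htmul (b p.1 x) (c p.2 (y, y * z)) := by
  have := basisUnitary_apply (tensorBasis (d q) (b k))
    (tensorBasis (b p.1) (c p.2)) (shearRight X) ((x, y), z)
  simp only [tensorBasis_apply] at this
  exact this

theorem leftUnitary_htmul (q : ν) (k : ι) (p : κ × ι) (x y z : X) :
    leftUnitary b c d q k p (htmul (d q (x, y)) (b k z)) =
      htmul (c p.1 (x, x * z)) (b p.2 y) := by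
  have := basisUnitary_apply (tensorBasis (d q) (b k))
    (tensorBasis (c p.1) (b p.2)) (shearLeft X) ((x, y), z)
  simp only [tensorBasis_apply] at this
  exact this

/-- The map `id ⊗ Δ` as a family of operators. -/
def rightMap (D : CAlg L) (q : ν) (k : ι) : D →L[ℂ] BProd (TensorFam H M) :=
  famL (M := TensorFam H M)
    (fun p => (ampConj (rightUnitary b c d q k p)).comp (CAlg.compL (A := D) q))
    fun _ t => (norm_ampConj_le _ _).trans (CAlg.norm_comp_le t q)

/-- The map `Δ ⊗ id` as a family of operators. -/
def leftMap (D : CAlg L) (q : ν) (k : ι) : D →L[ℂ] BProd (TensorFam M H) :=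
  famL (M := TensorFam M H)
    (fun p => (ampConj (leftUnitary b c d q k p)).comp (CAlg.compL (A := D) q))
    fun _ t => (norm_ampConj_le _ _).trans (CAlg.norm_comp_le t q)

variable {A : CAlg H} {B : CAlg M} {D : CAlg L} {x y : X} {s : A} {r : B} {t : D}

/-- In the coordinates ((u, v), v⁻¹w), the operator of t ⊗ 1 moves u by x and v by y and keeps v⁻¹w;
after the shear w is moved by y as well. This turns λ_x ⊗ λ_y into λ_x ⊗ (λ_y ⊗ λ_y). -/
theorem rightMap_apply (hs : ∀ i z, s.val.comp i (b i z) = b i (x * z))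
    (ht : ∀ i z, t.val.comp i (d i z) = d i (x * z.1, y * z.2))
    (hr : ∀ i z, r.val.comp i (c i z) = c i (y * z.1, y * z.2)) (q : ν) (k : ι) :
    rightMap b c d D q k t = (stmul s r).val := by
  refine BProd.ext_comp fun p => ?_
  refine hilbertBasis_clm_ext (tensorBasis (b p.1) (c p.2)) fun ⟨u, v, w⟩ => ?_
  have h := ampConj_apply (rightUnitary b c d q k p) (t.val.comp q) (d q (u, v)) (b k (v⁻¹ * w))
  simp only [ht, rightUnitary_htmul, mul_inv_cancel_left, mul_assoc] at h
  rw [tensorBasis_apply]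
  refine h.trans ?_
  change _ = opTensor (s.val.comp p.1) (r.val.comp p.2) (htmul (b p.1 u) (c p.2 (v, w)))
  rw [opTensor_htmul, hs, hr]

theorem leftMap_apply (hs : ∀ i z, s.val.comp i (b i z) = b i (y * z))
    (ht : ∀ i z, t.val.comp i (d i z) = d i (x * z.1, y * z.2))
    (hr : ∀ i z, r.val.comp i (c i z) = c i (x * z.1, x * z.2)) (q : ν) (k : ι) :
    leftMap b c d D q k t = (stmul r s).val := by
  refine BProd.ext_comp fun p => ?_
  refine hilbertBasis_clm_ext (tensorBasis (c p.1) (b p.2)) fun ⟨⟨u, v⟩, w⟩ => ?_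
  have h := ampConj_apply (leftUnitary b c d q k p) (t.val.comp q) (d q (u, w)) (b k (u⁻¹ * v))
  simp only [ht, leftUnitary_htmul, mul_inv_cancel_left, mul_assoc] at h
  rw [tensorBasis_apply]
  refine h.trans ?_
  change _ = opTensor (r.val.comp p.1) (s.val.comp p.2) (htmul (c p.1 (u, v)) (b p.2 w))
  rw [opTensor_htmul, hr, hs]

end Families

theorem lamR_comp_dltBasis (x : X) (i : PUnit.{u + 1}) (z : X) :
    (lamR x).val.comp i (dltBasis X z) = dltBasis X (x * z) := by
  rw [dltBasis_apply, dltBasis_apply]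
  exact lreg_dlt x z

theorem stmul_lamR_comp_dltBasis₂ (x y : X) (i : PUnit.{u + 1} × PUnit.{u + 1}) (z : X × X) :
    (stmul (lamR x) (lamR y)).val.comp i (dltBasis₂ X z) = dltBasis₂ X (x * z.1, y * z.2) := by
  rw [tensorBasis_apply, tensorBasis_apply]
  simp only [dltBasis_apply]
  rw [← lreg_dlt x z.1, ← lreg_dlt y z.2]
  exact opTensor_htmul _ _ _ _

section TensorWithIdentity

variable {κ : Type*} {M : κ → Type*} [∀ j, NormedAddCommGroup (M j)]
  [∀ j, InnerProductSpace ℂ (M j)] [∀ j, CompleteSpace (M j)] {B : CAlg M}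
  (c : ∀ k, HilbertBasis (X × X) ℂ (M k)) (Δ : redAlg X →L[ℂ] B)
  (hΔ : ∀ x i z, (Δ (lamR x)).val.comp i (c i z) = c i (x * z.1, x * z.2))

-- The map Δ enters only through its action on bases, so B may itself be a spatial tensor product.
-- Conjugation by the shear unitaries provides boundedness of id ⊗ Δ.
include hΔ in
theorem exists_id_tensor : ∃ Φ : spatial (redAlg X) (redAlg X) →L[ℂ] spatial (redAlg X) B,
    ExtendsToTensor (fun a b => stmul a (Δ b)) Φ := by
  obtain ⟨Φ, -, hΦ⟩ := exists_extendsToTensor (B := spatial (redAlg X) B)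
    (rightMap (H := redFam X) (L := TensorFam (redFam X) (redFam X)) (fun _ => dltBasis X) c
      (fun _ => dltBasis₂ X) (spatial (redAlg X) (redAlg X)) (PUnit.unit, PUnit.unit) PUnit.unit)
    ((stmulL (redAlg X) B).bilinearComp (ContinuousLinearMap.id ℂ (redAlg X)) Δ) fun x y =>
      rightMap_apply (H := redFam X) (L := TensorFam (redFam X) (redFam X))
        (fun _ => dltBasis X) c (fun _ => dltBasis₂ X) (lamR_comp_dltBasis x)
        (stmul_lamR_comp_dltBasis₂ x y) (hΔ y) _ _
  exact ⟨Φ, hΦ⟩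

include hΔ in
theorem exists_tensor_id : ∃ Ψ : spatial (redAlg X) (redAlg X) →L[ℂ] spatial B (redAlg X),
    ExtendsToTensor (fun a b => stmul (Δ a) b) Ψ := by
  obtain ⟨Ψ, -, hΨ⟩ := exists_extendsToTensor (B := spatial B (redAlg X))
    (leftMap (H := redFam X) (L := TensorFam (redFam X) (redFam X)) (fun _ => dltBasis X) c
      (fun _ => dltBasis₂ X) (spatial (redAlg X) (redAlg X)) (PUnit.unit, PUnit.unit) PUnit.unit)
    ((stmulL B (redAlg X)).bilinearComp Δ (ContinuousLinearMap.id ℂ (redAlg X))) fun x y =>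
      leftMap_apply (H := redFam X) (L := TensorFam (redFam X) (redFam X))
        (fun _ => dltBasis X) c (fun _ => dltBasis₂ X) (lamR_comp_dltBasis y)
        (stmul_lamR_comp_dltBasis₂ x y) (hΔ x) _ _
  exact ⟨Ψ, hΨ⟩

variable {Δ}

/-- A matrix coefficient of (id ⊗ Δ)Δ is packaged as a bounded functional of a, so that
coassociativity can be tested on λ_x, where the coefficient factorizes. -/
theorem exists_functional_id_tensor
    {Φ : spatial (redAlg X) (redAlg X) →L[ℂ] spatial (redAlg X) B}
    (hΦ : ExtendsToTensor (fun a b => stmul a (Δ b)) Φ) (i : PUnit.{u + 1}) (j : κ)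
    (ξ η : redFam X i) (v w : M j) :
    ∃ S : StrongDual ℂ (redAlg X),
      (∀ a, S a = Inner.inner ℂ (htmul η w) ((Φ (comulR a)).val.comp (i, j) (htmul ξ v))) ∧
      ∀ x, S (lamR x) = Inner.inner ℂ η ((lamR x).val.comp i ξ) *
        Inner.inner ℂ w ((Δ (lamR x)).val.comp j v) := by
  refine ⟨(vf (spatial (redAlg X) B) (i, j) (htmul ξ v) (htmul η w)).comp (Φ.comp comulRL),
    fun a => rfl, fun x => ?_⟩
  change vf (spatial (redAlg X) B) (i, j) (htmul ξ v) (htmul η w) (Φ (comulRL (lamR x))) = _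
  rw [comulRL_lamR, hΦ, ← inner_htmul, ← opTensor_htmul]
  rfl

theorem exists_functional_tensor_id
    {Ψ : spatial (redAlg X) (redAlg X) →L[ℂ] spatial B (redAlg X)}
    (hΨ : ExtendsToTensor (fun a b => stmul (Δ a) b) Ψ) (i : PUnit.{u + 1}) (j : κ)
    (ξ η : redFam X i) (v w : M j) :
    ∃ S : StrongDual ℂ (redAlg X),
      (∀ a, S a = Inner.inner ℂ (htmul w η) ((Ψ (comulR a)).val.comp (j, i) (htmul v ξ))) ∧
      ∀ x, S (lamR x) = Inner.inner ℂ w ((Δ (lamR x)).val.comp j v) *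
        Inner.inner ℂ η ((lamR x).val.comp i ξ) := by
  refine ⟨(vf (spatial B (redAlg X)) (j, i) (htmul v ξ) (htmul w η)).comp (Ψ.comp comulRL),
    fun a => rfl, fun x => ?_⟩
  change vf (spatial B (redAlg X)) (j, i) (htmul v ξ) (htmul w η) (Ψ (comulRL (lamR x))) = _
  rw [comulRL_lamR, hΨ, ← inner_htmul, ← opTensor_htmul]
  rfl

end TensorWithIdentity

theorem inner_comulRL_lamR (x : X) (i j : PUnit.{u + 1}) (ξ₁ η₁ : redFam X i)
    (ξ₂ η₂ : redFam X j) :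
    Inner.inner ℂ (htmul η₁ η₂) ((comulRL (lamR x)).val.comp (i, j) (htmul ξ₁ ξ₂)) =
      Inner.inner ℂ η₁ ((lamR x).val.comp i ξ₁) * Inner.inner ℂ η₂ ((lamR x).val.comp j ξ₂) := by
  rw [comulRL_lamR, ← inner_htmul, ← opTensor_htmul]
  rfl

end DiscreteDual

end CIdem

end

noncomputable section

namespace CIdem

set_option linter.unusedSectionVars false

section DiscreteDual

variable {X : Type u} [Group X]

set_option maxHeartbeats 4000000 in
theorem coassoc_redAlg : ∃ (Φ : spatial (redAlg X) (redAlg X) →L[ℂ]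
      spatial (redAlg X) (spatial (redAlg X) (redAlg X)))
    (Ψ : spatial (redAlg X) (redAlg X) →L[ℂ] spatial (spatial (redAlg X) (redAlg X)) (redAlg X)),
    ExtendsToTensor (fun a b => stmul a (comulR b)) Φ ∧
    ExtendsToTensor (fun a b => stmul (comulR a) b) Ψ ∧
    ∀ (a : redAlg X) (i j k : PUnit.{u + 1}) (ξ₁ η₁ : redFam X i) (ξ₂ η₂ : redFam X j)
      (ξ₃ η₃ : redFam X k),
      Inner.inner ℂ (htmul η₁ (htmul η₂ η₃))
        ((Φ (comulR a)).val.comp (i, (j, k)) (htmul ξ₁ (htmul ξ₂ ξ₃))) =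
      Inner.inner ℂ (htmul (htmul η₁ η₂) η₃)
        ((Ψ (comulR a)).val.comp ((i, j), k) (htmul (htmul ξ₁ ξ₂) ξ₃)) := by
  obtain ⟨Φ, hΦ⟩ := exists_id_tensor (M := TensorFam (redFam X) (redFam X)) (fun _ => dltBasis₂ X) (comulRL (X := X)) fun x i z => by
    rw [comulRL_lamR, stmul_lamR_comp_dltBasis₂]
  obtain ⟨Ψ, hΨ⟩ := exists_tensor_id (M := TensorFam (redFam X) (redFam X)) (fun _ => dltBasis₂ X) (comulRL (X := X)) fun x i z => by
    rw [comulRL_lamR, stmul_lamR_comp_dltBasis₂]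
  refine ⟨Φ, Ψ, hΦ, hΨ, fun a i j k ξ₁ η₁ ξ₂ η₂ ξ₃ η₃ => ?_⟩
  obtain ⟨S, hS, hS'⟩ := exists_functional_id_tensor hΦ i (j, k) ξ₁ η₁ (htmul ξ₂ ξ₃) (htmul η₂ η₃)
  obtain ⟨T, hT, hT'⟩ := exists_functional_tensor_id hΨ k (i, j) ξ₃ η₃ (htmul ξ₁ ξ₂) (htmul η₁ η₂)
  refine (hS a).symm.trans (Eq.trans ?_ (hT a))
  refine redAlg_ext (fun x => ?_) a
  rw [hS', hT', inner_comulRL_lamR, inner_comulRL_lamR, mul_assoc]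

/-! ### Slice maps and the Haar state -/

/-- The embedding `ξ ↦ ξ ⊗ v`. -/
def embLeft {E F : Type*} [NormedAddCommGroup E] [InnerProductSpace ℂ E]
    [NormedAddCommGroup F] [InnerProductSpace ℂ F] (v : F) : E →L[ℂ] HTensor E F :=
  (htmulL E F).flip v

theorem sandwich_embLeft {E F : Type*} [NormedAddCommGroup E] [InnerProductSpace ℂ E]
    [NormedAddCommGroup F] [InnerProductSpace ℂ F] [CompleteSpace E] [CompleteSpace F] (v : F)
    (S : E →L[ℂ] E) (T : F →L[ℂ] F) :
    sandwichL (ContinuousLinearMap.adjoint (embLeft v)) (embLeft v) (opTensor S T) =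
      (Inner.inner ℂ v (T v) : ℂ) • S := by
  ext x
  refine ext_inner_left ℂ fun w => ?_
  rw [sandwichL_apply, ContinuousLinearMap.adjoint_inner_right]
  change Inner.inner ℂ (htmul w v) (opTensor S T (htmul x v)) = _
  rw [opTensor_htmul, inner_htmul, smul_apply, inner_smul_right, mul_comm]

theorem sandwich_embRight {E F : Type*} [NormedAddCommGroup E] [InnerProductSpace ℂ E]
    [NormedAddCommGroup F] [InnerProductSpace ℂ F] [CompleteSpace E] [CompleteSpace F] (v : E)
    (S : E →L[ℂ] E) (T : F →L[ℂ] F) :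
    sandwichL (ContinuousLinearMap.adjoint (htmulL E F v)) (htmulL E F v) (opTensor S T) =
      (Inner.inner ℂ v (S v) : ℂ) • T := by
  ext x
  refine ext_inner_left ℂ fun w => ?_
  rw [sandwichL_apply, ContinuousLinearMap.adjoint_inner_right]
  change Inner.inner ℂ (htmul v w) (opTensor S T (htmul v x)) = _
  rw [opTensor_htmul, inner_htmul, smul_apply, inner_smul_right]

theorem norm_embLeft_le {E F : Type*} [NormedAddCommGroup E] [InnerProductSpace ℂ E]
    [NormedAddCommGroup F] [InnerProductSpace ℂ F] {v : F} (hv : ‖v‖ ≤ 1) :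
    ‖(embLeft v : E →L[ℂ] HTensor E F)‖ ≤ 1 :=
  ContinuousLinearMap.opNorm_le_bound _ zero_le_one fun x => by
    change ‖htmul x v‖ ≤ _
    rw [norm_htmul, mul_comm]
    exact mul_le_mul_of_nonneg_right hv (norm_nonneg _)

theorem norm_embRight_le {E F : Type*} [NormedAddCommGroup E] [InnerProductSpace ℂ E]
    [NormedAddCommGroup F] [InnerProductSpace ℂ F] {v : E} (hv : ‖v‖ ≤ 1) :
    ‖htmulL E F v‖ ≤ 1 :=
  ContinuousLinearMap.opNorm_le_bound _ zero_le_one fun x => by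
    rw [htmulL_apply, norm_htmul]
    exact mul_le_mul_of_nonneg_right hv (norm_nonneg _)

variable (X) in
/-- The vector state of a vector of `ℓ²(X)`. -/
abbrev vecState (v : L2 X) : StrongDual ℂ (redAlg X) := vf (redAlg X) PUnit.unit v v

/-- The slice map `a ⊗ b ↦ ⟨v, b v⟩ a`. -/
theorem exists_slice_left {v : L2 X} (hv : ‖v‖ ≤ 1) :
    ∃ E : spatial (redAlg X) (redAlg X) →L[ℂ] redAlg X, (∀ t, ‖E t‖ ≤ ‖t‖) ∧
      ExtendsToTensor (fun a b => vecState X v b • a) E := by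
  obtain ⟨E, hE, hE'⟩ := exists_extendsToTensor (X := X) (B := redAlg X)
    ((constL PUnit.{u + 1} (K := L2 X)).comp
      ((sandwichL (ContinuousLinearMap.adjoint (embLeft v)) (embLeft v)).comp
        (CAlg.compL (A := spatial (redAlg X) (redAlg X)) (PUnit.unit, PUnit.unit))))
    ((ContinuousLinearMap.lsmul ℂ ℂ).bilinearComp (vecState X v)
      (ContinuousLinearMap.id ℂ (redAlg X))).flip
    (fun x y => BProd.ext_comp fun _ => sandwich_embLeft v (lreg x) (lreg y))
  refine ⟨E, fun t => ?_, hE'⟩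
  rw [← CAlg.norm_val, hE]
  refine BProd.norm_le_of_comp (norm_nonneg _) fun _ => ?_
  refine (norm_sandwichL_le ?_ (norm_embLeft_le hv) _).trans (CAlg.norm_comp_le t _)
  rw [LinearIsometryEquiv.norm_map]
  exact norm_embLeft_le hv

/-- The slice map `a ⊗ b ↦ ⟨v, a v⟩ b`. -/
theorem exists_slice_right {v : L2 X} (hv : ‖v‖ ≤ 1) :
    ∃ E : spatial (redAlg X) (redAlg X) →L[ℂ] redAlg X, (∀ t, ‖E t‖ ≤ ‖t‖) ∧
      ExtendsToTensor (fun a b => vecState X v a • b) E := by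
  obtain ⟨E, hE, hE'⟩ := exists_extendsToTensor (X := X) (B := redAlg X)
    ((constL PUnit.{u + 1} (K := L2 X)).comp
      ((sandwichL (ContinuousLinearMap.adjoint (htmulL (L2 X) (L2 X) v))
        (htmulL (L2 X) (L2 X) v)).comp
        (CAlg.compL (A := spatial (redAlg X) (redAlg X)) (PUnit.unit, PUnit.unit))))
    ((ContinuousLinearMap.lsmul ℂ ℂ).bilinearComp (vecState X v)
      (ContinuousLinearMap.id ℂ (redAlg X)))
    (fun x y => BProd.ext_comp fun _ => sandwich_embRight v (lreg x) (lreg y))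
  refine ⟨E, fun t => ?_, hE'⟩
  rw [← CAlg.norm_val, hE]
  refine BProd.norm_le_of_comp (norm_nonneg _) fun _ => ?_
  refine (norm_sandwichL_le ?_ (norm_embRight_le hv) _).trans (CAlg.norm_comp_le t _)
  rw [LinearIsometryEquiv.norm_map]
  exact norm_embRight_le hv

theorem vecState_lamR (v : L2 X) (x : X) : vecState X v (lamR x) = Inner.inner ℂ v (lreg x v) :=
  rfl

theorem vecState_star_mul_self (v : L2 X) (a : redAlg X) :
    vecState X v (star a * a) = ((‖a.val.comp PUnit.unit v‖ ^ 2 : ℝ) : ℂ) := by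
  change Inner.inner ℂ v (star (a.val.comp PUnit.unit) (a.val.comp PUnit.unit v)) = _
  rw [ContinuousLinearMap.star_eq_adjoint, ContinuousLinearMap.adjoint_inner_right,
    inner_self_eq_norm_sq_to_K]
  norm_cast

/-- Invariance of the Haar state on generators: its value at λ_x is 0 unless x = 1. -/
theorem vecState_one_smul_lamR (x : X) :
    vecState X (dlt 1) (lamR x) • lamR x = vecState X (dlt 1) (lamR x) • lamR (1 : X) := by
  classical
  rw [vecState_lamR, lreg_dlt, mul_one, inner_dlt_dlt]
  split_ifs with h
  · rw [h]
  · rw [zero_smul, zero_smul]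

/-- The vector δ_1 is separating because right translations commute with the left regular
representation and carry δ_1 to every basis vector. This is faithfulness of the Haar state. -/
theorem eq_zero_of_comp_dlt_one {a : redAlg X} (h : a.val.comp PUnit.unit (dlt 1) = 0) :
    a = 0 := by
  have key : ∀ x : X, a.val.comp PUnit.unit (dlt x) =
      permL2 (Equiv.mulRight x) (a.val.comp PUnit.unit (dlt 1)) := by
    intro x
    refine redAlg_ext (S := (ContinuousLinearMap.apply ℂ (L2 X) (dlt x)).comp
        (CAlg.compL (A := redAlg X) PUnit.unit))
      (T := ((permL2 (Equiv.mulRight x)).toContinuousLinearMap.comp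
        (ContinuousLinearMap.apply ℂ (L2 X) (dlt 1))).comp
        (CAlg.compL (A := redAlg X) PUnit.unit)) (fun y => ?_) a
    change lreg y (dlt x) = permL2 (Equiv.mulRight x) (lreg y (dlt 1))
    rw [lreg_dlt, lreg_dlt, permL2_dlt]
    simp
  refine CAlg.val_ext fun _ => dlt_ext fun x => ?_
  refine (key x).trans ?_
  rw [h, map_zero]
  rfl

/-- λ_x ⊗ λ_y = Δ(λ_y)(λ_{y⁻¹x} ⊗ 1). -/
theorem cancel_left_redAlg : (Submodule.span ℂ {t : spatial (redAlg X) (redAlg X) |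
    ∃ a b, t = comulR a * stmul b (lamR 1)}).topologicalClosure = ⊤ := by
  refine eq_top_iff.2 fun t _ => spatial_redAlg_induction
    (Submodule.isClosed_topologicalClosure _) (fun x y => ?_) t
  refine Submodule.le_topologicalClosure _ (Submodule.subset_span ⟨lamR y, lamR (y⁻¹ * x), ?_⟩)
  rw [comulR_lamR, stmul_mul, lamR_mul, lamR_mul, mul_inv_cancel_left, mul_one]

theorem cancel_right_redAlg : (Submodule.span ℂ {t : spatial (redAlg X) (redAlg X) |
    ∃ a b, t = comulR a * stmul (lamR 1) b}).topologicalClosure = ⊤ := by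
  refine eq_top_iff.2 fun t _ => spatial_redAlg_induction
    (Submodule.isClosed_topologicalClosure _) (fun x y => ?_) t
  refine Submodule.le_topologicalClosure _ (Submodule.subset_span ⟨lamR x, lamR (x⁻¹ * y), ?_⟩)
  rw [comulR_lamR, stmul_mul, lamR_mul, lamR_mul, mul_inv_cancel_left, mul_one]

/-! ### The counit -/

variable (X) in
/-- The left regular representation has almost invariant unit vectors. -/
def HasAlmostInvariantVectors : Prop :=
  ∀ (F : Finset X) (ε : ℝ), 0 < ε → ∃ v : L2 X, ‖v‖ = 1 ∧ ∀ x ∈ F, ‖lreg x v - v‖ ≤ ε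

/-- Pairs (F, n) index vectors that are invariant on F up to 1/(n+1). -/
theorem HasAlmostInvariantVectors.exists_net (h : HasAlmostInvariantVectors X) :
    ∃ v : Finset X × ℕ → L2 X, (∀ i, ‖v i‖ ≤ 1) ∧
      ∀ x, Filter.Tendsto (fun i => vecState X (v i) (lamR x)) Filter.atTop (nhds 1) := by
  choose v hv1 hv using fun i : Finset X × ℕ => h i.1 (1 / (i.2 + 1)) (by positivity)
  refine ⟨v, fun i => (hv1 i).le, fun x => ?_⟩
  rw [tendsto_iff_norm_sub_tendsto_zero]
  have h1 : Filter.Tendsto (fun i : Finset X × ℕ => 1 / ((i.2 : ℝ) + 1)) Filter.atTop (nhds 0) :=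
    tendsto_one_div_add_atTop_nhds_zero_nat.comp
      (by rw [← Filter.prod_atTop_atTop_eq]; exact Filter.tendsto_snd)
  refine squeeze_zero' (Filter.Eventually.of_forall fun _ => norm_nonneg _) ?_ h1
  filter_upwards [Filter.eventually_ge_atTop (({x}, 0) : Finset X × ℕ)] with i hi
  have hx : x ∈ i.1 := hi.1 (Finset.mem_singleton_self x)
  have e : vecState X (v i) (lamR x) - 1 = Inner.inner ℂ (v i) (lreg x (v i) - v i) := by
    rw [inner_sub_right, inner_self_eq_norm_sq_to_K, hv1, vecState_lamR]
    simp
  rw [e]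
  refine (norm_inner_le_norm _ _).trans ?_
  rw [hv1, one_mul]
  exact hv i x hx

/-- The trivial character λ_x ↦ 1 is a pointwise limit of vector states v_i. The slice maps of the
v_i are contractions that converge on elementary tensors, hence everywhere, and their limits are the
bounded maps ε ⊗ id and id ⊗ ε. -/
theorem exists_counit (h : HasAlmostInvariantVectors X) :
    ∃ (ε : StrongDual ℂ (redAlg X)) (E F : spatial (redAlg X) (redAlg X) →L[ℂ] redAlg X),
      ExtendsToTensor (fun a b => ε a • b) E ∧ ExtendsToTensor (fun a b => ε b • a) F ∧
      ∀ a, E (comulR a) = a ∧ F (comulR a) = a := by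
  classical
  obtain ⟨v, hv1, hv⟩ := h.exists_net
  have hst : ∀ i (a : redAlg X), ‖vecState X (v i) a‖ ≤ ‖a‖ := fun i a => by
    refine (norm_vf_apply_le _ _ _ a).trans ?_
    exact mul_le_of_le_one_left (norm_nonneg _)
      (mul_le_one₀ (hv1 i) (norm_nonneg _) (hv1 i))
  obtain ⟨ε, hε⟩ := exists_clm_tendsto (l := Filter.atTop) (T := fun i => vecState X (v i)) hst
    (redAlg_induction (isClosed_convergenceSet hst) fun x => ⟨1, hv x⟩)
  have hε1 : ∀ x, ε (lamR x) = 1 := fun x => tendsto_nhds_unique (hε _) (hv x)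
  choose R hR hR' using fun i => exists_slice_right (hv1 i)
  choose L hL hL' using fun i => exists_slice_left (hv1 i)
  have hRt : ∀ a b, Filter.Tendsto (fun i => R i (stmul a b)) Filter.atTop (nhds (ε a • b)) := by
    intro a b
    simp only [hR' _ a b]
    exact (hε a).smul_const b
  have hLt : ∀ a b, Filter.Tendsto (fun i => L i (stmul a b)) Filter.atTop (nhds (ε b • a)) := by
    intro a b
    simp only [hL' _ a b]
    exact (hε b).smul_const a
  obtain ⟨E, hE⟩ := exists_clm_tendsto (l := Filter.atTop) hR
    (spatial_induction (isClosed_convergenceSet hR) fun a b => ⟨_, hRt a b⟩)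
  obtain ⟨F, hF⟩ := exists_clm_tendsto (l := Filter.atTop) hL
    (spatial_induction (isClosed_convergenceSet hL) fun a b => ⟨_, hLt a b⟩)
  have hE' : ExtendsToTensor (fun a b => ε a • b) E := fun a b =>
    tendsto_nhds_unique (hE _) (hRt a b)
  have hF' : ExtendsToTensor (fun a b => ε b • a) F := fun a b =>
    tendsto_nhds_unique (hF _) (hLt a b)
  refine ⟨ε, E, F, hE', hF', fun a => ⟨?_, ?_⟩⟩
  · refine redAlg_ext (S := E.comp comulRL) (T := ContinuousLinearMap.id ℂ (redAlg X))
      (fun x => ?_) a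
    rw [ContinuousLinearMap.comp_apply, comulRL_lamR, hE']
    change ε (lamR x) • lamR x = lamR x
    rw [hε1, one_smul]
  · refine redAlg_ext (S := F.comp comulRL) (T := ContinuousLinearMap.id ℂ (redAlg X))
      (fun x => ?_) a
    rw [ContinuousLinearMap.comp_apply, comulRL_lamR, hF']
    change ε (lamR x) • lamR x = lamR x
    rw [hε1, one_smul]

theorem haar_left_redAlg : ∃ E : spatial (redAlg X) (redAlg X) →L[ℂ] redAlg X,
    ExtendsToTensor (fun a b => vecState X (dlt 1) b • a) E ∧
      ∀ a, E (comulR a) = vecState X (dlt 1) a • lamR 1 := by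
  obtain ⟨E, -, hE⟩ := exists_slice_left (norm_dlt (1 : X)).le
  refine ⟨E, hE, fun a => ?_⟩
  refine redAlg_ext (S := E.comp comulRL)
    (T := (vecState X (dlt 1)).smulRight (lamR (1 : X))) (fun x => ?_) a
  rw [ContinuousLinearMap.comp_apply, comulRL_lamR, hE]
  exact vecState_one_smul_lamR x

theorem haar_right_redAlg : ∃ E : spatial (redAlg X) (redAlg X) →L[ℂ] redAlg X,
    ExtendsToTensor (fun a b => vecState X (dlt 1) a • b) E ∧
      ∀ a, E (comulR a) = vecState X (dlt 1) a • lamR 1 := by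
  obtain ⟨E, -, hE⟩ := exists_slice_right (norm_dlt (1 : X)).le
  refine ⟨E, hE, fun a => ?_⟩
  refine redAlg_ext (S := E.comp comulRL)
    (T := (vecState X (dlt 1)).smulRight (lamR (1 : X))) (fun x => ?_) a
  rw [ContinuousLinearMap.comp_apply, comulRL_lamR, hE]
  exact vecState_one_smul_lamR x

variable (X) in
/-- The dual compact quantum group of an amenable discrete group. -/
def discreteDual (h : HasAlmostInvariantVectors X) : CompactQuantumGroup.{u} where
  idx := PUnit
  space := redFam X
  alg := redAlg X
  one := lamR 1
  one_apply := lamR_one_comp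
  comul := comulR
  comul_one := comulR_lamR 1
  coassoc := coassoc_redAlg
  cancel_left := cancel_left_redAlg
  cancel_right := cancel_right_redAlg
  haar := vecState X (dlt 1)
  haar_one := by
    classical
    rw [vecState_lamR, lreg_one, one_apply_eq_self, inner_dlt_dlt, if_pos rfl]
  haar_pos a := by
    rw [vecState_star_mul_self]
    exact ⟨by rw [Complex.ofReal_re]; positivity, Complex.ofReal_im _⟩
  haar_faithful a ha := by
    rw [vecState_star_mul_self] at ha
    refine eq_zero_of_comp_dlt_one ?_
    simpa using ha
  haar_left := haar_left_redAlg
  haar_right := haar_right_redAlg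
  counit := exists_counit h

end DiscreteDual

end CIdem

end

/-! ### Closed range of *-homomorphisms. -/

noncomputable section

namespace CIdem

set_option linter.unusedSectionVars false

section ClosedRange

variable {A B : Type*} [NonUnitalCStarAlgebra A] [NonUnitalCStarAlgebra B]

/-- Functional calculus with the truncation of t to [-‖θ a‖, ‖θ a‖] shortens a without changing its
image, since the truncation is the identity on the spectrum of θ a. -/
theorem exists_lift_norm_le_of_isSelfAdjoint (θ : A →⋆ₙₐ[ℂ] B) {a : A} (ha : IsSelfAdjoint a) :
    ∃ a', θ a' = θ a ∧ ‖a'‖ ≤ ‖θ a‖ := by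
  have hb : IsSelfAdjoint (θ a) := ha.map θ
  have hr : 0 ≤ ‖θ a‖ := norm_nonneg _
  have hf0 : max (-‖θ a‖) (min ‖θ a‖ (0 : ℝ)) = 0 := by
    rw [min_eq_right hr, max_eq_right (by linarith)]
  have hc : Continuous fun t : ℝ => max (-‖θ a‖) (min ‖θ a‖ t) := by fun_prop
  have hθ : Continuous θ := AddMonoidHomClass.continuous_of_bound θ 1 fun x => by
    rw [one_mul]; exact NonUnitalStarAlgHom.norm_apply_le θ x
  refine ⟨cfcₙ (fun t : ℝ => max (-‖θ a‖) (min ‖θ a‖ t)) a, ?_, norm_cfcₙ_le fun x _ => ?_⟩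
  · refine (NonUnitalStarAlgHom.map_cfcₙ (θ.restrictScalars ℝ) _ a hc.continuousOn hf0 hθ ha
      hb).trans ?_
    change cfcₙ _ (θ a) = θ a
    conv_rhs => rw [← cfcₙ_id ℝ (θ a) hb]
    refine cfcₙ_congr fun x hx => ?_
    have h := norm_apply_le_norm_cfcₙ id (θ a) hx
    rw [cfcₙ_id ℝ (θ a) hb, id, Real.norm_eq_abs, abs_le] at h
    change max _ (min _ x) = id x
    rw [min_eq_right h.2, max_eq_right h.1, id]
  · rw [Real.norm_eq_abs, abs_le]
    exact ⟨le_max_left _ _, max_le (by linarith) (min_le_left _ _)⟩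

/-- Real and imaginary parts are lifted separately; the two bounds add up to the constant 2. -/
theorem exists_lift_norm_le (θ : A →⋆ₙₐ[ℂ] B) (a : A) :
    ∃ a', θ a' = θ a ∧ ‖a'‖ ≤ 2 * ‖θ a‖ := by
  obtain ⟨x, hx, hx'⟩ := exists_lift_norm_le_of_isSelfAdjoint θ (realPart a).2
  obtain ⟨y, hy, hy'⟩ := exists_lift_norm_le_of_isSelfAdjoint θ (imaginaryPart a).2
  refine ⟨x + Complex.I • y, ?_, ?_⟩
  · rw [map_add, map_smul, hx, hy, ← map_smul, ← map_add, realPart_add_I_smul_imaginaryPart]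
  · have h1 : ‖θ (realPart a)‖ ≤ ‖θ a‖ := by
      have e : θ (realPart a) = realPart (θ a) := by
        rw [realPart_apply_coe, realPart_apply_coe, ← map_star, ← map_add]
        exact map_smul (θ.restrictScalars ℝ) (2⁻¹ : ℝ) (a + star a)
      rw [e]
      exact realPart.norm_le (θ a)
    have h2 : ‖θ (imaginaryPart a)‖ ≤ ‖θ a‖ := by
      have e : θ (imaginaryPart a) = imaginaryPart (θ a) := by
        rw [imaginaryPart_apply_coe, imaginaryPart_apply_coe, ← map_star, ← map_sub, map_smul]
        congr 1
        exact map_smul (θ.restrictScalars ℝ) (2⁻¹ : ℝ) (a - star a)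
      rw [e]
      exact imaginaryPart.norm_le (θ a)
    calc ‖x + Complex.I • y‖ ≤ ‖x‖ + ‖Complex.I • y‖ := norm_add_le _ _
      _ = ‖x‖ + ‖y‖ := by rw [norm_smul, Complex.norm_I, one_mul]
      _ ≤ 2 * ‖θ a‖ := by linarith

/-- The range of a *-homomorphism between C*-algebras is closed. -/
theorem isClosed_range_starHom (θ : A →⋆ₙₐ[ℂ] B) : IsClosed (Set.range θ) := by
  have hθ : ∀ a, ‖θ a‖ ≤ 1 * ‖a‖ := fun a => by
    rw [one_mul]; exact NonUnitalStarAlgHom.norm_apply_le θ a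
  let f : NormedAddGroupHom A B := AddMonoidHom.mkNormedAddGroupHom (θ : A →+ B) 1 hθ
  have hf : f.SurjectiveOnWith f.range 2 := by
    rintro _ ⟨a, rfl⟩
    exact exists_lift_norm_le θ a
  -- Lifts with uniform norm control persist on the closure of the range, by summing a series in the
  -- complete domain.
  have h := controlled_closure_of_complete two_pos one_pos hf
  rw [← closure_subset_iff_isClosed]
  intro b hb
  obtain ⟨a, ha, -⟩ := h b hb
  exact ⟨a, ha⟩

end ClosedRange

/-! ### The quotient map onto the reduced C*-algebra of G/N. -/

section QuotientHom

variable {G : Type u} [Group G] [TopologicalSpace G] [IsTopologicalGroup G]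
  [LocallyCompactSpace G] [MeasurableSpace G] [BorelSpace G]
  (N : Subgroup G) [N.Normal] (hN : IsOpen (N : Set G))

theorem quasiReg_op_eq_lreg (g : G) : (quasiReg N hN).op g = lreg (g : G ⧸ N) := by
  refine dlt_ext fun x => ?_
  refine (quasiReg_op_qv N hN g x).trans (Eq.trans ?_ (lreg_dlt (g : G ⧸ N) x).symm)
  induction x using QuotientGroup.induction_on with
  | H s => rfl

include hN in
theorem continuous_lreg_coe : Continuous fun g : G => lreg (g : G ⧸ N) := by
  have : DiscreteTopology (G ⧸ N) := QuotientGroup.discreteTopology hN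
  exact (continuous_of_discreteTopology (f := fun x : G ⧸ N => lreg x)).comp continuous_quotient_mk'

theorem integrated_quasiReg (f : C_c(G, ℂ)) :
    (quasiReg N hN).integrated f =
      ∫ g, f g • lreg (g : G ⧸ N) ∂(Measure.haar : Measure G) := by
  ext1 ξ
  refine Eq.trans ?_ (((ContinuousLinearMap.apply ℂ (L2 (G ⧸ N))) ξ).integral_comp_comm
    (integrable_smul f (continuous_lreg_coe N hN)))
  refine (UnitaryRep.integrated_apply _ f ξ).trans ?_
  simp only [quasiReg_op_eq_lreg]
  rfl

/-- For normal N the whole of N acts trivially on ℓ²(G/N), so a bump supported in N becomes the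
identity. Consequently u_g e maps to the canonical unitary of gN. -/
theorem integrated_bump_quasiReg : (quasiReg N hN).integrated (bump (N : Set G)) = 1 := by
  ext1 ξ
  refine integrated_bump_fixed _ (subgroup_mem_nhds N hN) fun g hg => ?_
  rw [quasiReg_op_eq_lreg, (QuotientGroup.eq_one_iff g).2 hg, lreg_one]
  rfl

/-- As G/N is discrete, g ↦ λ_{gN} is norm continuous, so the image of f is a norm integral of
canonical unitaries. -/
theorem quotient_mem (a : groupCStar G) :
    constL PUnit.{u + 1} (a.val.comp (quasiReg N hN)) ∈ (redAlg (G ⧸ N)).toSub := by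
  refine groupCStar_induction (p := fun a => constL PUnit.{u + 1} (a.val.comp (quasiReg N hN)) ∈
    (redAlg (G ⧸ N)).toSub) ?_ (fun f => ?_) a
  · exact (redAlg (G ⧸ N)).isClosed.preimage ((constL (K := L2 (G ⧸ N)) PUnit.{u + 1}).continuous.comp
      (CAlg.compL (A := groupCStar G) (quasiReg N hN)).continuous)
  · have h := (constL (K := L2 (G ⧸ N)) PUnit.{u + 1}).integral_comp_comm
      (integrable_smul f (continuous_lreg_coe N hN))
    rw [← integrated_quasiReg] at h
    refine (congrArg (· ∈ (redAlg (G ⧸ N)).toSub) h).mp ?_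
    refine integral_mem_submodule (S := (redAlg (G ⧸ N)).toSub.toSubmodule)
      (redAlg (G ⧸ N)).isClosed ((constL (K := L2 (G ⧸ N)) PUnit.{u + 1}).integrable_comp
        (integrable_smul f (continuous_lreg_coe N hN))) fun g => ?_
    rw [map_smul]
    exact SMulMemClass.smul_mem _ (CAlg.Elem.mem (lamR (g : G ⧸ N)))

/-- The quotient map `C*(G) → C*_r(G/N)` for an open normal subgroup `N`. -/
def quotientHom : groupCStar G →⋆ₙₐ[ℂ] redAlg (G ⧸ N) where
  toFun a := CAlg.mkElem (constL PUnit.{u + 1} (a.val.comp (quasiReg N hN))) (quotient_mem N hN a)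
  map_smul' _ _ := rfl
  map_zero' := rfl
  map_add' _ _ := rfl
  map_mul' _ _ := rfl
  map_star' _ := rfl

theorem quotientHom_umul_bump (g : G) :
    quotientHom N hN (umul g (lamC (bump (N : Set G)))) = lamR (g : G ⧸ N) :=
  CAlg.val_ext fun _ => by
    change (quasiReg N hN).op g * (quasiReg N hN).integrated (bump (N : Set G)) =
      lreg (g : G ⧸ N)
    rw [integrated_bump_quasiReg, mul_one, quasiReg_op_eq_lreg]

/-- The range is closed and contains all the canonical unitaries. -/
theorem quotientHom_surjective : Function.Surjective (quotientHom N hN) := by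
  intro b
  refine redAlg_induction (p := LinearMap.range
    ((quotientHom N hN : groupCStar G →ₙₐ[ℂ] redAlg (G ⧸ N)) :
      groupCStar G →ₗ[ℂ] redAlg (G ⧸ N))) ?_ (fun x => ?_) b
  · exact isClosed_range_starHom (quotientHom N hN)
  · induction x using QuotientGroup.induction_on with
    | H g => exact ⟨_, quotientHom_umul_bump N hN g⟩

end QuotientHom

end CIdem

end

/-! ### The quotient map intertwines the comultiplications. -/

noncomputable section

namespace CIdem

set_option linter.unusedSectionVars false

section Intertwining

variable {G : Type u} [Group G] [TopologicalSpace G] [IsTopologicalGroup G]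
  [LocallyCompactSpace G] [MeasurableSpace G] [BorelSpace G]
  (N : Subgroup G) [N.Normal] (hN : IsOpen (N : Set G))

/-- The tensor square of the quotient map `C*(G) → C*_r(G/N)`. -/
def quotientTensor : spatial (groupCStar G) (groupCStar G) →L[ℂ]
    spatial (redAlg (G ⧸ N)) (redAlg (G ⧸ N)) :=
  CAlg.codRestrict _ ((constL (PUnit.{u + 1} × PUnit.{u + 1})
    (K := HTensor (L2 (G ⧸ N)) (L2 (G ⧸ N)))).comp
    (CAlg.compL (A := spatial (groupCStar G) (groupCStar G)) (quasiReg N hN, quasiReg N hN)))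
    (mem_of_spatial _ fun a b =>
      CAlg.Elem.mem (stmul (quotientHom N hN a) (quotientHom N hN b)))

theorem quotientTensor_stmul (a b : groupCStar G) :
    quotientTensor N hN (stmul a b) = stmul (quotientHom N hN a) (quotientHom N hN b) := rfl

theorem norm_quotientTensor_le (t : spatial (groupCStar G) (groupCStar G)) :
    ‖quotientTensor N hN t‖ ≤ ‖t‖ := by
  rw [← CAlg.norm_val]
  exact BProd.norm_le_of_comp (norm_nonneg _) fun p => CAlg.norm_comp_le t _

theorem bump₂_comp_quasiReg :
    (bump₂ (N : Set G)).val.comp (quasiReg N hN, quasiReg N hN) = 1 := by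
  change opTensor ((quasiReg N hN).integrated (bump (N : Set G)))
    ((quasiReg N hN).integrated (bump (N : Set G))) = 1
  rw [integrated_bump_quasiReg]
  refine opTensor_ext fun x y => ?_
  rw [opTensor_htmul]
  rfl

/-- The strict extension of the tensor square of the quotient map. -/
def quotientMult : multiplier (spatial (groupCStar G) (groupCStar G)) →ₗ[ℂ]
    spatial (redAlg (G ⧸ N)) (redAlg (G ⧸ N)) where
  toFun T := quotientTensor N hN (multMul T (bump₂ (N : Set G)))
  map_add' S T := by
    rw [← map_add]
    exact congrArg _ (CAlg.val_injective (add_mul (S : BGG G) T _))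
  map_smul' c T := by
    rw [RingHom.id_apply, ← map_smul]
    exact congrArg _ (CAlg.val_injective (smul_mul_assoc c (T : BGG G) _))

theorem quotientMult_comp (T : multiplier (spatial (groupCStar G) (groupCStar G)))
    (p : PUnit.{u + 1} × PUnit.{u + 1}) :
    (quotientMult N hN T).val.comp p =
      (T : BGG G).comp (quasiReg N hN, quasiReg N hN) := by
  change (T : BGG G).comp (quasiReg N hN, quasiReg N hN) *
    (bump₂ (N : Set G)).val.comp (quasiReg N hN, quasiReg N hN) = _
  rw [bump₂_comp_quasiReg, mul_one]

/-- The element e ⊗ e, with e supported in N, maps to 1. So T ↦ (θ ⊗ θ)(T(e ⊗ e)) extends θ ⊗ θ and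
is bounded by the single strict seminorm of e ⊗ e. -/
theorem isStrictExtension_quotientMult :
    IsStrictExtension (quotientTensor N hN) (quotientMult N hN) := by
  refine ⟨fun b => CAlg.val_ext fun p => quotientMult_comp N hN _ p,
    {bump₂ (N : Set G)}, 1, fun T => ?_⟩
  rw [Finset.sum_singleton, one_mul]
  refine (norm_quotientTensor_le N hN _).trans ?_
  exact le_add_of_nonneg_right (norm_nonneg _)

/-- Fell absorption: V conjugates λ ⊗ 1 into λ ⊗ λ, and integration against f preserves this. -/
theorem integrated_tensor_quasiReg (f : C_c(G, ℂ)) :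
    ((quasiReg N hN).tensor (quasiReg N hN)).integrated f =
      ampConj (mulUnitary (G ⧸ N)) ((quasiReg N hN).integrated f) := by
  have h := (ampConj (mulUnitary (G ⧸ N))).integral_comp_comm
    (integrable_smul f (continuous_lreg_coe N hN))
  rw [← integrated_quasiReg N hN] at h
  refine Eq.trans ?_ h
  ext1 ξ
  refine Eq.trans ?_
    (((ContinuousLinearMap.apply ℂ (HTensor (L2 (G ⧸ N)) (L2 (G ⧸ N)))) ξ).integral_comp_comm
    ((ampConj (mulUnitary (G ⧸ N))).integrable_comp
      (integrable_smul f (continuous_lreg_coe N hN))))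
  refine (UnitaryRep.integrated_apply _ f ξ).trans ?_
  refine integral_congr_ae (Filter.Eventually.of_forall fun g => ?_)
  simp only [map_smul, ampConj_mulUnitary_lreg]
  refine (congrArg (f g • ·) (tensor_op_apply (quasiReg N hN) (quasiReg N hN) g ξ)).trans ?_
  rw [quasiReg_op_eq_lreg]
  rfl

theorem comp_tensor_quasiReg (a : groupCStar G) :
    a.val.comp ((quasiReg N hN).tensor (quasiReg N hN)) =
      ampConj (mulUnitary (G ⧸ N)) (a.val.comp (quasiReg N hN)) := by
  refine congrFun (groupCStar_ext
    (CAlg.compL (A := groupCStar G) ((quasiReg N hN).tensor (quasiReg N hN))).continuous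
    ((ampConj (mulUnitary (G ⧸ N))).continuous.comp
      (CAlg.compL (A := groupCStar G) (quasiReg N hN)).continuous) fun f => ?_) a
  exact integrated_tensor_quasiReg N hN f

theorem intertwines_quotientHom (h : HasAlmostInvariantVectors (G ⧸ N)) :
    Intertwines (discreteDual (G ⧸ N) h) (quotientHom N hN) :=
  ⟨quotientTensor N hN, quotientTensor_stmul N hN, quotientMult N hN,
    isStrictExtension_quotientMult N hN, fun a => ⟨comul_mem_multiplier a,
      CAlg.val_ext fun p => (quotientMult_comp N hN _ p).trans (comp_tensor_quasiReg N hN a)⟩⟩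

end Intertwining

section HaarIdempotents

variable {G : Type u} [Group G] [TopologicalSpace G] [IsTopologicalGroup G]
  [LocallyCompactSpace G] [MeasurableSpace G] [BorelSpace G]
  (N : Subgroup G) (hN : IsOpen (N : Set G))

theorem isIdempotentState_cosetFun_one : IsIdempotentState (cosetFun N hN 1) := by
  refine ⟨fun a => ?_, le_antisymm (norm_cosetFun_le N hN 1) (one_le_norm_cosetFun N hN 1),
    isIdempotentFunctional_cosetFun N hN 1⟩
  have h : cosetFun N hN 1 (star a * a) =
      ((‖a.val.comp (quasiReg N hN) (qv N hN ((1 : G) : G ⧸ N))‖ ^ 2 : ℝ) : ℂ) :=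
    inner_star_mul_self a (quasiReg N hN) (qv N hN ((1 : G) : G ⧸ N))
  rw [h]
  exact ⟨by rw [Complex.ofReal_re]; positivity, Complex.ofReal_im _⟩

/-- The Haar state composed with the quotient map and the functional of N are by definition the same
vector state, that of the trivial coset in ℓ²(G/N). -/
theorem isHaarIdempotent_cosetFun_one [N.Normal] (h : HasAlmostInvariantVectors (G ⧸ N)) :
    IsHaarIdempotent (cosetFun N hN 1) :=
  ⟨isIdempotentState_cosetFun_one N hN, discreteDual (G ⧸ N) h, quotientHom N hN,
    quotientHom_surjective N hN, intertwines_quotientHom N hN h, fun _ => rfl⟩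

end HaarIdempotents

end CIdem

end

/-! ### From an invariant mean to almost invariant vectors. -/

noncomputable section

namespace CIdem

set_option linter.unusedSectionVars false

section Amenability

theorem IsAmenable.quotient {G : Type u} [Group G] [TopologicalSpace G] [IsTopologicalGroup G]
    (h : IsAmenable G) (N : Subgroup G) [N.Normal] : IsAmenable (G ⧸ N) := by
  obtain ⟨m, hm0, hm1, hm⟩ := h
  let q : C(G, G ⧸ N) := ⟨fun g => (g : G ⧸ N), continuous_quotient_mk'⟩
  refine ⟨{ toFun := fun f => m (f.compContinuous q)
            map_add' := fun f k => map_add m (f.compContinuous q) (k.compContinuous q)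
            map_smul' := fun c f => map_smul m c (f.compContinuous q) },
    fun f hf => hm0 _ fun g => hf g, hm1, fun s f => ?_⟩
  induction s using QuotientGroup.induction_on with
  | H s => exact hm s (f.compContinuous q)

variable {X : Type u}

/-- The Banach space `ℓ¹(X)` of real functions. -/
abbrev L1 (X : Type*) : Type _ := lp (fun _ : X => ℝ) 1

theorem norm_L1 (p : L1 X) : ‖p‖ = ∑' x, |p x| := by
  rw [lp.norm_eq_tsum_rpow (by norm_num)]
  simp

theorem summable_L1 (p : L1 X) : Summable fun x => |p x| := by
  simpa using (lp.memℓp p).summable (by norm_num)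

theorem norm_sq_L2 (f : L2 X) : ‖f‖ ^ 2 = ∑' x, ‖f x‖ ^ 2 := by
  have h := lp.norm_rpow_eq_tsum (p := 2) (by norm_num) f
  simpa using h

/-- The permutation of the coordinates of a summable function. -/
def permL1 (e : Equiv.Perm X) : L1 X →ₗ[ℝ] L1 X where
  toFun f := ⟨fun x => f (e.symm x), by
    refine (memℓp_gen_iff (by norm_num)).2 ?_
    exact ((lp.memℓp f).summable (by norm_num)).comp_injective e.symm.injective⟩
  map_add' f k := by ext x; rfl
  map_smul' c f := by ext x; rfl

theorem permL1_apply (e : Equiv.Perm X) (f : L1 X) (x : X) : permL1 e f x = f (e.symm x) := rfl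

open Classical in
/-- The point mass at `x`. -/
def ptMass (x : X) : L1 X := lp.single 1 x (1 : ℝ)

theorem ptMass_apply (x y : X) [Decidable (y = x)] : ptMass x y = if y = x then 1 else 0 := by
  classical
  rw [ptMass, lp.single_apply, Pi.single_apply]
  congr

theorem norm_ptMass (x : X) : ‖ptMass x‖ = 1 := by
  classical
  rw [ptMass, lp.norm_single (by norm_num), norm_one]

theorem permL1_ptMass (e : Equiv.Perm X) (x : X) : permL1 e (ptMass x) = ptMass (e x) := by
  classical
  ext y
  rw [permL1_apply, ptMass_apply, ptMass_apply]
  simp only [Equiv.symm_apply_eq]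

variable (X) in
/-- The probability densities in `ℓ¹(X)`. -/
def densities : Set (L1 X) := {p | (∀ x, 0 ≤ p x) ∧ HasSum (fun x => p x) 1}

theorem convex_densities : Convex ℝ (densities X) := by
  intro p hp q hq a b ha hb hab
  refine ⟨fun x => ?_, ?_⟩
  · exact add_nonneg (mul_nonneg ha (hp.1 x)) (mul_nonneg hb (hq.1 x))
  · have h := (hp.2.mul_left a).add (hq.2.mul_left b)
    rw [mul_one, mul_one, hab] at h
    exact h

theorem ptMass_mem_densities (x : X) : ptMass x ∈ densities X := by
  classical
  refine ⟨fun y => ?_, ?_⟩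
  · rw [ptMass_apply]; split_ifs <;> norm_num
  · simp only [ptMass_apply]
    exact hasSum_ite_eq x 1

variable [Group X]

/-- The differences of a density and its translates. -/
def translationDefect (F : Finset X) : L1 X →ₗ[ℝ] (F → L1 X) :=
  LinearMap.pi fun x => permL1 (Equiv.mulLeft (x : X)) - LinearMap.id

theorem translationDefect_apply (F : Finset X) (p : L1 X) (x : F) :
    translationDefect F p x = permL1 (Equiv.mulLeft (x : X)) p - p := rfl

theorem translationDefect_ptMass (F : Finset X) (y : X) (x : F) :
    translationDefect F (ptMass y) x = ptMass ((x : X) * y) - ptMass y := by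
  rw [translationDefect_apply, permL1_ptMass]
  rfl

variable [TopologicalSpace X] [IsTopologicalGroup X] [DiscreteTopology X]

/-- The Day-Namioka argument. If densities were not almost invariant in ℓ¹, a separating functional
would produce a sum of differences of translates bounded below by a positive constant, which a
translation invariant mean cannot allow. -/
theorem IsAmenable.zero_mem_closure (h : IsAmenable X) (F : Finset X) :
    (0 : F → L1 X) ∈ closure (translationDefect F '' densities X) := by
  classical
  obtain ⟨m, hm0, hm1, hm⟩ := h
  by_contra h0
  have hconv : Convex ℝ (closure (translationDefect F '' densities X)) :=
    (convex_densities.linear_image _).closure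
  obtain ⟨f, c, hc, hf⟩ := geometric_hahn_banach_point_closed hconv isClosed_closure h0
  rw [map_zero] at hc
  let φ : F → L1 X →L[ℝ] ℝ := fun x => f.comp (ContinuousLinearMap.single ℝ (fun _ : F => L1 X) x)
  have hφ : ∀ v : F → L1 X, f v = ∑ x, φ x (v x) := by
    intro v
    conv_lhs => rw [← Finset.univ_sum_single v]
    rw [map_sum]
    rfl
  let k : F → X →ᵇ ℝ := fun x => BoundedContinuousFunction.ofNormedAddCommGroupDiscrete
    (fun y => φ x (ptMass y)) ‖φ x‖ fun y => by
      have := (φ x).le_opNorm (ptMass y)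
      rwa [norm_ptMass, mul_one] at this
  -- H(y) is the separating functional at the defect of the point mass at y: it exceeds c > 0
  -- everywhere, while its mean is 0 by invariance.
  let H : X →ᵇ ℝ := ∑ x : F, ((k x).compContinuous ⟨fun y => (x : X) * y, by fun_prop⟩ - k x)
  have hH : m H = 0 := by
    rw [map_sum]
    refine Finset.sum_eq_zero fun x _ => ?_
    rw [map_sub, hm, sub_self]
  have hH' : ∀ y, H y = f (translationDefect F (ptMass y)) := by
    intro y
    rw [hφ, BoundedContinuousFunction.sum_apply]
    refine Finset.sum_congr rfl fun x _ => ?_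
    rw [translationDefect_ptMass, map_sub]
    rfl
  have h1 : 0 ≤ H - c • (1 : X →ᵇ ℝ) := by
    intro y
    have := hf _ (subset_closure ⟨_, ptMass_mem_densities y, rfl⟩)
    rw [← hH'] at this
    change 0 ≤ H y - c * 1
    linarith
  have h2 := hm0 _ h1
  rw [map_sub, map_smul, hH, hm1, smul_eq_mul, mul_one] at h2
  linarith

/-- This passes from densities in ℓ¹ to their square roots in ℓ². -/
theorem sq_sqrt_sub_sqrt_le {a b : ℝ} (ha : 0 ≤ a) (hb : 0 ≤ b) :
    (√a - √b) ^ 2 ≤ |a - b| := by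
  have e : a - b = (√a - √b) * (√a + √b) := by
    nlinarith [Real.mul_self_sqrt ha, Real.mul_self_sqrt hb]
  rw [e, abs_mul, abs_of_nonneg (add_nonneg (Real.sqrt_nonneg a) (Real.sqrt_nonneg b)), ← sq_abs,
    sq]
  refine mul_le_mul_of_nonneg_left ?_ (abs_nonneg _)
  rw [abs_le]
  constructor <;> linarith [Real.sqrt_nonneg a, Real.sqrt_nonneg b]

theorem IsAmenable.hasAlmostInvariantVectors (h : IsAmenable X) :
    HasAlmostInvariantVectors X := by
  intro F ε hε
  -- The ℓ¹ tolerance is ε² because the squared ℓ² defect of the square root is bounded by the ℓ¹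
  -- defect.
  obtain ⟨_, ⟨p, hp, rfl⟩, hpε⟩ := Metric.mem_closure_iff.1 (h.zero_mem_closure F) (ε ^ 2)
    (by positivity)
  rw [dist_zero_left] at hpε
  have hsq : ∀ y, ‖((√(p y) : ℝ) : ℂ)‖ ^ 2 = p y := fun y => by
    rw [Complex.norm_real, Real.norm_eq_abs, sq_abs, Real.sq_sqrt (hp.1 y)]
  let v : L2 X := ⟨fun y => ((√(p y) : ℝ) : ℂ), by
    refine (memℓp_gen_iff (by norm_num)).2 ?_
    have : Summable fun y => ‖((√(p y) : ℝ) : ℂ)‖ ^ 2 := by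
      simp only [hsq]
      exact hp.2.summable
    simpa using this⟩
  refine ⟨v, ?_, fun x hx => ?_⟩
  · have h1 : ‖v‖ ^ 2 = 1 := by
      rw [norm_sq_L2]
      exact (tsum_congr hsq).trans hp.2.tsum_eq
    exact (pow_eq_one_iff_of_nonneg (norm_nonneg v) two_ne_zero).1 h1
  · have h1 : ‖permL1 (Equiv.mulLeft x) p - p‖ ≤ ε ^ 2 :=
      (norm_le_pi_norm (translationDefect F p) ⟨x, hx⟩).trans hpε.le
    refine le_of_sq_le_sq ?_ hε.le
    refine le_trans ?_ h1
    rw [norm_sq_L2, norm_L1]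
    have hs := summable_L1 (permL1 (Equiv.mulLeft x) p - p)
    have hle : ∀ y, ‖(lreg x v - v) y‖ ^ 2 ≤ |(permL1 (Equiv.mulLeft x) p - p) y| := by
      intro y
      change ‖((√(p (x⁻¹ * y)) : ℝ) : ℂ) - ((√(p y) : ℝ) : ℂ)‖ ^ 2 ≤ |p (x⁻¹ * y) - p y|
      rw [← Complex.ofReal_sub, Complex.norm_real, Real.norm_eq_abs, sq_abs]
      exact sq_sqrt_sub_sqrt_le (hp.1 _) (hp.1 _)
    exact Summable.tsum_le_tsum hle (hs.of_nonneg_of_le (fun _ => by positivity) hle) hs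

end Amenability

end CIdem

end

/-! ### Normality of N and of its conjugates; conclusion. -/

noncomputable section

namespace CIdem

set_option linter.unusedSectionVars false

section Main

variable {G : Type u} [Group G]

theorem normal_conj_iff (N : Subgroup G) (s : G) : (MulAut.conj s • N).Normal ↔ N.Normal := by
  constructor
  · intro h
    have h1 := Subgroup.Normal.conj_smul_eq_self s⁻¹ (MulAut.conj s • N)
    rw [map_inv, inv_smul_smul] at h1
    rwa [← h1] at h
  · intro h
    rwa [Subgroup.Normal.conj_smul_eq_self]

theorem inv_mul_leftCoset (N : Subgroup G) (s : G) :
    (s • (N : Set G))⁻¹ * (s • (N : Set G)) = N := by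
  ext g
  constructor
  · rintro ⟨a, ha, b, hb, rfl⟩
    rw [Set.mem_inv, Set.mem_smul_set_iff_inv_smul_mem] at ha
    rw [Set.mem_smul_set_iff_inv_smul_mem] at hb
    have h := N.mul_mem (N.inv_mem ha) hb
    simpa [mul_assoc] using h
  · intro hg
    exact ⟨s⁻¹, Set.mem_inv.2 (Set.mem_smul_set_iff_inv_smul_mem.2 (by simp)), s * g,
      Set.smul_mem_smul_set hg, by simp⟩

theorem exists_normal_iff (N : Subgroup G) :
    (∃ M : Subgroup G, M.Normal ∧ (M : Set G) = N) ↔ N.Normal :=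
  ⟨fun ⟨_, hM, h⟩ => SetLike.coe_injective h ▸ hM, fun h => ⟨N, h, rfl⟩⟩

variable [TopologicalSpace G] [IsTopologicalGroup G] [LocallyCompactSpace G] [MeasurableSpace G]
  [BorelSpace G]

theorem isHaarIdempotent_cosetFun_one_iff (hG : IsAmenable G) (N : Subgroup G)
    (hN : IsOpen (N : Set G)) : IsHaarIdempotent (cosetFun N hN 1) ↔ N.Normal := by
  refine ⟨normal_of_isHaarIdempotent N hN, fun h => ?_⟩
  have : DiscreteTopology (G ⧸ N) := QuotientGroup.discreteTopology hN
  exact isHaarIdempotent_cosetFun_one N hN (hG.quotient N).hasAlmostInvariantVectors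

end Main

end CIdem

end

theorem mainTheorem10 {G : Type u} [Group G] [TopologicalSpace G] [IsTopologicalGroup G]
    [T2Space G] [LocallyCompactSpace G] [MeasurableSpace G] [BorelSpace G]
    (hG : CIdem.IsAmenable G) :
    (∀ ω : StrongDual ℂ (CIdem.groupCStar G),
      CIdem.IsContractiveIdempotent ω ↔
        ∃ C : Set G, CIdem.IsOpenCoset C ∧ CIdem.Represents ω (C.indicator 1)) ∧
    (∀ C : Set G, CIdem.IsOpenCoset C →
      ∃ ω : StrongDual ℂ (CIdem.groupCStar G), CIdem.Represents ω (C.indicator 1)) ∧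
    (∀ (ω : StrongDual ℂ (CIdem.groupCStar G)) (C : Set G),
      CIdem.IsOpenCoset C → CIdem.Represents ω (C.indicator 1) →
      ∀ (u : StrongDual ℂ (StrongDual ℂ (CIdem.groupCStar G)))
        (τ : StrongDual ℂ (CIdem.groupCStar G)),
        CIdem.IsPolarDecomposition ω u τ →
        (CIdem.IsHaarIdempotent τ ↔
          ∃ N : Subgroup G, N.Normal ∧ (N : Set G) = C⁻¹ * C) ∧
        (CIdem.IsHaarIdempotent (CIdem.leftAbs u τ) ↔
          ∃ N : Subgroup G, N.Normal ∧ (N : Set G) = C⁻¹ * C)) := by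
  refine ⟨CIdem.isContractiveIdempotent_iff, fun C hC => ?_, fun ω C hC hω u τ hpol => ?_⟩
  · obtain ⟨N, hN, s, -, h⟩ := CIdem.exists_represents_of_isOpenCoset hC
    exact ⟨_, h⟩
  · obtain ⟨N, hN, s, rfl, h⟩ := CIdem.exists_represents_of_isOpenCoset hC
    rw [hω.functional_unique h] at hpol
    obtain ⟨hr, hl⟩ := CIdem.polar_cosetFun N hN hpol
    rw [CIdem.inv_mul_leftCoset, CIdem.exists_normal_iff, hl, hr, CIdem.vf_qv_self,
      CIdem.isHaarIdempotent_cosetFun_one_iff hG, CIdem.isHaarIdempotent_cosetFun_one_iff hG,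
      CIdem.normal_conj_iff]
    exact ⟨Iff.rfl, Iff.rfl⟩
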